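/- Let $\Bbbk$ be a field and let $K,H$ be Hopf algebras over $\Bbbk$ with bijective antipodes; write $\otimes=\otimes_\Bbbk$, $\Delta(h)=h_{(1)}\otimes h_{(2)}$, $\varepsilon$, $S$ for the structure maps, and $\delta(v)=v^{(-1)}\otimes v^{(0)}$ for left coactions. Let $\varphi\colon K\to H$ be a morphism of Hopf algebras. *Yetter–Drinfeld modules.* ${}^H_H\mathbf{YD}$ is the category of (left-left) Yetter–Drinfeld modules over $H$: vector spaces $V$ with a left $H$-action and a left $H$-coaction $\delta$ such that $h_{(1)}v^{(-1)}\otimes h_{(2)}v^{(0)}=(h_{(1)}v)^{(-1)}h_{(2)}\otimes (h_{(1)}v)^{(0)}$, with the $H$-linear and $H$-colinear maps as morphisms. It is monoidal under $\otimes$, with the diagonal action $h(v\otimes w)=h_{(1)}v\otimes h_{(2)}w$ and codiagonal coaction $\delta(v\otimes w)=v^{(-1)}w^{(-1)}\otimes (v^{(0)}\otimes w^{(0)})$, and braided by $\Psi(v\otimes w)=v^{(-1)}w\otimes v^{(0)}$. The categories of left modules and of left comodules over a Hopf algebra are monoidal in the same way. *Projection formula.* Let $G\dashv R$ be an adjunction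 with $G$ strong monoidal and unit $\eta$, and let $\mathrm{lax}_{X,Y}\colon RX\otimes RY\to R(X\otimes Y)$, $\mathrm{lax}^0\colon \mathbb 1\to R\mathbb 1$ be the induced lax monoidal structure on $R$. Put $\mathrm{lproj}_{A,X}=\mathrm{lax}_{GA,X}(\eta_A\otimes RX)\colon A\otimes RX\to R(GA\otimes X)$ and $\mathrm{rproj}_{X,A}=\mathrm{lax}_{X,GA}(RX\otimes\eta_A)\colon RX\otimes A\to R(X\otimes GA)$. The right adjoint $R$ satisfies the projection formula if all $\mathrm{lproj}_{A,X}$ and $\mathrm{rproj}_{X,A}$ are isomorphisms. **(1) Comodule induction.** Let $\operatorname{Res}^\varphi$ be the functor from left $K$-comodules to left $H$-comodules, $(V,\delta)\mapsto (V,(\varphi\otimes\mathrm{id})\delta)$. For a left $H$-comodule $W$ let $K\Box_H W\subseteq K\otimes W$ be the equalizer of $\mathrm{id}_K\otimes\delta_W$ and $(\mathrm{id}_K\otimes\varphi)\Delta_K\otimes\mathrm{id}_W$, with the $K$-coaction $k\otimes w\mapsto k_{(1)}\otimes(k_{(2)}\otimes w)$, and let $\operatorname{Ind}^\varphi(W)=K\Box_H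 W$. Then $\operatorname{Ind}^\varphi$ is right adjoint to $\operatorname{Res}^\varphi$ with unit $\delta_V\colon V\to K\Box_H V$ and counit $\varepsilon_K\otimes \mathrm{id}_W\colon K\Box_H W\to W$; its lax monoidal structure is the restriction of $(k\otimes v)\otimes(l\otimes w)\mapsto kl\otimes(v\otimes w)$ and $\Bbbk\to K\Box_H\Bbbk$, $c\mapsto 1\otimes c$; and $\operatorname{Ind}^\varphi$ satisfies the projection formula. Moreover $\operatorname{Ind}^\varphi$ induces a braided lax monoidal functor $F\colon {}^H_H\mathbf{YD}\to{}^K_K\mathbf{YD}$: up to a natural isomorphism, the $K$-comodule underlying $F(V)$ is $K\Box_H V$, with $F(f)$ the restriction of $\mathrm{id}_K\otimes f$ for every morphism $f$, the $K$-action on $F(V)$ is $$k\cdot(l\otimes v)=k_{(1)}\,l\,S(k_{(3)})\otimes\varphi(k_{(2)})v ,$$ the coaction is $l\otimes v\mapsto l_{(1)}\otimes(l_{(2)}\otimes v)$, and the lax monoidal structure of $F$ is that of $\operatorname{Ind}^\varphi$ given above. "Induces" means that, with $c_{A,V}\colon A\otimes V\to V\otimes A$, $a\otimes v\mapsto a^{(-1)}v\otimes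 a^{(0)}$, for a comodule $A$ and a Yetter–Drinfeld module $V$, one has $\mathrm{rproj}_{V,A}\circ c_{A,F(V)}=\operatorname{Ind}^\varphi(c_{\operatorname{Res}^\varphi A,V})\circ\mathrm{lproj}_{A,V}$ for every $V\in{}^H_H\mathbf{YD}$ and every $K$-comodule $A$. **(2) Coinduction of modules.** Assume that $H$ is finitely generated projective as a left $K$-module via $\varphi$. Let $\operatorname{Res}_\varphi$ be restriction of left $H$-modules to left $K$-modules along $\varphi$, and for a left $K$-module $V$ let $\operatorname{CoInd}_\varphi(V)=\operatorname{Hom}_K(H,V)$ with $H$-action $(hf)(g)=f(gh)$. Then for every vector space $W$ and every $K$-module $V$ the map $\alpha_{W,V}\colon W\otimes\operatorname{Hom}_K(H,V)\to\operatorname{Hom}_K(H,W^{\mathrm{triv}}\otimes V)$, $w\otimes f\mapsto(h\mapsto w\otimes f(h))$, is bijective, where $K$ acts on $W^{\mathrm{triv}}\otimes V$ by $k(w\otimes v)=w\otimes kv$. The functor $\operatorname{CoInd}_\varphi$ is right adjoint to $\operatorname{Res}_\varphi$ with unit $w\mapsto(h\mapsto hw)$ and counit $f\mapsto f(1)$;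 its lax monoidal structure is $f\otimes g\mapsto\big(h\mapsto f(h_{(1)})\otimes g(h_{(2)})\big)$ and $\Bbbk\to\operatorname{Hom}_K(H,\Bbbk)$, $c\mapsto(h\mapsto\varepsilon(h)c)$; and $\operatorname{CoInd}_\varphi$ satisfies the projection formula. Moreover $\operatorname{CoInd}_\varphi$ induces a braided lax monoidal functor $F\colon{}^K_K\mathbf{YD}\to{}^H_H\mathbf{YD}$: up to a natural isomorphism, the $H$-module underlying $F(V)$ is $\operatorname{Hom}_K(H,V)$, with $F(t)=\operatorname{Hom}_K(H,t)$ for every morphism $t$, the coaction of $F(V)$ is $$\delta(f)=\alpha_{H,V}^{-1}\Big(h\mapsto S(h_{(1)})\,\varphi\big(f(h_{(2)})^{(-1)}\big)\,h_{(3)}\otimes f(h_{(2)})^{(0)}\Big),$$ and the lax monoidal structure of $F$ is that of $\operatorname{CoInd}_\varphi$ given above. "Induces" means that, with $c_{V,A}\colon V\otimes A\to A\otimes V$, $v\otimes a\mapsto v^{(-1)}a\otimes v^{(0)}$, for a Yetter–Drinfeld module $V$ and a module $A$, one has $\mathrm{lproj}_{A,V}\circ c_{F(V),A}=\operatorname{CoInd}_\varphi(c_{V,\operatorname{Res}_\varphi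 A})\circ\mathrm{rproj}_{V,A}$ for every $V\in{}^K_K\mathbf{YD}$ and every $H$-module $A$. Finally, $F$ sends finite-dimensional Yetter–Drinfeld modules to finite-dimensional ones. -/

import Mathlib

open CategoryTheory MonoidalCategory
open scoped TensorProduct

universe u

namespace HopfInd

section Unbundled

variable {𝕜 : Type u} [Field 𝕜] {H : Type u} [Ring H]
  {V W U V' W' : Type u} [AddCommGroup V] [Module 𝕜 V] [AddCommGroup W] [Module 𝕜 W]
  [AddCommGroup U] [Module 𝕜 U] [AddCommGroup V'] [Module 𝕜 V'] [AddCommGroup W'] [Module 𝕜 W']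

section
variable [Algebra 𝕜 H]

/-- The map `h ↦ h v` of an action. -/
def orbit (ρ : H →ₐ[𝕜] Module.End 𝕜 V) (v : V) : H →ₗ[𝕜] V := ρ.toLinearMap.flip v

@[simp] theorem orbit_apply (ρ : H →ₐ[𝕜] Module.End 𝕜 V) (v : V) (h : H) :
    orbit ρ v h = ρ h v := rfl

theorem orbit_map {ρ : H →ₐ[𝕜] Module.End 𝕜 V} {σ : H →ₐ[𝕜] Module.End 𝕜 W} {f : V →ₗ[𝕜] W}
    (hf : ∀ h, f ∘ₗ ρ h = σ h ∘ₗ f) (v : V) : orbit σ (f v) = f ∘ₗ orbit ρ v := by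
  ext h; exact (LinearMap.congr_fun (hf h) v).symm

/-- For fixed `v`, the linear map `H ⊗ H → H ⊗ V`, `a ⊗ b ↦ a v⁽⁻¹⁾ ⊗ b v⁽⁰⁾`. -/
noncomputable def ydLeft (ρ : H →ₐ[𝕜] Module.End 𝕜 V) (δ : V →ₗ[𝕜] H ⊗[𝕜] V) (v : V) :
    H ⊗[𝕜] H →ₗ[𝕜] H ⊗[𝕜] V :=
  TensorProduct.lift (LinearMap.mk₂ 𝕜
    (fun a b => TensorProduct.map (LinearMap.mulLeft 𝕜 a) (ρ b) (δ v))
    (fun a a' b => by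
      rw [show LinearMap.mulLeft 𝕜 (a + a') = LinearMap.mulLeft 𝕜 a + LinearMap.mulLeft 𝕜 a' by
        ext; simp [add_mul], TensorProduct.map_add_left]; rfl)
    (fun c a b => by
      rw [show LinearMap.mulLeft 𝕜 (c • a) = c • LinearMap.mulLeft 𝕜 a by
        ext; simp, TensorProduct.map_smul_left]; rfl)
    (fun a b b' => by rw [map_add, TensorProduct.map_add_right]; rfl)
    (fun c a b => by rw [map_smul, TensorProduct.map_smul_right]; rfl))

@[simp] theorem ydLeft_tmul (ρ : H →ₐ[𝕜] Module.End 𝕜 V) (δ : V →ₗ[𝕜] H ⊗[𝕜] V) (v : V) (a b : H) :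
    ydLeft ρ δ v (a ⊗ₜ b) = TensorProduct.map (LinearMap.mulLeft 𝕜 a) (ρ b) (δ v) := rfl

/-- For fixed `v`, the linear map `H ⊗ H → H ⊗ V`, `a ⊗ b ↦ (a v)⁽⁻¹⁾ b ⊗ (a v)⁽⁰⁾`. -/
noncomputable def ydRight (ρ : H →ₐ[𝕜] Module.End 𝕜 V) (δ : V →ₗ[𝕜] H ⊗[𝕜] V) (v : V) :
    H ⊗[𝕜] H →ₗ[𝕜] H ⊗[𝕜] V :=
  TensorProduct.lift (LinearMap.mk₂ 𝕜
    (fun a b => (LinearMap.mulRight 𝕜 b).rTensor V (δ (ρ a v)))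
    (fun a a' b => by simp)
    (fun c a b => by simp)
    (fun a b b' => by
      rw [show LinearMap.mulRight 𝕜 (b + b') = LinearMap.mulRight 𝕜 b + LinearMap.mulRight 𝕜 b' by
        ext; simp [mul_add], LinearMap.rTensor_add]; rfl)
    (fun c a b => by
      rw [show LinearMap.mulRight 𝕜 (c • b) = c • LinearMap.mulRight 𝕜 b by
        ext; simp, LinearMap.rTensor_smul]; rfl))

@[simp] theorem ydRight_tmul (ρ : H →ₐ[𝕜] Module.End 𝕜 V) (δ : V →ₗ[𝕜] H ⊗[𝕜] V) (v : V) (a b : H) :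
    ydRight ρ δ v (a ⊗ₜ b) = (LinearMap.mulRight 𝕜 b).rTensor V (δ (ρ a v)) := rfl

end

variable [Bialgebra 𝕜 H]

/-- The action `h (v ⊗ w) = h₍₁₎ v ⊗ h₍₂₎ w` on a tensor product. -/
noncomputable def tensorAct (ρ : H →ₐ[𝕜] Module.End 𝕜 V) (σ : H →ₐ[𝕜] Module.End 𝕜 W) :
    H →ₐ[𝕜] Module.End 𝕜 (V ⊗[𝕜] W) :=
  (Module.endTensorEndAlgHom (R := 𝕜) (S := 𝕜) (A := 𝕜)).comp
    ((Algebra.TensorProduct.map ρ σ).comp (Bialgebra.comulAlgHom 𝕜 H))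

variable (𝕜 H) in
/-- The action `h c = ε(h) c` on the base field. -/
noncomputable def unitAct : H →ₐ[𝕜] Module.End 𝕜 𝕜 :=
  (Algebra.ofId 𝕜 (Module.End 𝕜 𝕜)).comp (Bialgebra.counitAlgHom 𝕜 H)

theorem tensorAct_tmul (ρ : H →ₐ[𝕜] Module.End 𝕜 V) (σ : H →ₐ[𝕜] Module.End 𝕜 W)
    (h : H) (v : V) (w : W) : tensorAct ρ σ h (v ⊗ₜ w) =
      TensorProduct.map (orbit ρ v) (orbit σ w) (Coalgebra.comul h) := by
  change (Module.endTensorEndAlgHom (R := 𝕜) (S := 𝕜) (A := 𝕜)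
    (Algebra.TensorProduct.map ρ σ (Coalgebra.comul h))) (v ⊗ₜ w) = _
  generalize (Coalgebra.comul h : H ⊗[𝕜] H) = x
  induction x with
  | zero => simp
  | tmul a b => simp [Module.endTensorEndAlgHom_apply]
  | add x y hx hy => simp only [map_add, LinearMap.add_apply, hx, hy]

theorem unitAct_apply (h : H) (c : 𝕜) : unitAct 𝕜 H h c = Coalgebra.counit (R := 𝕜) h * c := rfl

theorem orbit_tensor (ρ : H →ₐ[𝕜] Module.End 𝕜 V) (σ : H →ₐ[𝕜] Module.End 𝕜 W) (v : V) (w : W) :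
    orbit (tensorAct ρ σ) (v ⊗ₜ w) =
      TensorProduct.map (orbit ρ v) (orbit σ w) ∘ₗ Coalgebra.comul := by
  ext h; exact tensorAct_tmul ρ σ h v w

theorem orbit_unit (c : 𝕜) : orbit (unitAct 𝕜 H) c = c • Coalgebra.counit := by
  ext h; simp [unitAct_apply, mul_comm]

theorem tensorAct_map {ρ : H →ₐ[𝕜] Module.End 𝕜 V} {σ : H →ₐ[𝕜] Module.End 𝕜 W}
    {ρ' : H →ₐ[𝕜] Module.End 𝕜 V'} {σ' : H →ₐ[𝕜] Module.End 𝕜 W'} {f : V →ₗ[𝕜] V'} {g : W →ₗ[𝕜] W'}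
    (hf : ∀ h, f ∘ₗ ρ h = ρ' h ∘ₗ f) (hg : ∀ h, g ∘ₗ σ h = σ' h ∘ₗ g) (h : H) :
    TensorProduct.map f g ∘ₗ tensorAct ρ σ h = tensorAct ρ' σ' h ∘ₗ TensorProduct.map f g := by
  ext v w
  simp [tensorAct_tmul, orbit_map hf, orbit_map hg, TensorProduct.map_comp]

theorem tensorAct_assoc (ρ : H →ₐ[𝕜] Module.End 𝕜 V) (σ : H →ₐ[𝕜] Module.End 𝕜 W)
    (τ : H →ₐ[𝕜] Module.End 𝕜 U) (h : H) :
    (TensorProduct.assoc 𝕜 V W U).toLinearMap ∘ₗ tensorAct (tensorAct ρ σ) τ h =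
      tensorAct ρ (tensorAct σ τ) h ∘ₗ (TensorProduct.assoc 𝕜 V W U).toLinearMap := by
  ext v w u
  have := congr(TensorProduct.map (orbit ρ v) (TensorProduct.map (orbit σ w) (orbit τ u))
    $(Coalgebra.coassoc_apply (R := 𝕜) h))
  simp only [TensorProduct.AlgebraTensorModule.curry_apply, LinearMap.restrictScalars_self,
    TensorProduct.curry_apply, LinearMap.comp_apply, LinearEquiv.coe_coe, tensorAct_tmul,
    orbit_tensor, TensorProduct.assoc_tmul]
  rw [show TensorProduct.map (TensorProduct.map (orbit ρ v) (orbit σ w) ∘ₗ Coalgebra.comul)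
      (orbit τ u) = TensorProduct.map (TensorProduct.map (orbit ρ v) (orbit σ w)) (orbit τ u) ∘ₗ
        (Coalgebra.comul (R := 𝕜) (A := H)).rTensor H by
      rw [LinearMap.map_comp_rTensor],
    show TensorProduct.map (orbit ρ v) (TensorProduct.map (orbit σ w) (orbit τ u) ∘ₗ
      Coalgebra.comul) = TensorProduct.map (orbit ρ v) (TensorProduct.map (orbit σ w) (orbit τ u)) ∘ₗ
        (Coalgebra.comul (R := 𝕜) (A := H)).lTensor H by
      rw [LinearMap.map_comp_lTensor]]
  refine Eq.trans ?_ this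
  simp only [LinearMap.comp_apply]
  generalize (Coalgebra.comul (R := 𝕜) (A := H)).rTensor H (Coalgebra.comul h) = x
  induction x using TensorProduct.induction_on with
  | zero => simp
  | add x y hx hy => simp only [map_add, hx, hy]
  | tmul x c =>
    induction x using TensorProduct.induction_on with
    | zero => simp
    | add x y hx hy => simp only [map_add, TensorProduct.add_tmul, hx, hy]
    | tmul a b => simp

theorem tensorAct_lid (ρ : H →ₐ[𝕜] Module.End 𝕜 V) (h : H) :
    (TensorProduct.lid 𝕜 V).toLinearMap ∘ₗ tensorAct (unitAct 𝕜 H) ρ h =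
      ρ h ∘ₗ (TensorProduct.lid 𝕜 V).toLinearMap := by
  ext v
  have := congr(TensorProduct.lid 𝕜 V ((orbit ρ v).lTensor 𝕜
    $(Coalgebra.rTensor_counit_comul (R := 𝕜) h)))
  rw [← LinearMap.comp_apply, LinearMap.lTensor_comp_rTensor] at this
  simpa [tensorAct_tmul, orbit_unit] using this

theorem tensorAct_rid (ρ : H →ₐ[𝕜] Module.End 𝕜 V) (h : H) :
    (TensorProduct.rid 𝕜 V).toLinearMap ∘ₗ tensorAct ρ (unitAct 𝕜 H) h =
      ρ h ∘ₗ (TensorProduct.rid 𝕜 V).toLinearMap := by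
  ext v
  have := congr(TensorProduct.rid 𝕜 V ((orbit ρ v).rTensor 𝕜
    $(Coalgebra.lTensor_counit_comul (R := 𝕜) h)))
  rw [← LinearMap.comp_apply, LinearMap.rTensor_comp_lTensor] at this
  simpa [tensorAct_tmul, orbit_unit] using this

/-- The linear map `(a ⊗ v) ⊗ (b ⊗ w) ↦ a b ⊗ (v ⊗ w)`. -/
noncomputable def mulTensor (H V W : Type u) [Ring H] [Bialgebra 𝕜 H] [AddCommGroup V] [Module 𝕜 V]
    [AddCommGroup W] [Module 𝕜 W] :
    (H ⊗[𝕜] V) ⊗[𝕜] (H ⊗[𝕜] W) →ₗ[𝕜] H ⊗[𝕜] (V ⊗[𝕜] W) :=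
  (LinearMap.mul' 𝕜 H).rTensor (V ⊗[𝕜] W) ∘ₗ
    (TensorProduct.tensorTensorTensorComm 𝕜 H V H W).toLinearMap

@[simp] theorem mulTensor_tmul (a b : H) (v : V) (w : W) :
    mulTensor (𝕜 := 𝕜) H V W ((a ⊗ₜ v) ⊗ₜ (b ⊗ₜ w)) = (a * b) ⊗ₜ (v ⊗ₜ w) := rfl

/-- The coaction `v ⊗ w ↦ v⁽⁻¹⁾ w⁽⁻¹⁾ ⊗ (v⁽⁰⁾ ⊗ w⁽⁰⁾)` on a tensor product. -/
noncomputable def tensorCoact (δ : V →ₗ[𝕜] H ⊗[𝕜] V) (γ : W →ₗ[𝕜] H ⊗[𝕜] W) :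
    V ⊗[𝕜] W →ₗ[𝕜] H ⊗[𝕜] (V ⊗[𝕜] W) :=
  mulTensor H V W ∘ₗ TensorProduct.map δ γ

theorem mulTensor_natural (f : V →ₗ[𝕜] V') (g : W →ₗ[𝕜] W') :
    mulTensor H V' W' ∘ₗ TensorProduct.map (f.lTensor H) (g.lTensor H) =
      (TensorProduct.map f g).lTensor H ∘ₗ mulTensor H V W := by
  ext a v b w; simp

theorem tensorCoact_map {δ : V →ₗ[𝕜] H ⊗[𝕜] V} {γ : W →ₗ[𝕜] H ⊗[𝕜] W}
    {δ' : V' →ₗ[𝕜] H ⊗[𝕜] V'} {γ' : W' →ₗ[𝕜] H ⊗[𝕜] W'} {f : V →ₗ[𝕜] V'} {g : W →ₗ[𝕜] W'}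
    (hf : δ' ∘ₗ f = f.lTensor H ∘ₗ δ) (hg : γ' ∘ₗ g = g.lTensor H ∘ₗ γ) :
    tensorCoact δ' γ' ∘ₗ TensorProduct.map f g =
      (TensorProduct.map f g).lTensor H ∘ₗ tensorCoact δ γ := by
  rw [tensorCoact, LinearMap.comp_assoc, ← TensorProduct.map_comp, hf, hg, TensorProduct.map_comp,
    ← LinearMap.comp_assoc, mulTensor_natural, LinearMap.comp_assoc]; rfl

/-- The comodule axioms for a linear map `δ : V → H ⊗ V`. -/
structure IsCoact (δ : V →ₗ[𝕜] H ⊗[𝕜] V) : Prop where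
  coassoc : (TensorProduct.assoc 𝕜 H H V).toLinearMap ∘ₗ
    (Coalgebra.comul (R := 𝕜) (A := H)).rTensor V ∘ₗ δ = δ.lTensor H ∘ₗ δ
  counit : (Coalgebra.counit (R := 𝕜) (A := H)).rTensor V ∘ₗ δ = TensorProduct.mk 𝕜 𝕜 V 1

theorem mulTensor_comul : (TensorProduct.assoc 𝕜 H H (V ⊗[𝕜] W)).toLinearMap ∘ₗ
      (Coalgebra.comul (R := 𝕜) (A := H)).rTensor (V ⊗[𝕜] W) ∘ₗ mulTensor H V W =
    (mulTensor H V W).lTensor H ∘ₗ mulTensor H (H ⊗[𝕜] V) (H ⊗[𝕜] W) ∘ₗ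
      TensorProduct.map ((TensorProduct.assoc 𝕜 H H V).toLinearMap ∘ₗ
          (Coalgebra.comul (R := 𝕜) (A := H)).rTensor V)
        ((TensorProduct.assoc 𝕜 H H W).toLinearMap ∘ₗ
          (Coalgebra.comul (R := 𝕜) (A := H)).rTensor W) := by
  ext a v b w
  simp only [TensorProduct.AlgebraTensorModule.curry_apply, LinearMap.restrictScalars_self,
    TensorProduct.curry_apply, LinearMap.comp_apply, LinearEquiv.coe_coe, mulTensor_tmul,
    LinearMap.rTensor_tmul, TensorProduct.map_tmul, Bialgebra.comul_mul]
  generalize (Coalgebra.comul a : H ⊗[𝕜] H) = x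
  generalize (Coalgebra.comul b : H ⊗[𝕜] H) = y
  induction x using TensorProduct.induction_on with
  | zero => simp
  | add x y hx hy => simp only [add_mul, map_add, TensorProduct.add_tmul, hx, hy]
  | tmul a a' =>
    induction y using TensorProduct.induction_on with
    | zero => simp
    | add x y hx hy =>
      simp only [mul_add, map_add, TensorProduct.add_tmul, TensorProduct.tmul_add, hx, hy]
    | tmul b b' => simp

theorem mulTensor_counit : (Coalgebra.counit (R := 𝕜) (A := H)).rTensor (V ⊗[𝕜] W) ∘ₗ
      mulTensor H V W =
    (TensorProduct.lid 𝕜 (V ⊗[𝕜] W)).symm.toLinearMap ∘ₗ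
      TensorProduct.map (TensorProduct.lid 𝕜 V).toLinearMap (TensorProduct.lid 𝕜 W).toLinearMap ∘ₗ
      TensorProduct.map ((Coalgebra.counit (R := 𝕜) (A := H)).rTensor V)
        ((Coalgebra.counit (R := 𝕜) (A := H)).rTensor W) := by
  ext a v b w
  simp only [TensorProduct.AlgebraTensorModule.curry_apply, LinearMap.restrictScalars_self,
    TensorProduct.curry_apply, LinearMap.comp_apply, LinearEquiv.coe_coe, mulTensor_tmul,
    LinearMap.rTensor_tmul, TensorProduct.map_tmul, Bialgebra.counit_mul, TensorProduct.lid_tmul,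
    TensorProduct.lid_symm_apply, TensorProduct.smul_tmul_smul]
  rw [← TensorProduct.smul_tmul, smul_eq_mul, mul_one]

theorem IsCoact.tensor {δ : V →ₗ[𝕜] H ⊗[𝕜] V} {γ : W →ₗ[𝕜] H ⊗[𝕜] W} (hδ : IsCoact δ)
    (hγ : IsCoact γ) : IsCoact (tensorCoact δ γ) where
  coassoc := by
    have h1 := congr($(mulTensor_comul (𝕜 := 𝕜) (H := H) (V := V) (W := W)) ∘ₗ TensorProduct.map δ γ)
    simp only [LinearMap.comp_assoc, ← TensorProduct.map_comp, hδ.coassoc, hγ.coassoc] at h1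
    rw [tensorCoact, h1, TensorProduct.map_comp, ← LinearMap.comp_assoc (TensorProduct.map δ γ),
      mulTensor_natural, LinearMap.lTensor_comp]
    simp only [LinearMap.comp_assoc]
  counit := by
    have h1 := congr($(mulTensor_counit (𝕜 := 𝕜) (H := H) (V := V) (W := W)) ∘ₗ TensorProduct.map δ γ)
    simp only [LinearMap.comp_assoc, ← TensorProduct.map_comp, hδ.counit, hγ.counit] at h1
    rw [tensorCoact, h1]
    ext v w; simp

variable (𝕜 H) in
/-- The coaction `c ↦ 1 ⊗ c` on the base field. -/
noncomputable def unitCoact : 𝕜 →ₗ[𝕜] H ⊗[𝕜] 𝕜 := TensorProduct.mk 𝕜 H 𝕜 1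

theorem unitCoact_isCoact : IsCoact (unitCoact 𝕜 H) where
  coassoc := by ext; simp [unitCoact, Algebra.TensorProduct.one_def]
  counit := by ext; simp [unitCoact]

theorem tensorCoact_assoc (δ : V →ₗ[𝕜] H ⊗[𝕜] V) (γ : W →ₗ[𝕜] H ⊗[𝕜] W)
    (κ : U →ₗ[𝕜] H ⊗[𝕜] U) :
    tensorCoact δ (tensorCoact γ κ) ∘ₗ (TensorProduct.assoc 𝕜 V W U).toLinearMap =
      (TensorProduct.assoc 𝕜 V W U).toLinearMap.lTensor H ∘ₗ
        tensorCoact (tensorCoact δ γ) κ := by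
  ext v w u
  simp only [tensorCoact, TensorProduct.AlgebraTensorModule.curry_apply,
    LinearMap.restrictScalars_self,
    TensorProduct.curry_apply, LinearMap.comp_apply, LinearEquiv.coe_coe,
    TensorProduct.assoc_tmul, TensorProduct.map_tmul]
  generalize δ v = x
  generalize γ w = y
  generalize κ u = z
  induction x using TensorProduct.induction_on with
  | zero => simp
  | add x y hx hy => simp only [map_add, TensorProduct.add_tmul, hx, hy]
  | tmul a v =>
    induction y using TensorProduct.induction_on with
    | zero => simp
    | add x y hx hy => simp only [map_add, TensorProduct.add_tmul, TensorProduct.tmul_add, hx, hy]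
    | tmul b w =>
      induction z using TensorProduct.induction_on with
      | zero => simp
      | add x y hx hy =>
        simp only [map_add, TensorProduct.tmul_add, hx, hy]
      | tmul c u => simp [mul_assoc]

theorem tensorCoact_lid (δ : V →ₗ[𝕜] H ⊗[𝕜] V) :
    δ ∘ₗ (TensorProduct.lid 𝕜 V).toLinearMap =
      (TensorProduct.lid 𝕜 V).toLinearMap.lTensor H ∘ₗ tensorCoact (unitCoact 𝕜 H) δ := by
  ext v
  simp only [tensorCoact, unitCoact, TensorProduct.AlgebraTensorModule.curry_apply,
    LinearMap.restrictScalars_self,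
    TensorProduct.curry_apply, LinearMap.comp_apply, LinearEquiv.coe_coe,
    TensorProduct.lid_tmul, TensorProduct.map_tmul, one_smul, TensorProduct.mk_apply]
  generalize δ v = x
  induction x using TensorProduct.induction_on with
  | zero => simp
  | add x y hx hy => simp only [map_add, TensorProduct.tmul_add, ← hx, ← hy]
  | tmul a v => simp

theorem tensorCoact_rid (δ : V →ₗ[𝕜] H ⊗[𝕜] V) :
    δ ∘ₗ (TensorProduct.rid 𝕜 V).toLinearMap =
      (TensorProduct.rid 𝕜 V).toLinearMap.lTensor H ∘ₗ tensorCoact δ (unitCoact 𝕜 H) := by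
  ext v
  simp only [tensorCoact, unitCoact, TensorProduct.AlgebraTensorModule.curry_apply,
    LinearMap.restrictScalars_self,
    TensorProduct.curry_apply, LinearMap.comp_apply, LinearEquiv.coe_coe,
    TensorProduct.rid_tmul, TensorProduct.map_tmul, one_smul, TensorProduct.mk_apply]
  generalize δ v = x
  induction x using TensorProduct.induction_on with
  | zero => simp
  | add x y hx hy => simp only [map_add, TensorProduct.add_tmul, ← hx, ← hy]
  | tmul a v => simp

/-- The Yetter--Drinfeld condition
`h₍₁₎ v⁽⁻¹⁾ ⊗ h₍₂₎ v⁽⁰⁾ = (h₍₁₎ v)⁽⁻¹⁾ h₍₂₎ ⊗ (h₍₁₎ v)⁽⁰⁾`. -/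
def IsYD (ρ : H →ₐ[𝕜] Module.End 𝕜 V) (δ : V →ₗ[𝕜] H ⊗[𝕜] V) : Prop :=
  ∀ (h : H) (v : V), ydLeft ρ δ v (Coalgebra.comul h) = ydRight ρ δ v (Coalgebra.comul h)

theorem IsYD.comp {ρ : H →ₐ[𝕜] Module.End 𝕜 V} {δ : V →ₗ[𝕜] H ⊗[𝕜] V} (h : IsYD ρ δ) (v : V) :
    ydLeft ρ δ v ∘ₗ Coalgebra.comul = ydRight ρ δ v ∘ₗ Coalgebra.comul :=
  LinearMap.ext fun a => h a v

theorem IsYD.tensor {ρ : H →ₐ[𝕜] Module.End 𝕜 V} {δ : V →ₗ[𝕜] H ⊗[𝕜] V}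
    {σ : H →ₐ[𝕜] Module.End 𝕜 W} {γ : W →ₗ[𝕜] H ⊗[𝕜] W} (hV : IsYD ρ δ) (hW : IsYD σ γ) :
    IsYD (tensorAct ρ σ) (tensorCoact δ γ) := by
  intro h x
  induction x using TensorProduct.induction_on with
  | zero =>
    rw [show ydLeft (tensorAct ρ σ) (tensorCoact δ γ) 0 = 0 by ext; simp,
      show ydRight (tensorAct ρ σ) (tensorCoact δ γ) 0 = 0 by ext; simp]
  | add x y hx hy =>
    rw [show ydLeft (tensorAct ρ σ) (tensorCoact δ γ) (x + y) =
        ydLeft (tensorAct ρ σ) (tensorCoact δ γ) x + ydLeft (tensorAct ρ σ) (tensorCoact δ γ) y by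
          ext; simp,
      show ydRight (tensorAct ρ σ) (tensorCoact δ γ) (x + y) =
        ydRight (tensorAct ρ σ) (tensorCoact δ γ) x + ydRight (tensorAct ρ σ) (tensorCoact δ γ) y by
          ext; simp, LinearMap.add_apply, LinearMap.add_apply, hx, hy]
  | tmul v w =>
    have e1 : ydLeft (tensorAct ρ σ) (tensorCoact δ γ) (v ⊗ₜ w) =
        mulTensor H V W ∘ₗ TensorProduct.map (ydLeft ρ δ v) (ydLeft σ γ w ∘ₗ TensorProduct.mk 𝕜 H H 1)
          ∘ₗ (TensorProduct.assoc 𝕜 H H H).symm.toLinearMap ∘ₗ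
            (Coalgebra.comul (R := 𝕜) (A := H)).lTensor H := by
      ext a b
      simp only [TensorProduct.AlgebraTensorModule.curry_apply, LinearMap.restrictScalars_self,
        TensorProduct.curry_apply, LinearMap.comp_apply, LinearEquiv.coe_coe, ydLeft_tmul,
        LinearMap.lTensor_tmul, tensorCoact, TensorProduct.map_tmul]
      change TensorProduct.map (LinearMap.mulLeft 𝕜 a)
        (Module.endTensorEndAlgHom (R := 𝕜) (S := 𝕜) (A := 𝕜)
          (Algebra.TensorProduct.map ρ σ (Coalgebra.comul b))) _ = _
      generalize (Coalgebra.comul b : H ⊗[𝕜] H) = y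
      induction y using TensorProduct.induction_on with
      | zero => simp
      | add y z hy hz =>
        simp only [map_add, TensorProduct.map_add_right, LinearMap.add_apply,
          TensorProduct.tmul_add, hy, hz]
      | tmul b c =>
        simp only [TensorProduct.assoc_symm_tmul, TensorProduct.map_tmul, ydLeft_tmul,
          LinearMap.comp_apply, TensorProduct.mk_apply, Algebra.TensorProduct.map_tmul,
          Module.endTensorEndAlgHom_apply]
        generalize δ v = x
        generalize γ w = y
        induction x using TensorProduct.induction_on with
        | zero => simp
        | add x x' hx hx' => simp only [map_add, TensorProduct.add_tmul, hx, hx']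
        | tmul p v =>
          induction y using TensorProduct.induction_on with
          | zero => simp
          | add x x' hx hx' => simp only [map_add, TensorProduct.tmul_add, hx, hx']
          | tmul q w => simp [mul_assoc]
    have e2 : ydRight (tensorAct ρ σ) (tensorCoact δ γ) (v ⊗ₜ w) =
        mulTensor H V W ∘ₗ TensorProduct.map (δ ∘ₗ orbit ρ v) (ydRight σ γ w)
          ∘ₗ (TensorProduct.assoc 𝕜 H H H).toLinearMap ∘ₗ
            (Coalgebra.comul (R := 𝕜) (A := H)).rTensor H := by
      ext a b
      simp only [TensorProduct.AlgebraTensorModule.curry_apply, LinearMap.restrictScalars_self,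
        TensorProduct.curry_apply, LinearMap.comp_apply, LinearEquiv.coe_coe, ydRight_tmul,
        LinearMap.rTensor_tmul, tensorCoact, tensorAct_tmul]
      generalize (Coalgebra.comul a : H ⊗[𝕜] H) = y
      induction y using TensorProduct.induction_on with
      | zero => simp
      | add y z hy hz => simp only [map_add, TensorProduct.add_tmul, hy, hz]
      | tmul a c =>
        simp only [TensorProduct.map_tmul, orbit_apply, TensorProduct.assoc_tmul, ydRight_tmul,
          LinearMap.comp_apply]
        generalize δ (ρ a v) = x
        generalize γ (σ c w) = y
        induction x using TensorProduct.induction_on with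
        | zero => simp
        | add x x' hx hx' => simp only [map_add, TensorProduct.add_tmul, hx, hx']
        | tmul p v =>
          induction y using TensorProduct.induction_on with
          | zero => simp
          | add x x' hx hx' => simp only [map_add, TensorProduct.tmul_add, hx, hx']
          | tmul q w => simp [mul_assoc]
    have e3 : mulTensor H V W ∘ₗ TensorProduct.map (ydRight ρ δ v)
          (ydLeft σ γ w ∘ₗ TensorProduct.mk 𝕜 H H 1) =
        mulTensor H V W ∘ₗ TensorProduct.map (δ ∘ₗ orbit ρ v) (ydLeft σ γ w) ∘ₗ
          (TensorProduct.assoc 𝕜 H H H).toLinearMap := by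
      ext a b c
      simp only [TensorProduct.AlgebraTensorModule.curry_apply, LinearMap.restrictScalars_self,
        TensorProduct.curry_apply, LinearMap.comp_apply, LinearEquiv.coe_coe, ydRight_tmul,
        TensorProduct.map_tmul, TensorProduct.assoc_tmul, TensorProduct.mk_apply, ydLeft_tmul,
        orbit_apply]
      generalize δ (ρ a v) = x
      generalize γ w = y
      induction x using TensorProduct.induction_on with
      | zero => simp
      | add x x' hx hx' => simp only [map_add, TensorProduct.add_tmul, hx, hx']
      | tmul p v =>
        induction y using TensorProduct.induction_on with
        | zero => simp
        | add x x' hx hx' => simp only [map_add, TensorProduct.tmul_add, hx, hx']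
        | tmul q w => simp [mul_assoc]
    have e4 : ydLeft (tensorAct ρ σ) (tensorCoact δ γ) (v ⊗ₜ w) ∘ₗ Coalgebra.comul =
        ydRight (tensorAct ρ σ) (tensorCoact δ γ) (v ⊗ₜ w) ∘ₗ Coalgebra.comul := by
      calc _ = mulTensor H V W ∘ₗ TensorProduct.map (ydLeft ρ δ v)
              (ydLeft σ γ w ∘ₗ TensorProduct.mk 𝕜 H H 1) ∘ₗ
              (Coalgebra.comul (R := 𝕜) (A := H)).rTensor H ∘ₗ Coalgebra.comul := by
            rw [e1]; simp only [LinearMap.comp_assoc, Coalgebra.coassoc_symm]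
        _ = (mulTensor H V W ∘ₗ TensorProduct.map (ydRight ρ δ v)
              (ydLeft σ γ w ∘ₗ TensorProduct.mk 𝕜 H H 1)) ∘ₗ
              (Coalgebra.comul (R := 𝕜) (A := H)).rTensor H ∘ₗ Coalgebra.comul := by
            have := congr(mulTensor H V W ∘ₗ TensorProduct.map $(hV.comp v)
              (ydLeft σ γ w ∘ₗ TensorProduct.mk 𝕜 H H 1) ∘ₗ Coalgebra.comul)
            simpa only [← LinearMap.map_comp_rTensor, LinearMap.comp_assoc] using this
        _ = mulTensor H V W ∘ₗ TensorProduct.map (δ ∘ₗ orbit ρ v) (ydLeft σ γ w) ∘ₗ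
              (Coalgebra.comul (R := 𝕜) (A := H)).lTensor H ∘ₗ Coalgebra.comul := by
            rw [e3]; simp only [LinearMap.comp_assoc, Coalgebra.coassoc]
        _ = mulTensor H V W ∘ₗ TensorProduct.map (δ ∘ₗ orbit ρ v) (ydRight σ γ w) ∘ₗ
              (Coalgebra.comul (R := 𝕜) (A := H)).lTensor H ∘ₗ Coalgebra.comul := by
            have := congr(mulTensor H V W ∘ₗ TensorProduct.map (δ ∘ₗ orbit ρ v) $(hW.comp w) ∘ₗ
              Coalgebra.comul)
            simpa only [← LinearMap.map_comp_lTensor, LinearMap.comp_assoc] using this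
        _ = _ := by
            rw [e2]; simp only [LinearMap.comp_assoc, Coalgebra.coassoc]
    exact LinearMap.congr_fun e4 h

theorem unit_isYD : IsYD (unitAct 𝕜 H) (unitCoact 𝕜 H) := by
  intro h c
  have h1 : ydLeft (unitAct 𝕜 H) (unitCoact 𝕜 H) c =
      c • (Coalgebra.counit (R := 𝕜) (A := H)).lTensor H := by
    ext a b; simp [unitCoact, unitAct_apply, ← TensorProduct.tmul_smul, mul_comm]
  have h2 : ydRight (unitAct 𝕜 H) (unitCoact 𝕜 H) c =
      c • (TensorProduct.comm 𝕜 𝕜 H).toLinearMap ∘ₗ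
        (Coalgebra.counit (R := 𝕜) (A := H)).rTensor H := by
    ext a b; simp [unitCoact, unitAct_apply, ← TensorProduct.tmul_smul, mul_comm]
  rw [h1, h2]; simp

/-- The map `x ⊗ w ↦ x⁽⁻¹⁾ w ⊗ x⁽⁰⁾`, where `δ x = x⁽⁻¹⁾ ⊗ x⁽⁰⁾`. -/
noncomputable def braid (δ : U →ₗ[𝕜] H ⊗[𝕜] V) (σ : H →ₐ[𝕜] Module.End 𝕜 W) :
    U ⊗[𝕜] W →ₗ[𝕜] W ⊗[𝕜] V :=
  TensorProduct.lift (LinearMap.mk₂ 𝕜 (fun x w => (orbit σ w).rTensor V (δ x))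
    (fun x y w => by simp) (fun c x w => by simp)
    (fun x w w' => by
      rw [show orbit σ (w + w') = orbit σ w + orbit σ w' by ext; simp, LinearMap.rTensor_add]; rfl)
    (fun c x w => by
      rw [show orbit σ (c • w) = c • orbit σ w by ext; simp, LinearMap.rTensor_smul]; rfl))

@[simp] theorem braid_tmul (δ : U →ₗ[𝕜] H ⊗[𝕜] V) (σ : H →ₐ[𝕜] Module.End 𝕜 W) (x : U) (w : W) :
    braid δ σ (x ⊗ₜ w) = (orbit σ w).rTensor V (δ x) := rfl

theorem braid_linear {ρ : H →ₐ[𝕜] Module.End 𝕜 V} {δ : V →ₗ[𝕜] H ⊗[𝕜] V} (hV : IsYD ρ δ)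
    (σ : H →ₐ[𝕜] Module.End 𝕜 W) (h : H) :
    braid δ σ ∘ₗ tensorAct ρ σ h = tensorAct σ ρ h ∘ₗ braid δ σ := by
  ext v w
  have h1 : ∀ x : H ⊗[𝕜] H, braid δ σ (TensorProduct.map (orbit ρ v) (orbit σ w) x) =
      (orbit σ w).rTensor V (ydRight ρ δ v x) := by
    intro x
    induction x using TensorProduct.induction_on with
    | zero => simp
    | add x y hx hy => simp only [map_add, hx, hy]
    | tmul a b =>
      simp only [TensorProduct.map_tmul, orbit_apply, braid_tmul, ydRight_tmul]
      generalize δ (ρ a v) = x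
      induction x using TensorProduct.induction_on with
      | zero => simp
      | add x y hx hy => simp only [map_add, hx, hy]
      | tmul a b => simp
  have h2 : (orbit σ w).rTensor V (ydLeft ρ δ v (Coalgebra.comul h)) =
      tensorAct σ ρ h ((orbit σ w).rTensor V (δ v)) := by
    have : ∀ y : H ⊗[𝕜] V, tensorAct σ ρ h ((orbit σ w).rTensor V y) =
      (orbit σ w).rTensor V (Module.endTensorEndAlgHom (R := 𝕜) (S := 𝕜) (A := 𝕜)
        (Algebra.TensorProduct.map (Algebra.lmul 𝕜 H) ρ (Coalgebra.comul h)) y) := by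
      intro y
      rw [tensorAct]
      change Module.endTensorEndAlgHom (R := 𝕜) (S := 𝕜) (A := 𝕜)
        (Algebra.TensorProduct.map σ ρ (Coalgebra.comul h)) _ = _
      generalize (Coalgebra.comul h : H ⊗[𝕜] H) = x
      induction x using TensorProduct.induction_on with
      | zero => simp
      | add x y hx hy => simp only [map_add, hx, hy, LinearMap.add_apply]
      | tmul a b =>
        induction y using TensorProduct.induction_on with
        | zero => simp
        | add x y hx hy => simp only [map_add, hx, hy]
        | tmul p q => simp [Module.endTensorEndAlgHom_apply]
    rw [this]
    congr 1
    generalize (Coalgebra.comul h : H ⊗[𝕜] H) = x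
    induction x using TensorProduct.induction_on with
    | zero => simp
    | add x y hx hy => simp only [map_add, hx, hy, LinearMap.add_apply]
    | tmul a b => simp [Module.endTensorEndAlgHom_apply]; rfl
  simp only [TensorProduct.AlgebraTensorModule.curry_apply, LinearMap.restrictScalars_self,
    TensorProduct.curry_apply, LinearMap.comp_apply, tensorAct_tmul, h1, ← hV h v, h2, braid_tmul]

theorem braid_colinear {δ : V →ₗ[𝕜] H ⊗[𝕜] V} (hδ : IsCoact δ)
    {σ : H →ₐ[𝕜] Module.End 𝕜 W} {γ : W →ₗ[𝕜] H ⊗[𝕜] W} (hW : IsYD σ γ) :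
    tensorCoact γ δ ∘ₗ braid δ σ = (braid δ σ).lTensor H ∘ₗ tensorCoact δ γ := by
  ext v w
  have co := LinearMap.congr_fun hδ.coassoc v
  simp only [LinearMap.comp_apply, LinearEquiv.coe_coe] at co
  have h1 : ∀ y : H ⊗[𝕜] V, tensorCoact γ δ ((orbit σ w).rTensor V y) =
      TensorProduct.assoc 𝕜 H W V ((ydRight σ γ w).rTensor V
        ((TensorProduct.assoc 𝕜 H H V).symm (δ.lTensor H y))) := by
    intro y
    induction y using TensorProduct.induction_on with
    | zero => simp
    | add x y hx hy => simp only [map_add, hx, hy]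
    | tmul a v =>
      simp only [tensorCoact, LinearMap.comp_apply, LinearMap.rTensor_tmul, orbit_apply,
        TensorProduct.map_tmul, LinearMap.lTensor_tmul]
      generalize δ v = y
      induction y using TensorProduct.induction_on with
      | zero => simp
      | add x y hx hy => simp only [map_add, TensorProduct.tmul_add, hx, hy]
      | tmul b v =>
        simp only [TensorProduct.assoc_symm_tmul, LinearMap.rTensor_tmul, ydRight_tmul]
        generalize γ (σ a w) = z
        induction z using TensorProduct.induction_on with
        | zero => simp
        | add x y hx hy => simp only [map_add, TensorProduct.add_tmul, hx, hy]
        | tmul c u => simp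
  have h2 : ∀ y : H ⊗[𝕜] V, (braid δ σ).lTensor H (mulTensor H V W (y ⊗ₜ γ w)) =
      TensorProduct.assoc 𝕜 H W V ((ydLeft σ γ w).rTensor V
        ((TensorProduct.assoc 𝕜 H H V).symm (δ.lTensor H y))) := by
    intro y
    have hb : braid δ σ = braid LinearMap.id σ ∘ₗ TensorProduct.map δ LinearMap.id := by
      ext v w; simp
    have hn := LinearMap.congr_fun (mulTensor_natural (𝕜 := 𝕜) (H := H) δ
      (LinearMap.id (R := 𝕜) (M := W))) (y ⊗ₜ γ w)
    simp only [LinearMap.comp_apply, TensorProduct.map_tmul, LinearMap.lTensor_id,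
      LinearMap.id_apply] at hn
    rw [hb, LinearMap.lTensor_comp, LinearMap.comp_apply, ← hn]
    generalize δ.lTensor H y = x
    induction x using TensorProduct.induction_on with
    | zero => simp
    | add x y hx hy => simp only [map_add, TensorProduct.add_tmul, hx, hy]
    | tmul a y =>
      induction y using TensorProduct.induction_on with
      | zero => simp
      | add x y hx hy => simp only [map_add, TensorProduct.add_tmul, TensorProduct.tmul_add, hx, hy]
      | tmul b v =>
        simp only [TensorProduct.assoc_symm_tmul, LinearMap.rTensor_tmul, ydLeft_tmul]
        generalize γ w = z
        induction z using TensorProduct.induction_on with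
        | zero => simp
        | add x y hx hy => simp only [map_add, TensorProduct.add_tmul, TensorProduct.tmul_add, hx, hy]
        | tmul c u => simp
  simp only [TensorProduct.AlgebraTensorModule.curry_apply, LinearMap.restrictScalars_self,
    TensorProduct.curry_apply, LinearMap.comp_apply, braid_tmul, h1]
  rw [tensorCoact, LinearMap.comp_apply, TensorProduct.map_tmul, h2, ← co,
    LinearEquiv.symm_apply_apply]
  have := congr(($(hW.comp w)).rTensor V (δ v))
  rw [LinearMap.rTensor_comp, LinearMap.rTensor_comp] at this
  simpa using this.symm

theorem braid_natural {δ : V →ₗ[𝕜] H ⊗[𝕜] V} {σ : H →ₐ[𝕜] Module.End 𝕜 W}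
    {δ' : V' →ₗ[𝕜] H ⊗[𝕜] V'} {σ' : H →ₐ[𝕜] Module.End 𝕜 W'} {f : V →ₗ[𝕜] V'} {g : W →ₗ[𝕜] W'}
    (hf : δ' ∘ₗ f = f.lTensor H ∘ₗ δ) (hg : ∀ h, g ∘ₗ σ h = σ' h ∘ₗ g) :
    braid δ' σ' ∘ₗ TensorProduct.map f g = TensorProduct.map g f ∘ₗ braid δ σ := by
  ext v w
  have := LinearMap.congr_fun hf v
  simp only [LinearMap.comp_apply] at this
  simp only [TensorProduct.AlgebraTensorModule.curry_apply, LinearMap.restrictScalars_self,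
    TensorProduct.curry_apply, LinearMap.comp_apply, braid_tmul, TensorProduct.map_tmul, this,
    orbit_map hg]
  rw [← LinearMap.comp_apply, ← LinearMap.comp_apply (TensorProduct.map g f),
    LinearMap.rTensor_comp_lTensor, LinearMap.map_comp_rTensor]

theorem braid_hexagon_forward {δ : V →ₗ[𝕜] H ⊗[𝕜] V} (hδ : IsCoact δ)
    (σ : H →ₐ[𝕜] Module.End 𝕜 W) (τ : H →ₐ[𝕜] Module.End 𝕜 U) :
    (TensorProduct.assoc 𝕜 W U V).toLinearMap ∘ₗ braid δ (tensorAct σ τ) ∘ₗ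
        (TensorProduct.assoc 𝕜 V W U).toLinearMap =
      (braid δ τ).lTensor W ∘ₗ (TensorProduct.assoc 𝕜 W V U).toLinearMap ∘ₗ
        (braid δ σ).rTensor U := by
  ext v w u
  have co := LinearMap.congr_fun hδ.coassoc v
  simp only [LinearMap.comp_apply, LinearEquiv.coe_coe] at co
  simp only [TensorProduct.AlgebraTensorModule.curry_apply, LinearMap.restrictScalars_self,
    TensorProduct.curry_apply, LinearMap.comp_apply, braid_tmul, TensorProduct.assoc_tmul,
    LinearEquiv.coe_coe, orbit_tensor, LinearMap.rTensor_tmul, LinearMap.rTensor_comp]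
  have h1 : ∀ y : H ⊗[𝕜] V, (braid δ τ).lTensor W (TensorProduct.assoc 𝕜 W V U
      ((orbit σ w).rTensor V y ⊗ₜ u)) = TensorProduct.map (orbit σ w) ((orbit τ u).rTensor V)
        (δ.lTensor H y) := by
    intro y
    induction y using TensorProduct.induction_on with
    | zero => simp
    | add x y hx hy => simp only [map_add, TensorProduct.add_tmul, hx, hy]
    | tmul a v => simp
  rw [h1, ← co]
  generalize (Coalgebra.comul (R := 𝕜) (A := H)).rTensor V (δ v) = x
  induction x using TensorProduct.induction_on with
  | zero => simp
  | add x y hx hy => simp only [map_add, hx, hy]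
  | tmul x v =>
    induction x using TensorProduct.induction_on with
    | zero => simp
    | add x y hx hy => simp only [map_add, TensorProduct.add_tmul, hx, hy]
    | tmul a b => simp

theorem braid_hexagon_reverse (δ : V →ₗ[𝕜] H ⊗[𝕜] V) (γ : W →ₗ[𝕜] H ⊗[𝕜] W)
    (τ : H →ₐ[𝕜] Module.End 𝕜 U) :
    (TensorProduct.assoc 𝕜 U V W).symm.toLinearMap ∘ₗ braid (tensorCoact δ γ) τ ∘ₗ
        (TensorProduct.assoc 𝕜 V W U).symm.toLinearMap =
      (braid δ τ).rTensor W ∘ₗ (TensorProduct.assoc 𝕜 V U W).symm.toLinearMap ∘ₗ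
        (braid γ τ).lTensor V := by
  apply TensorProduct.ext'
  intro v x
  induction x using TensorProduct.induction_on with
  | zero => simp
  | add x y hx hy => simp only [map_add, TensorProduct.tmul_add, hx, hy]
  | tmul w u =>
    simp only [LinearMap.comp_apply, braid_tmul, TensorProduct.assoc_symm_tmul,
      LinearEquiv.coe_coe, LinearMap.lTensor_tmul, tensorCoact, TensorProduct.map_tmul]
    generalize γ w = y
    induction y using TensorProduct.induction_on with
    | zero => simp
    | add x y hx hy => simp only [map_add, TensorProduct.tmul_add, hx, hy]
    | tmul b w =>
      simp only [LinearMap.rTensor_tmul, orbit_apply, TensorProduct.assoc_symm_tmul, braid_tmul]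
      generalize δ v = x
      induction x using TensorProduct.induction_on with
      | zero => simp
      | add x y hx hy => simp only [map_add, TensorProduct.add_tmul, hx, hy]
      | tmul a v => simp

end Unbundled

/-- The Hopf algebra `H` has a bijective antipode. -/
class InvertibleAntipode (𝕜 : Type u) [Field 𝕜] (H : Type u) [Ring H] [HopfAlgebra 𝕜 H] : Prop where
  bijective : Function.Bijective (HopfAlgebra.antipode 𝕜 : H →ₗ[𝕜] H)

section BraidInv

variable {𝕜 : Type u} [Field 𝕜] {H : Type u} [Ring H] [HopfAlgebra 𝕜 H] [InvertibleAntipode 𝕜 H]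
  {V W : Type u} [AddCommGroup V] [Module 𝕜 V] [AddCommGroup W] [Module 𝕜 W]

variable (𝕜 H) in
/-- The inverse of the antipode. -/
noncomputable def antipodeInv : H →ₗ[𝕜] H :=
  (LinearEquiv.ofBijective (HopfAlgebra.antipode 𝕜 : H →ₗ[𝕜] H)
    InvertibleAntipode.bijective).symm.toLinearMap

theorem antipode_antipodeInv (h : H) : HopfAlgebra.antipode 𝕜 (antipodeInv 𝕜 H h) = h :=
  (LinearEquiv.ofBijective (HopfAlgebra.antipode 𝕜 : H →ₗ[𝕜] H)
    InvertibleAntipode.bijective).apply_symm_apply h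

/-- `h₍₂₎ S⁻¹(h₍₁₎) = ε(h)`. -/
theorem mul_antipodeInv_right : LinearMap.mul' 𝕜 H ∘ₗ (TensorProduct.comm 𝕜 H H).toLinearMap ∘ₗ
    (antipodeInv 𝕜 H).rTensor H ∘ₗ Coalgebra.comul = Algebra.linearMap 𝕜 H ∘ₗ Coalgebra.counit := by
  ext h
  apply (InvertibleAntipode.bijective (𝕜 := 𝕜) (H := H)).1
  have h1 : ∀ x : H ⊗[𝕜] H, HopfAlgebra.antipode 𝕜 (LinearMap.mul' 𝕜 H
      (TensorProduct.comm 𝕜 H H ((antipodeInv 𝕜 H).rTensor H x))) =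
      LinearMap.mul' 𝕜 H ((HopfAlgebra.antipode 𝕜).lTensor H x) := by
    intro x
    induction x using TensorProduct.induction_on with
    | zero => simp
    | add x y hx hy => simp only [map_add, hx, hy]
    | tmul a b => simp [HopfAlgebra.antipode_mul_antidistrib, antipode_antipodeInv]
  simp only [LinearMap.comp_apply, LinearEquiv.coe_coe, h1,
    HopfAlgebra.mul_antipode_lTensor_comul_apply]
  simp [Algebra.algebraMap_eq_smul_one]

/-- `S⁻¹(h₍₂₎) h₍₁₎ = ε(h)`. -/
theorem mul_antipodeInv_left : LinearMap.mul' 𝕜 H ∘ₗ (TensorProduct.comm 𝕜 H H).toLinearMap ∘ₗ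
    (antipodeInv 𝕜 H).lTensor H ∘ₗ Coalgebra.comul = Algebra.linearMap 𝕜 H ∘ₗ Coalgebra.counit := by
  ext h
  apply (InvertibleAntipode.bijective (𝕜 := 𝕜) (H := H)).1
  have h1 : ∀ x : H ⊗[𝕜] H, HopfAlgebra.antipode 𝕜 (LinearMap.mul' 𝕜 H
      (TensorProduct.comm 𝕜 H H ((antipodeInv 𝕜 H).lTensor H x))) =
      LinearMap.mul' 𝕜 H ((HopfAlgebra.antipode 𝕜).rTensor H x) := by
    intro x
    induction x using TensorProduct.induction_on with
    | zero => simp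
    | add x y hx hy => simp only [map_add, hx, hy]
    | tmul a b => simp [HopfAlgebra.antipode_mul_antidistrib, antipode_antipodeInv]
  simp only [LinearMap.comp_apply, LinearEquiv.coe_coe, h1,
    HopfAlgebra.mul_antipode_rTensor_comul_apply]
  simp [Algebra.algebraMap_eq_smul_one]

/-- The map `w ⊗ v ↦ v⁽⁰⁾ ⊗ S⁻¹(v⁽⁻¹⁾) w`. -/
noncomputable def braidInv (δ : V →ₗ[𝕜] H ⊗[𝕜] V) (σ : H →ₐ[𝕜] Module.End 𝕜 W) :
    W ⊗[𝕜] V →ₗ[𝕜] V ⊗[𝕜] W :=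
  TensorProduct.lift (LinearMap.mk₂ 𝕜
    (fun w v => TensorProduct.comm 𝕜 W V ((orbit σ w ∘ₗ antipodeInv 𝕜 H).rTensor V (δ v)))
    (fun w w' v => by
      rw [show orbit σ (w + w') = orbit σ w + orbit σ w' by ext; simp, LinearMap.add_comp,
        LinearMap.rTensor_add]; simp)
    (fun c w v => by
      rw [show orbit σ (c • w) = c • orbit σ w by ext; simp, LinearMap.smul_comp,
        LinearMap.rTensor_smul]; simp)
    (fun w v v' => by simp) (fun c w v => by simp))

@[simp] theorem braidInv_tmul (δ : V →ₗ[𝕜] H ⊗[𝕜] V) (σ : H →ₐ[𝕜] Module.End 𝕜 W) (v : V) (w : W) :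
    braidInv δ σ (w ⊗ₜ v) =
      TensorProduct.comm 𝕜 W V ((orbit σ w ∘ₗ antipodeInv 𝕜 H).rTensor V (δ v)) := rfl

theorem braid_braidInv {δ : V →ₗ[𝕜] H ⊗[𝕜] V} (hδ : IsCoact δ)
    (σ : H →ₐ[𝕜] Module.End 𝕜 W) : braid δ σ ∘ₗ braidInv δ σ = LinearMap.id := by
  ext w v
  have co := LinearMap.congr_fun hδ.coassoc v
  have cu := LinearMap.congr_fun hδ.counit v
  simp only [LinearMap.comp_apply, LinearEquiv.coe_coe] at co cu
  have h1 : ∀ y : H ⊗[𝕜] V, braid δ σ (TensorProduct.comm 𝕜 W V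
      ((orbit σ w ∘ₗ antipodeInv 𝕜 H).rTensor V y)) =
      (orbit σ w ∘ₗ LinearMap.mul' 𝕜 H ∘ₗ (TensorProduct.comm 𝕜 H H).toLinearMap ∘ₗ
        (antipodeInv 𝕜 H).rTensor H).rTensor V
        ((TensorProduct.assoc 𝕜 H H V).symm (δ.lTensor H y)) := by
    intro y
    induction y using TensorProduct.induction_on with
    | zero => simp
    | add x y hx hy => simp only [map_add, hx, hy]
    | tmul a v =>
      simp only [LinearMap.rTensor_tmul, TensorProduct.comm_tmul, braid_tmul,
        LinearMap.lTensor_tmul]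
      generalize δ v = y
      induction y using TensorProduct.induction_on with
      | zero => simp
      | add x y hx hy => simp only [map_add, TensorProduct.tmul_add, hx, hy]
      | tmul b v => simp
  simp only [TensorProduct.AlgebraTensorModule.curry_apply, LinearMap.restrictScalars_self,
    TensorProduct.curry_apply, LinearMap.comp_apply, braidInv_tmul, LinearMap.id_apply]
  rw [h1, ← co, LinearEquiv.symm_apply_apply, ← LinearMap.comp_apply, ← LinearMap.rTensor_comp]
  simp only [LinearMap.comp_assoc, mul_antipodeInv_right]
  rw [← LinearMap.comp_assoc, LinearMap.rTensor_comp, LinearMap.comp_apply, cu]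
  simp

theorem braidInv_braid {δ : V →ₗ[𝕜] H ⊗[𝕜] V} (hδ : IsCoact δ)
    (σ : H →ₐ[𝕜] Module.End 𝕜 W) : braidInv δ σ ∘ₗ braid δ σ = LinearMap.id := by
  ext v w
  have co := LinearMap.congr_fun hδ.coassoc v
  have cu := LinearMap.congr_fun hδ.counit v
  simp only [LinearMap.comp_apply, LinearEquiv.coe_coe] at co cu
  have h1 : ∀ y : H ⊗[𝕜] V, braidInv δ σ ((orbit σ w).rTensor V y) =
      TensorProduct.comm 𝕜 W V ((orbit σ w ∘ₗ LinearMap.mul' 𝕜 H ∘ₗ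
        (TensorProduct.comm 𝕜 H H).toLinearMap ∘ₗ (antipodeInv 𝕜 H).lTensor H).rTensor V
        ((TensorProduct.assoc 𝕜 H H V).symm (δ.lTensor H y))) := by
    intro y
    induction y using TensorProduct.induction_on with
    | zero => simp
    | add x y hx hy => simp only [map_add, hx, hy]
    | tmul a v =>
      simp only [LinearMap.rTensor_tmul, orbit_apply, braidInv_tmul, LinearMap.lTensor_tmul]
      generalize δ v = y
      induction y using TensorProduct.induction_on with
      | zero => simp
      | add x y hx hy => simp only [map_add, TensorProduct.tmul_add, hx, hy]
      | tmul b v => simp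
  simp only [TensorProduct.AlgebraTensorModule.curry_apply, LinearMap.restrictScalars_self,
    TensorProduct.curry_apply, LinearMap.comp_apply, braid_tmul, LinearMap.id_apply]
  rw [h1, ← co, LinearEquiv.symm_apply_apply, ← LinearMap.comp_apply (LinearMap.rTensor V _),
    ← LinearMap.rTensor_comp]
  simp only [LinearMap.comp_assoc, mul_antipodeInv_left]
  rw [← LinearMap.comp_assoc, LinearMap.rTensor_comp, LinearMap.comp_apply, cu]
  simp

end BraidInv

/-! ### Left modules -/

/-- A left module over a `𝕜`-algebra `H`: a `𝕜`-vector space `V` with an algebra map `H → End V`. -/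
structure LMod (𝕜 : Type u) [Field 𝕜] (H : Type u) [Ring H] [Algebra 𝕜 H] where
  carrier : Type u
  [addCommGroup : AddCommGroup carrier]
  [module : Module 𝕜 carrier]
  act : H →ₐ[𝕜] Module.End 𝕜 carrier

attribute [instance] LMod.addCommGroup LMod.module

namespace LMod

section
variable {𝕜 : Type u} [Field 𝕜] {H : Type u} [Ring H] [Algebra 𝕜 H]

/-- Morphisms of left `H`-modules. -/
@[ext] structure Hom (V W : LMod 𝕜 H) where
  toLin : V.carrier →ₗ[𝕜] W.carrier
  comm : ∀ h, toLin ∘ₗ V.act h = W.act h ∘ₗ toLin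

instance : Category (LMod 𝕜 H) where
  Hom V W := Hom V W
  id V := ⟨LinearMap.id, fun _ => rfl⟩
  comp f g := ⟨g.toLin ∘ₗ f.toLin, fun h => by
    rw [LinearMap.comp_assoc, f.comm, ← LinearMap.comp_assoc, g.comm, LinearMap.comp_assoc]⟩

@[ext] theorem hom_ext {V W : LMod 𝕜 H} {f g : V ⟶ W} (h : f.toLin = g.toLin) : f = g := Hom.ext h
@[simp] theorem id_toLin (V : LMod 𝕜 H) : Hom.toLin (𝟙 V) = LinearMap.id := rfl
@[simp] theorem comp_toLin {U V W : LMod 𝕜 H} (f : U ⟶ V) (g : V ⟶ W) :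
    (f ≫ g).toLin = g.toLin ∘ₗ f.toLin := rfl

/-- A linear isomorphism commuting with the actions is an isomorphism of modules. -/
def mkIso {V W : LMod 𝕜 H} (e : V.carrier ≃ₗ[𝕜] W.carrier)
    (he : ∀ h, e.toLinearMap ∘ₗ V.act h = W.act h ∘ₗ e.toLinearMap) : V ≅ W where
  hom := ⟨e, he⟩
  inv := ⟨e.symm, fun h => by
    ext w
    apply e.injective
    have := LinearMap.congr_fun (he h) (e.symm w)
    simpa using this.symm⟩
  hom_inv_id := by apply hom_ext; ext v; exact e.symm_apply_apply v
  inv_hom_id := by apply hom_ext; ext v; exact e.apply_symm_apply v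

end

section
variable {𝕜 : Type u} [Field 𝕜] {H : Type u} [Ring H] [Bialgebra 𝕜 H]

noncomputable instance : MonoidalCategoryStruct (LMod 𝕜 H) where
  tensorObj V W := ⟨V.carrier ⊗[𝕜] W.carrier, tensorAct V.act W.act⟩
  tensorUnit := ⟨𝕜, unitAct 𝕜 H⟩
  tensorHom f g := ⟨TensorProduct.map f.toLin g.toLin, tensorAct_map f.comm g.comm⟩
  whiskerLeft V _ _ f := ⟨f.toLin.lTensor V.carrier, tensorAct_map (fun _ => rfl) f.comm⟩
  whiskerRight f V := ⟨f.toLin.rTensor V.carrier, tensorAct_map f.comm (fun _ => rfl)⟩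
  associator V W U := mkIso (TensorProduct.assoc 𝕜 V.carrier W.carrier U.carrier)
    (tensorAct_assoc V.act W.act U.act)
  leftUnitor V := mkIso (TensorProduct.lid 𝕜 V.carrier) (tensorAct_lid V.act)
  rightUnitor V := mkIso (TensorProduct.rid 𝕜 V.carrier) (tensorAct_rid V.act)

noncomputable instance : MonoidalCategory (LMod 𝕜 H) :=
  MonoidalCategory.ofTensorHom
    (id_tensorHom_id := fun _ _ => hom_ext TensorProduct.map_id)
    (id_tensorHom := fun _ _ _ _ => rfl)
    (tensorHom_id := fun _ _ => rfl)
    (tensorHom_comp_tensorHom := fun _ _ _ _ => hom_ext (TensorProduct.map_comp _ _ _ _).symm)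
    (associator_naturality := fun _ _ _ => hom_ext
      (TensorProduct.ext_threefold fun _ _ _ => rfl))
    (leftUnitor_naturality := fun f => hom_ext
      (TensorProduct.ext' fun c v => (f.toLin.map_smul c v).symm))
    (rightUnitor_naturality := fun f => hom_ext
      (TensorProduct.ext' fun v c => (f.toLin.map_smul c v).symm))
    (pentagon := fun _ _ _ _ => hom_ext
      (TensorProduct.ext_fourfold fun _ _ _ _ => rfl))
    (triangle := fun _ _ => hom_ext
      (TensorProduct.ext_threefold fun v c w => (TensorProduct.smul_tmul c v w).symm))

end
end LMod

/-! ### Left comodules -/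

/-- A left comodule over a bialgebra `H`: a vector space with a coassociative counital coaction. -/
structure LComod (𝕜 : Type u) [Field 𝕜] (H : Type u) [Ring H] [Bialgebra 𝕜 H] where
  carrier : Type u
  [addCommGroup : AddCommGroup carrier]
  [module : Module 𝕜 carrier]
  coact : carrier →ₗ[𝕜] H ⊗[𝕜] carrier
  isCoact : IsCoact coact

attribute [instance] LComod.addCommGroup LComod.module

namespace LComod

variable {𝕜 : Type u} [Field 𝕜] {H : Type u} [Ring H] [Bialgebra 𝕜 H]

/-- Morphisms of left `H`-comodules. -/
@[ext] structure Hom (V W : LComod 𝕜 H) where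
  toLin : V.carrier →ₗ[𝕜] W.carrier
  comm : W.coact ∘ₗ toLin = toLin.lTensor H ∘ₗ V.coact

instance : Category (LComod 𝕜 H) where
  Hom V W := Hom V W
  id V := ⟨LinearMap.id, by rw [LinearMap.lTensor_id]; rfl⟩
  comp f g := ⟨g.toLin ∘ₗ f.toLin, by
    rw [← LinearMap.comp_assoc, g.comm, LinearMap.comp_assoc, f.comm, LinearMap.lTensor_comp,
      LinearMap.comp_assoc]⟩

@[ext] theorem hom_ext {V W : LComod 𝕜 H} {f g : V ⟶ W} (h : f.toLin = g.toLin) : f = g := Hom.ext h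
@[simp] theorem id_toLin (V : LComod 𝕜 H) : Hom.toLin (𝟙 V) = LinearMap.id := rfl
@[simp] theorem comp_toLin {U V W : LComod 𝕜 H} (f : U ⟶ V) (g : V ⟶ W) :
    (f ≫ g).toLin = g.toLin ∘ₗ f.toLin := rfl

/-- A linear isomorphism commuting with the coactions is an isomorphism of comodules. -/
def mkIso {V W : LComod 𝕜 H} (e : V.carrier ≃ₗ[𝕜] W.carrier)
    (he : W.coact ∘ₗ e.toLinearMap = e.toLinearMap.lTensor H ∘ₗ V.coact) : V ≅ W where
  hom := ⟨e, he⟩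
  inv := ⟨e.symm, by
    ext w
    have := congr(e.symm.toLinearMap.lTensor H $(LinearMap.congr_fun he (e.symm w)))
    have h1 : ∀ x, e.symm.toLinearMap.lTensor H (e.toLinearMap.lTensor H x) = x := fun x => by
      rw [← LinearMap.comp_apply, ← LinearMap.lTensor_comp]; simp
    simp only [LinearMap.comp_apply, h1] at this
    simpa using this.symm⟩
  hom_inv_id := by apply hom_ext; ext v; exact e.symm_apply_apply v
  inv_hom_id := by apply hom_ext; ext v; exact e.apply_symm_apply v

noncomputable instance : MonoidalCategoryStruct (LComod 𝕜 H) where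
  tensorObj V W := ⟨V.carrier ⊗[𝕜] W.carrier, tensorCoact V.coact W.coact,
    V.isCoact.tensor W.isCoact⟩
  tensorUnit := ⟨𝕜, unitCoact 𝕜 H, unitCoact_isCoact⟩
  tensorHom f g := ⟨TensorProduct.map f.toLin g.toLin, tensorCoact_map f.comm g.comm⟩
  whiskerLeft V _ _ f := ⟨f.toLin.lTensor V.carrier,
    tensorCoact_map (by rw [LinearMap.lTensor_id]; rfl) f.comm⟩
  whiskerRight f V := ⟨f.toLin.rTensor V.carrier,
    tensorCoact_map f.comm (by rw [LinearMap.lTensor_id]; rfl)⟩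
  associator V W U := mkIso (TensorProduct.assoc 𝕜 V.carrier W.carrier U.carrier)
    (tensorCoact_assoc V.coact W.coact U.coact)
  leftUnitor V := mkIso (TensorProduct.lid 𝕜 V.carrier) (tensorCoact_lid V.coact)
  rightUnitor V := mkIso (TensorProduct.rid 𝕜 V.carrier) (tensorCoact_rid V.coact)

noncomputable instance : MonoidalCategory (LComod 𝕜 H) :=
  MonoidalCategory.ofTensorHom
    (id_tensorHom_id := fun _ _ => hom_ext TensorProduct.map_id)
    (id_tensorHom := fun _ _ _ _ => rfl)
    (tensorHom_id := fun _ _ => rfl)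
    (tensorHom_comp_tensorHom := fun _ _ _ _ => hom_ext (TensorProduct.map_comp _ _ _ _).symm)
    (associator_naturality := fun _ _ _ => hom_ext
      (TensorProduct.ext_threefold fun _ _ _ => rfl))
    (leftUnitor_naturality := fun f => hom_ext
      (TensorProduct.ext' fun c v => (f.toLin.map_smul c v).symm))
    (rightUnitor_naturality := fun f => hom_ext
      (TensorProduct.ext' fun v c => (f.toLin.map_smul c v).symm))
    (pentagon := fun _ _ _ _ => hom_ext
      (TensorProduct.ext_fourfold fun _ _ _ _ => rfl))
    (triangle := fun _ _ => hom_ext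
      (TensorProduct.ext_threefold fun v c w => (TensorProduct.smul_tmul c v w).symm))

end LComod

/-! ### Yetter--Drinfeld modules -/

/-- A (left-left) Yetter--Drinfeld module over `H`: a left module and left comodule satisfying the
Yetter--Drinfeld condition. -/
structure YD (𝕜 : Type u) [Field 𝕜] (H : Type u) [Ring H] [Bialgebra 𝕜 H] extends
    LMod 𝕜 H, LComod 𝕜 H where
  isYD : IsYD act coact

namespace YD

section
variable {𝕜 : Type u} [Field 𝕜] {H : Type u} [Ring H] [Bialgebra 𝕜 H]

/-- Morphisms of Yetter--Drinfeld modules: linear maps that are `H`-linear and `H`-colinear. -/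
@[ext] structure Hom (V W : YD 𝕜 H) where
  toLin : V.carrier →ₗ[𝕜] W.carrier
  comm : ∀ h, toLin ∘ₗ V.act h = W.act h ∘ₗ toLin
  comm' : W.coact ∘ₗ toLin = toLin.lTensor H ∘ₗ V.coact

instance : Category (YD 𝕜 H) where
  Hom V W := Hom V W
  id V := ⟨LinearMap.id, fun _ => rfl, by rw [LinearMap.lTensor_id]; rfl⟩
  comp f g := ⟨g.toLin ∘ₗ f.toLin, fun h => by
    rw [LinearMap.comp_assoc, f.comm, ← LinearMap.comp_assoc, g.comm, LinearMap.comp_assoc], by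
    rw [← LinearMap.comp_assoc, g.comm', LinearMap.comp_assoc, f.comm', LinearMap.lTensor_comp,
      LinearMap.comp_assoc]⟩

@[ext] theorem hom_ext {V W : YD 𝕜 H} {f g : V ⟶ W} (h : f.toLin = g.toLin) : f = g := Hom.ext h
@[simp] theorem id_toLin (V : YD 𝕜 H) : Hom.toLin (𝟙 V) = LinearMap.id := rfl
@[simp] theorem comp_toLin {U V W : YD 𝕜 H} (f : U ⟶ V) (g : V ⟶ W) :
    (f ≫ g).toLin = g.toLin ∘ₗ f.toLin := rfl

variable (𝕜 H) in
/-- The functor forgetting the coaction. -/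
def forgetLMod : YD 𝕜 H ⥤ LMod 𝕜 H where
  obj V := V.toLMod
  map f := ⟨f.toLin, f.comm⟩

variable (𝕜 H) in
/-- The functor forgetting the action. -/
def forgetLComod : YD 𝕜 H ⥤ LComod 𝕜 H where
  obj V := V.toLComod
  map f := ⟨f.toLin, f.comm'⟩

/-- A linear isomorphism commuting with actions and coactions is an isomorphism. -/
def mkIso {V W : YD 𝕜 H} (e : V.carrier ≃ₗ[𝕜] W.carrier)
    (he : ∀ h, e.toLinearMap ∘ₗ V.act h = W.act h ∘ₗ e.toLinearMap)
    (he' : W.coact ∘ₗ e.toLinearMap = e.toLinearMap.lTensor H ∘ₗ V.coact) : V ≅ W where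
  hom := ⟨e, he, he'⟩
  inv := ⟨e.symm, (LMod.mkIso (V := V.toLMod) (W := W.toLMod) e he).inv.comm,
    (LComod.mkIso (V := V.toLComod) (W := W.toLComod) e he').inv.comm⟩
  hom_inv_id := by apply hom_ext; ext v; exact e.symm_apply_apply v
  inv_hom_id := by apply hom_ext; ext v; exact e.apply_symm_apply v

noncomputable instance : MonoidalCategoryStruct (YD 𝕜 H) where
  tensorObj V W :=
    { toLMod := ⟨V.carrier ⊗[𝕜] W.carrier, tensorAct V.act W.act⟩
      coact := tensorCoact V.coact W.coact
      isCoact := V.isCoact.tensor W.isCoact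
      isYD := V.isYD.tensor W.isYD }
  tensorUnit :=
    { toLMod := ⟨𝕜, unitAct 𝕜 H⟩
      coact := unitCoact 𝕜 H
      isCoact := unitCoact_isCoact
      isYD := unit_isYD }
  tensorHom f g := ⟨TensorProduct.map f.toLin g.toLin, tensorAct_map f.comm g.comm,
    tensorCoact_map f.comm' g.comm'⟩
  whiskerLeft V _ _ f := ⟨f.toLin.lTensor V.carrier, tensorAct_map (fun _ => rfl) f.comm,
    tensorCoact_map (by rw [LinearMap.lTensor_id]; rfl) f.comm'⟩
  whiskerRight f V := ⟨f.toLin.rTensor V.carrier, tensorAct_map f.comm (fun _ => rfl),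
    tensorCoact_map f.comm' (by rw [LinearMap.lTensor_id]; rfl)⟩
  associator V W U := mkIso (TensorProduct.assoc 𝕜 V.carrier W.carrier U.carrier)
    (tensorAct_assoc V.act W.act U.act) (tensorCoact_assoc V.coact W.coact U.coact)
  leftUnitor V := mkIso (TensorProduct.lid 𝕜 V.carrier) (tensorAct_lid V.act)
    (tensorCoact_lid V.coact)
  rightUnitor V := mkIso (TensorProduct.rid 𝕜 V.carrier) (tensorAct_rid V.act)
    (tensorCoact_rid V.coact)

noncomputable instance : MonoidalCategory (YD 𝕜 H) :=
  MonoidalCategory.ofTensorHom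
    (id_tensorHom_id := fun _ _ => hom_ext TensorProduct.map_id)
    (id_tensorHom := fun _ _ _ _ => rfl)
    (tensorHom_id := fun _ _ => rfl)
    (tensorHom_comp_tensorHom := fun _ _ _ _ => hom_ext (TensorProduct.map_comp _ _ _ _).symm)
    (associator_naturality := fun _ _ _ => hom_ext
      (TensorProduct.ext_threefold fun _ _ _ => rfl))
    (leftUnitor_naturality := fun f => hom_ext
      (TensorProduct.ext' fun c v => (f.toLin.map_smul c v).symm))
    (rightUnitor_naturality := fun f => hom_ext
      (TensorProduct.ext' fun v c => (f.toLin.map_smul c v).symm))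
    (pentagon := fun _ _ _ _ => hom_ext
      (TensorProduct.ext_fourfold fun _ _ _ _ => rfl))
    (triangle := fun _ _ => hom_ext
      (TensorProduct.ext_threefold fun v c w => (TensorProduct.smul_tmul c v w).symm))

/-- The half-braiding of a Yetter--Drinfeld module `V` with a module `A`:
`V ⊗ A → A ⊗ V`, `v ⊗ a ↦ v⁽⁻¹⁾ a ⊗ v⁽⁰⁾`. -/
noncomputable def halfBraidingMod (V : YD 𝕜 H) (A : LMod 𝕜 H) :
    (forgetLMod 𝕜 H).obj V ⊗ A ⟶ A ⊗ (forgetLMod 𝕜 H).obj V :=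
  ⟨braid V.coact A.act, braid_linear V.isYD A.act⟩

/-- The (inverse) half-braiding of a Yetter--Drinfeld module `V` with a comodule `A`:
`A ⊗ V → V ⊗ A`, `a ⊗ v ↦ a⁽⁻¹⁾ v ⊗ a⁽⁰⁾`. -/
noncomputable def halfBraidingComod (V : YD 𝕜 H) (A : LComod 𝕜 H) :
    A ⊗ (forgetLComod 𝕜 H).obj V ⟶ (forgetLComod 𝕜 H).obj V ⊗ A :=
  ⟨braid A.coact V.act, braid_colinear A.isCoact V.isYD⟩

end

variable {𝕜 : Type u} [Field 𝕜] {H : Type u} [Ring H] [HopfAlgebra 𝕜 H] [InvertibleAntipode 𝕜 H]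

/-- The braiding `V ⊗ W → W ⊗ V`, `v ⊗ w ↦ v⁽⁻¹⁾ w ⊗ v⁽⁰⁾`. -/
noncomputable instance : BraidedCategory (YD 𝕜 H) where
  braiding V W := mkIso
    (LinearEquiv.ofLinearMap (braid V.coact W.act) (braidInv V.coact W.act)
      (braid_braidInv V.isCoact W.act) (braidInv_braid V.isCoact W.act))
    (braid_linear V.isYD W.act) (braid_colinear V.isCoact W.isYD)
  braiding_naturality_right V _ _ f := hom_ext
    (braid_natural (f := LinearMap.id) (by rw [LinearMap.lTensor_id]; rfl) f.comm)
  braiding_naturality_left f V := hom_ext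
    (braid_natural (g := LinearMap.id) f.comm' (fun _ => rfl))
  hexagon_forward V W U := hom_ext (braid_hexagon_forward V.isCoact W.act U.act)
  hexagon_reverse V W U := hom_ext (braid_hexagon_reverse V.coact W.coact U.act)

end YD

/-! ### The projection formula -/

section Projection
universe v₁ v₂ u₁ u₂
variable {C : Type u₁} [Category.{v₁} C] [MonoidalCategory C]
  {D : Type u₂} [Category.{v₂} D] [MonoidalCategory D] {G : C ⥤ D} {R : D ⥤ C} (adj : G ⊣ R)
  [G.OplaxMonoidal]

/-- The lax structure `R X ⊗ R Y ⟶ R (X ⊗ Y)` on the right adjoint of an oplax monoidal functor. -/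
def lax (X Y : D) : R.obj X ⊗ R.obj Y ⟶ R.obj (X ⊗ Y) :=
  letI := adj.rightAdjointLaxMonoidal
  Functor.LaxMonoidal.μ R X Y

/-- The lax unit `𝟙 ⟶ R 𝟙` on the right adjoint of an oplax monoidal functor. -/
def laxUnit : 𝟙_ C ⟶ R.obj (𝟙_ D) :=
  letI := adj.rightAdjointLaxMonoidal
  Functor.LaxMonoidal.ε R

/-- The left projection formula morphism `A ⊗ R X ⟶ R (G A ⊗ X)`. -/
def lproj (A : C) (X : D) : A ⊗ R.obj X ⟶ R.obj (G.obj A ⊗ X) :=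
  adj.unit.app A ▷ R.obj X ≫ lax adj (G.obj A) X

/-- The right projection formula morphism `R X ⊗ A ⟶ R (X ⊗ G A)`. -/
def rproj (X : D) (A : C) : R.obj X ⊗ A ⟶ R.obj (X ⊗ G.obj A) :=
  R.obj X ◁ adj.unit.app A ≫ lax adj X (G.obj A)

/-- The right adjoint `R` satisfies the (left and right) projection formula. -/
def ProjectionFormula : Prop :=
  (∀ (A : C) (X : D), IsIso (lproj adj A X)) ∧ ∀ (X : D) (A : C), IsIso (rproj adj X A)

end Projection

section Res
variable {𝕜 : Type u} [Field 𝕜] {K H : Type u} [Ring K] [Ring H] [Bialgebra 𝕜 K] [Bialgebra 𝕜 H]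
  (φ : K →ₐc[𝕜] H)

/-- Restriction of modules along `φ : K → H`. -/
def resMod : LMod 𝕜 H ⥤ LMod 𝕜 K where
  obj W := ⟨W.carrier, W.act.comp (φ : K →ₐ[𝕜] H)⟩
  map f := ⟨f.toLin, fun k => f.comm (φ k)⟩

theorem tensorAct_comp {V W : Type u} [AddCommGroup V] [Module 𝕜 V] [AddCommGroup W] [Module 𝕜 W]
    (ρ : H →ₐ[𝕜] Module.End 𝕜 V) (σ : H →ₐ[𝕜] Module.End 𝕜 W) :
    (tensorAct ρ σ).comp (φ : K →ₐ[𝕜] H) =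
      tensorAct (ρ.comp (φ : K →ₐ[𝕜] H)) (σ.comp (φ : K →ₐ[𝕜] H)) := by
  ext k v w
  have h1 : (Coalgebra.comul (φ k) : H ⊗[𝕜] H) =
      TensorProduct.map (φ : K →ₗ[𝕜] H) (φ : K →ₗ[𝕜] H) (Coalgebra.comul k) :=
    (CoalgHomClass.map_comp_comul_apply φ k).symm
  simp only [TensorProduct.AlgebraTensorModule.curry_apply, LinearMap.restrictScalars_self,
    TensorProduct.curry_apply, tensorAct_tmul]
  change tensorAct ρ σ (φ k) (v ⊗ₜ w) = _
  rw [tensorAct_tmul, h1, ← LinearMap.comp_apply, ← TensorProduct.map_comp]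
  rfl

theorem unitAct_comp : (unitAct 𝕜 H).comp (φ : K →ₐ[𝕜] H) = unitAct 𝕜 K := by
  ext k
  change unitAct 𝕜 H (φ k) 1 = unitAct 𝕜 K k 1
  rw [unitAct_apply, unitAct_apply, CoalgHomClass.counit_comp_apply]

/-- Restriction of modules is strong monoidal, via identity maps. -/
noncomputable def resModCore : (resMod φ).CoreMonoidal where
  εIso := LMod.mkIso (V := 𝟙_ (LMod 𝕜 K)) (W := (resMod φ).obj (𝟙_ (LMod 𝕜 H)))
    (LinearEquiv.refl 𝕜 𝕜) (fun k => congr($(unitAct_comp φ) k).symm)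
  μIso V W := LMod.mkIso (V := (resMod φ).obj V ⊗ (resMod φ).obj W)
    (W := (resMod φ).obj (V ⊗ W)) (LinearEquiv.refl 𝕜 (V.carrier ⊗[𝕜] W.carrier))
    (fun k => congr($(tensorAct_comp φ V.act W.act) k).symm)
  μIso_hom_natural_left _ _ := rfl
  μIso_hom_natural_right _ _ := rfl
  associativity _ _ _ := LMod.hom_ext (TensorProduct.ext_threefold fun _ _ _ => rfl)
  left_unitality _ := LMod.hom_ext (TensorProduct.ext' fun _ _ => rfl)
  right_unitality _ := LMod.hom_ext (TensorProduct.ext' fun _ _ => rfl)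

noncomputable instance : (resMod φ).Monoidal := (resModCore φ).toMonoidal

variable {V W : Type u} [AddCommGroup V] [Module 𝕜 V] [AddCommGroup W] [Module 𝕜 W]

/-- The coaction `v ↦ φ(v⁽⁻¹⁾) ⊗ v⁽⁰⁾`. -/
noncomputable def resCoact (δ : V →ₗ[𝕜] K ⊗[𝕜] V) : V →ₗ[𝕜] H ⊗[𝕜] V :=
  (φ : K →ₗ[𝕜] H).rTensor V ∘ₗ δ

theorem resCoact_isCoact {δ : V →ₗ[𝕜] K ⊗[𝕜] V} (hδ : IsCoact δ) : IsCoact (resCoact φ δ) where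
  coassoc := by
    have h1 : ∀ x : K ⊗[𝕜] V, TensorProduct.assoc 𝕜 H H V
        ((Coalgebra.comul (R := 𝕜) (A := H)).rTensor V ((φ : K →ₗ[𝕜] H).rTensor V x)) =
        TensorProduct.map (φ : K →ₗ[𝕜] H) ((φ : K →ₗ[𝕜] H).rTensor V) (TensorProduct.assoc 𝕜 K K V
          ((Coalgebra.comul (R := 𝕜) (A := K)).rTensor V x)) := by
      intro x
      induction x using TensorProduct.induction_on with
      | zero => simp
      | add x y hx hy => simp only [map_add, hx, hy]
      | tmul k v =>
        have h2 : (Coalgebra.comul ((φ : K →ₗ[𝕜] H) k) : H ⊗[𝕜] H) =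
            TensorProduct.map (φ : K →ₗ[𝕜] H) (φ : K →ₗ[𝕜] H) (Coalgebra.comul k) :=
          (CoalgHomClass.map_comp_comul_apply φ k).symm
        simp only [LinearMap.rTensor_tmul, h2]
        generalize (Coalgebra.comul k : K ⊗[𝕜] K) = y
        induction y using TensorProduct.induction_on with
        | zero => simp
        | add x y hx hy => simp only [map_add, TensorProduct.add_tmul, hx, hy]
        | tmul a b => simp
    ext v
    have := LinearMap.congr_fun hδ.coassoc v
    simp only [LinearMap.comp_apply, LinearEquiv.coe_coe] at this
    simp only [resCoact, LinearMap.comp_apply, LinearEquiv.coe_coe, h1, this, LinearMap.lTensor_comp]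
    generalize δ v = x
    induction x using TensorProduct.induction_on with
    | zero => simp
    | add x y hx hy => simp only [map_add, hx, hy]
    | tmul a b => simp
  counit := by
    have h1 : (Coalgebra.counit (R := 𝕜) (A := H)) ∘ₗ (φ : K →ₗ[𝕜] H) = Coalgebra.counit :=
      CoalgHomClass.counit_comp φ
    rw [resCoact, ← LinearMap.comp_assoc, ← LinearMap.rTensor_comp, h1, hδ.counit]

theorem resCoact_map {δ : V →ₗ[𝕜] K ⊗[𝕜] V} {γ : W →ₗ[𝕜] K ⊗[𝕜] W} {f : V →ₗ[𝕜] W}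
    (hf : γ ∘ₗ f = f.lTensor K ∘ₗ δ) :
    resCoact φ γ ∘ₗ f = f.lTensor H ∘ₗ resCoact φ δ := by
  rw [resCoact, LinearMap.comp_assoc, hf, ← LinearMap.comp_assoc, LinearMap.rTensor_comp_lTensor,
    resCoact, ← LinearMap.comp_assoc, LinearMap.lTensor_comp_rTensor]

theorem resCoact_tensor (δ : V →ₗ[𝕜] K ⊗[𝕜] V) (γ : W →ₗ[𝕜] K ⊗[𝕜] W) :
    resCoact φ (tensorCoact δ γ) = tensorCoact (resCoact φ δ) (resCoact φ γ) := by
  ext v w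
  simp only [resCoact, tensorCoact, TensorProduct.AlgebraTensorModule.curry_apply,
    LinearMap.restrictScalars_self, TensorProduct.curry_apply, LinearMap.comp_apply,
    TensorProduct.map_tmul]
  generalize δ v = x
  generalize γ w = y
  induction x using TensorProduct.induction_on with
  | zero => simp
  | add x x' hx hx' => simp only [map_add, TensorProduct.add_tmul, hx, hx']
  | tmul p v =>
    induction y using TensorProduct.induction_on with
    | zero => simp
    | add x x' hx hx' => simp only [map_add, TensorProduct.tmul_add, hx, hx']
    | tmul q w => simp

theorem resCoact_unit : resCoact φ (unitCoact 𝕜 K) = unitCoact 𝕜 H := by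
  ext; simp [resCoact, unitCoact]

/-- Restriction of comodules along `φ : K → H`. -/
noncomputable def resComod : LComod 𝕜 K ⥤ LComod 𝕜 H where
  obj V := ⟨V.carrier, resCoact φ V.coact, resCoact_isCoact φ V.isCoact⟩
  map f := ⟨f.toLin, resCoact_map φ f.comm⟩

theorem resComod_εIso : (resCoact φ (unitCoact 𝕜 K)) ∘ₗ (LinearEquiv.refl 𝕜 𝕜).toLinearMap =
    (LinearEquiv.refl 𝕜 𝕜).toLinearMap.lTensor H ∘ₗ unitCoact 𝕜 H := by
  rw [LinearEquiv.refl_toLinearMap, LinearMap.lTensor_id]; exact resCoact_unit φ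

theorem resComod_μIso (δ : V →ₗ[𝕜] K ⊗[𝕜] V) (γ : W →ₗ[𝕜] K ⊗[𝕜] W) :
    resCoact φ (tensorCoact δ γ) ∘ₗ (LinearEquiv.refl 𝕜 (V ⊗[𝕜] W)).toLinearMap =
    (LinearEquiv.refl 𝕜 (V ⊗[𝕜] W)).toLinearMap.lTensor H ∘ₗ
      tensorCoact (resCoact φ δ) (resCoact φ γ) := by
  rw [LinearEquiv.refl_toLinearMap, LinearMap.lTensor_id]; exact resCoact_tensor φ δ γ

/-- Restriction of comodules is strong monoidal, via identity maps. -/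
noncomputable def resComodCore : (resComod φ).CoreMonoidal where
  εIso := LComod.mkIso (V := 𝟙_ (LComod 𝕜 H)) (W := (resComod φ).obj (𝟙_ (LComod 𝕜 K)))
    (LinearEquiv.refl 𝕜 𝕜) (resComod_εIso φ)
  μIso V W := LComod.mkIso (V := (resComod φ).obj V ⊗ (resComod φ).obj W)
    (W := (resComod φ).obj (V ⊗ W)) (LinearEquiv.refl 𝕜 (V.carrier ⊗[𝕜] W.carrier))
    (resComod_μIso φ V.coact W.coact)
  μIso_hom_natural_left _ _ := LComod.hom_ext rfl
  μIso_hom_natural_right _ _ := LComod.hom_ext rfl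
  associativity _ _ _ := LComod.hom_ext (TensorProduct.ext_threefold fun _ _ _ => rfl)
  left_unitality _ := LComod.hom_ext (TensorProduct.ext' fun _ _ => rfl)
  right_unitality _ := LComod.hom_ext (TensorProduct.ext' fun _ _ => rfl)

noncomputable instance : (resComod φ).Monoidal := (resComodCore φ).toMonoidal

/-! ### Coinduction of modules -/

/-- The space `Hom_K(H, V)` of left `K`-module maps. -/
def homK (ρ : K →ₐ[𝕜] Module.End 𝕜 V) : Submodule 𝕜 (H →ₗ[𝕜] V) where
  carrier := {f | ∀ (k : K) (h : H), f (φ k * h) = ρ k (f h)}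
  add_mem' hf hg k h := by simp [hf k h, hg k h]
  zero_mem' k h := by simp
  smul_mem' c f hf k h := by simp [hf k h]

/-- The action `(h f)(g) = f(g h)` on `Hom_K(H, V)`. -/
def homKAct (ρ : K →ₐ[𝕜] Module.End 𝕜 V) : H →ₐ[𝕜] Module.End 𝕜 (homK φ ρ) :=
  AlgHom.ofLinearMap
    { toFun := fun h =>
        { toFun := fun f => ⟨f.1 ∘ₗ LinearMap.mulRight 𝕜 h, fun k g => by
            simpa [mul_assoc] using f.2 k (g * h)⟩
          map_add' := fun f g => rfl
          map_smul' := fun c f => rfl }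
      map_add' := fun h h' => by ext f g; simp [mul_add]
      map_smul' := fun c h => by ext f g; simp }
    (by ext f g; simp) (fun h h' => by ext f g; simp [mul_assoc])

@[simp] theorem homKAct_apply (ρ : K →ₐ[𝕜] Module.End 𝕜 V) (h g : H) (f : homK φ ρ) :
    (homKAct φ ρ h f).1 g = f.1 (g * h) := rfl

/-- Coinduction `V ↦ Hom_K(H, V)`. -/
def coind : LMod 𝕜 K ⥤ LMod 𝕜 H where
  obj V := ⟨homK φ V.act, homKAct φ V.act⟩
  map {V W} t := ⟨
    { toFun := fun f => (⟨t.toLin ∘ₗ f.1, fun k h => by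
        simpa [f.2 k h] using LinearMap.congr_fun (t.comm k) (f.1 h)⟩ : homK φ W.act)
      map_add' := fun f g => by ext h; simp
      map_smul' := fun c f => by ext h; simp }, fun h => rfl⟩

/-- The `K`-module `W^triv ⊗ V`, with `k (w ⊗ v) = w ⊗ k v`. -/
noncomputable def trivTensorAct (W : Type u) [AddCommGroup W] [Module 𝕜 W]
    (ρ : K →ₐ[𝕜] Module.End 𝕜 V) : K →ₐ[𝕜] Module.End 𝕜 (W ⊗[𝕜] V) :=
  (Module.endTensorEndAlgHom (R := 𝕜) (S := 𝕜) (A := 𝕜)).comp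
    (Algebra.TensorProduct.includeRight.comp ρ)

/-- The canonical map `W ⊗ Hom_K(H, V) → Hom_K(H, W^triv ⊗ V)`, `w ⊗ f ↦ (h ↦ w ⊗ f(h))`. -/
noncomputable def homKTensor (W : Type u) [AddCommGroup W] [Module 𝕜 W]
    (ρ : K →ₐ[𝕜] Module.End 𝕜 V) :
    W ⊗[𝕜] homK φ ρ →ₗ[𝕜] homK φ (trivTensorAct W ρ) :=
  TensorProduct.lift (LinearMap.mk₂ 𝕜
    (fun w f => ⟨TensorProduct.mk 𝕜 W V w ∘ₗ f.1, fun k h => by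
      simp [f.2 k h, trivTensorAct, Module.endTensorEndAlgHom_apply]⟩)
    (fun w w' f => by ext h; simp)
    (fun c w f => by ext h; simp [TensorProduct.smul_tmul'])
    (fun w f f' => by ext h; simp [TensorProduct.tmul_add])
    (fun c w f => by ext h; simp))

end Res

/-! ### Comodule induction -/

section Cotensor
variable {𝕜 : Type u} [Field 𝕜] {K H : Type u} [Ring K] [Ring H] [Bialgebra 𝕜 K] [Bialgebra 𝕜 H]
  (φ : K →ₐc[𝕜] H)
  {V W : Type u} [AddCommGroup V] [Module 𝕜 V] [AddCommGroup W] [Module 𝕜 W]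

/-- The map `k ⊗ w ↦ k₍₁₎ ⊗ φ(k₍₂₎) ⊗ w`. -/
noncomputable def cotensorRight (W : Type u) [AddCommGroup W] [Module 𝕜 W] :
    K ⊗[𝕜] W →ₗ[𝕜] K ⊗[𝕜] (H ⊗[𝕜] W) :=
  (TensorProduct.assoc 𝕜 K H W).toLinearMap ∘ₗ
    ((φ : K →ₗ[𝕜] H).lTensor K ∘ₗ (Coalgebra.comul (R := 𝕜) (A := K))).rTensor W

/-- The cotensor product `K □_H W`, the equalizer of `k ⊗ w ↦ k ⊗ w⁽⁻¹⁾ ⊗ w⁽⁰⁾` and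
`k ⊗ w ↦ k₍₁₎ ⊗ φ(k₍₂₎) ⊗ w` inside `K ⊗ W`. -/
noncomputable def cotensor (δ : W →ₗ[𝕜] H ⊗[𝕜] W) : Submodule 𝕜 (K ⊗[𝕜] W) :=
  LinearMap.eqLocus (δ.lTensor K) (cotensorRight φ W)

/-- The map `k ⊗ w ↦ k₍₁₎ ⊗ (k₍₂₎ ⊗ w)`. -/
noncomputable def freeCoact (𝕜 K W : Type u) [Field 𝕜] [Ring K] [Bialgebra 𝕜 K]
    [AddCommGroup W] [Module 𝕜 W] : K ⊗[𝕜] W →ₗ[𝕜] K ⊗[𝕜] (K ⊗[𝕜] W) :=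
  (TensorProduct.assoc 𝕜 K K W).toLinearMap ∘ₗ (Coalgebra.comul (R := 𝕜) (A := K)).rTensor W

theorem freeCoact_coassoc : (TensorProduct.assoc 𝕜 K K (K ⊗[𝕜] W)).toLinearMap ∘ₗ
    (Coalgebra.comul (R := 𝕜) (A := K)).rTensor (K ⊗[𝕜] W) ∘ₗ freeCoact 𝕜 K W =
      (freeCoact 𝕜 K W).lTensor K ∘ₗ freeCoact 𝕜 K W := by
  ext k w
  have := congr(((TensorProduct.assoc 𝕜 K K W).toLinearMap.lTensor K)
    (TensorProduct.assoc 𝕜 K (K ⊗[𝕜] K) W ($(Coalgebra.coassoc_apply (R := 𝕜) k) ⊗ₜ[𝕜] w)))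
  simp only [TensorProduct.AlgebraTensorModule.curry_apply, LinearMap.restrictScalars_self,
    TensorProduct.curry_apply, LinearMap.comp_apply, LinearEquiv.coe_coe, freeCoact,
    LinearMap.rTensor_tmul, LinearMap.lTensor_comp] at this ⊢
  generalize (Coalgebra.comul k : K ⊗[𝕜] K) = y at this ⊢
  have h1 : ∀ y : K ⊗[𝕜] K, TensorProduct.assoc 𝕜 K K (K ⊗[𝕜] W)
      ((Coalgebra.comul (R := 𝕜) (A := K)).rTensor (K ⊗[𝕜] W)
        (TensorProduct.assoc 𝕜 K K W (y ⊗ₜ w))) =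
      (TensorProduct.assoc 𝕜 K K W).toLinearMap.lTensor K (TensorProduct.assoc 𝕜 K (K ⊗[𝕜] K) W
        (TensorProduct.assoc 𝕜 K K K
          ((Coalgebra.comul (R := 𝕜) (A := K)).rTensor K y) ⊗ₜ w)) := by
    intro y
    induction y using TensorProduct.induction_on with
    | zero => simp
    | add x y hx hy => simp only [map_add, TensorProduct.add_tmul, hx, hy]
    | tmul a b =>
      simp only [TensorProduct.assoc_tmul, LinearMap.rTensor_tmul]
      generalize (Coalgebra.comul a : K ⊗[𝕜] K) = z
      induction z using TensorProduct.induction_on with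
      | zero => simp
      | add x y hx hy => simp only [map_add, TensorProduct.add_tmul, hx, hy]
      | tmul c d => simp
  have h2 : ∀ y : K ⊗[𝕜] K, (TensorProduct.assoc 𝕜 K K W).toLinearMap.lTensor K
      (((Coalgebra.comul (R := 𝕜) (A := K)).rTensor W).lTensor K
        (TensorProduct.assoc 𝕜 K K W (y ⊗ₜ w))) =
      (TensorProduct.assoc 𝕜 K K W).toLinearMap.lTensor K (TensorProduct.assoc 𝕜 K (K ⊗[𝕜] K) W
        ((Coalgebra.comul (R := 𝕜) (A := K)).lTensor K y ⊗ₜ w)) := by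
    intro y
    induction y using TensorProduct.induction_on with
    | zero => simp
    | add x y hx hy => simp only [map_add, TensorProduct.add_tmul, hx, hy]
    | tmul a b => simp
  rw [h1, h2]; exact this

theorem freeCoact_counit : (Coalgebra.counit (R := 𝕜) (A := K)).rTensor (K ⊗[𝕜] W) ∘ₗ
    freeCoact 𝕜 K W = TensorProduct.mk 𝕜 𝕜 (K ⊗[𝕜] W) 1 := by
  ext k w
  have := congr(TensorProduct.assoc 𝕜 𝕜 K W
    ($(Coalgebra.rTensor_counit_comul (R := 𝕜) k) ⊗ₜ[𝕜] w))
  simp only [TensorProduct.AlgebraTensorModule.curry_apply, LinearMap.restrictScalars_self,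
    TensorProduct.curry_apply, LinearMap.comp_apply, LinearEquiv.coe_coe, freeCoact,
    LinearMap.rTensor_tmul, TensorProduct.mk_apply] at this ⊢
  rw [TensorProduct.assoc_tmul] at this
  rw [← this]
  generalize (Coalgebra.comul k : K ⊗[𝕜] K) = y
  induction y using TensorProduct.induction_on with
  | zero => simp
  | add x y hx hy => simp only [map_add, TensorProduct.add_tmul, hx, hy]
  | tmul a b => simp

theorem freeCoact_natural (f : V →ₗ[𝕜] W) :
    freeCoact 𝕜 K W ∘ₗ f.lTensor K = (f.lTensor K).lTensor K ∘ₗ freeCoact 𝕜 K V := by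
  ext k v
  simp only [TensorProduct.AlgebraTensorModule.curry_apply, LinearMap.restrictScalars_self,
    TensorProduct.curry_apply, LinearMap.comp_apply, LinearEquiv.coe_coe, freeCoact,
    LinearMap.rTensor_tmul, LinearMap.lTensor_tmul]
  generalize (Coalgebra.comul k : K ⊗[𝕜] K) = y
  induction y using TensorProduct.induction_on with
  | zero => simp
  | add x y hx hy => simp only [map_add, TensorProduct.add_tmul, hx, hy]
  | tmul a b => simp

theorem freeCoact_right : (cotensorRight φ W).lTensor K ∘ₗ freeCoact 𝕜 K W =
    freeCoact 𝕜 K (H ⊗[𝕜] W) ∘ₗ cotensorRight φ W := by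
  ext k w
  have := LinearMap.congr_fun (freeCoact_coassoc (𝕜 := 𝕜) (K := K) (W := W)) (k ⊗ₜ w)
  have key := congr((((φ : K →ₗ[𝕜] H).rTensor W).lTensor K).lTensor K $this)
  simp only [LinearMap.comp_apply, LinearEquiv.coe_coe] at key
  simp only [TensorProduct.AlgebraTensorModule.curry_apply, LinearMap.restrictScalars_self,
    TensorProduct.curry_apply, LinearMap.comp_apply]
  have h1 : ∀ x : K ⊗[𝕜] W, cotensorRight φ W x =
      ((φ : K →ₗ[𝕜] H).rTensor W).lTensor K (freeCoact 𝕜 K W x) := by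
    intro x
    induction x using TensorProduct.induction_on with
    | zero => simp
    | add x y hx hy => simp only [map_add, hx, hy]
    | tmul k w =>
      simp only [cotensorRight, freeCoact, LinearMap.comp_apply, LinearEquiv.coe_coe,
        LinearMap.rTensor_tmul]
      generalize (Coalgebra.comul k : K ⊗[𝕜] K) = y
      induction y using TensorProduct.induction_on with
      | zero => simp
      | add x y hx hy => simp only [map_add, TensorProduct.add_tmul, hx, hy]
      | tmul a b => simp
  have h2 : cotensorRight φ W = ((φ : K →ₗ[𝕜] H).rTensor W).lTensor K ∘ₗ freeCoact 𝕜 K W :=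
    LinearMap.ext h1
  have h3 := LinearMap.congr_fun (freeCoact_natural (K := K) ((φ : K →ₗ[𝕜] H).rTensor W))
    (freeCoact 𝕜 K W (k ⊗ₜ w))
  simp only [LinearMap.comp_apply] at h3
  rw [h1, h3, h2, LinearMap.lTensor_comp, LinearMap.comp_apply]
  refine key.symm.trans ?_
  congr 1
  
theorem freeCoact_mem (δ : W →ₗ[𝕜] H ⊗[𝕜] W) (x : cotensor φ δ) :
    freeCoact 𝕜 K W x.1 ∈ LinearMap.range ((cotensor φ δ).subtype.lTensor K) := by
  have h : LinearMap.eqLocus ((δ.lTensor K).lTensor K) ((cotensorRight φ W).lTensor K) =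
      LinearMap.range ((cotensor φ δ).subtype.lTensor K) :=
    Module.Flat.eqLocus_lTensor_eq 𝕜 K (δ.lTensor K) (cotensorRight φ W)
  rw [← h, LinearMap.mem_eqLocus, ← LinearMap.comp_apply, ← freeCoact_natural,
    LinearMap.comp_apply, x.2, ← LinearMap.comp_apply ((cotensorRight φ W).lTensor K),
    freeCoact_right, LinearMap.comp_apply]

theorem lTensor_subtype_injective (δ : W →ₗ[𝕜] H ⊗[𝕜] W) (M : Type u) [AddCommGroup M]
    [Module 𝕜 M] : Function.Injective ((cotensor φ δ).subtype.lTensor M) :=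
  Module.Flat.lTensor_preserves_injective_linearMap _ (cotensor φ δ).injective_subtype

/-- The coaction `k ⊗ w ↦ k₍₁₎ ⊗ (k₍₂₎ ⊗ w)` on the cotensor product `K □_H W`. -/
noncomputable def cotensorCoact (δ : W →ₗ[𝕜] H ⊗[𝕜] W) :
    cotensor φ δ →ₗ[𝕜] K ⊗[𝕜] cotensor φ δ :=
  LinearMap.codRestrictOfInjective (freeCoact 𝕜 K W ∘ₗ (cotensor φ δ).subtype)
    ((cotensor φ δ).subtype.lTensor K) (lTensor_subtype_injective φ δ K) (freeCoact_mem φ δ)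

theorem cotensorCoact_spec (δ : W →ₗ[𝕜] H ⊗[𝕜] W) :
    (cotensor φ δ).subtype.lTensor K ∘ₗ cotensorCoact φ δ =
      freeCoact 𝕜 K W ∘ₗ (cotensor φ δ).subtype :=
  LinearMap.codRestrictOfInjective_comp ..

theorem cotensorCoact_isCoact (δ : W →ₗ[𝕜] H ⊗[𝕜] W) :
    IsCoact (V := cotensor φ δ) (cotensorCoact φ δ) where
  coassoc := by
    have hinj : Function.Injective (((cotensor φ δ).subtype.lTensor K).lTensor K) :=
      Module.Flat.lTensor_preserves_injective_linearMap _ (lTensor_subtype_injective φ δ K)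
    have h1 := freeCoact_natural (𝕜 := 𝕜) (K := K) (V := cotensor φ δ) (W := K ⊗[𝕜] W)
      (cotensor φ δ).subtype
    ext x
    apply hinj
    have e1 := LinearMap.congr_fun h1 (cotensorCoact φ δ x)
    have e2 := LinearMap.congr_fun (cotensorCoact_spec φ δ) x
    have e3 := LinearMap.congr_fun (freeCoact_coassoc (𝕜 := 𝕜) (K := K) (W := W)) x.1
    simp only [LinearMap.comp_apply, Submodule.subtype_apply] at e1 e2 e3
    have e4 : ((cotensor φ δ).subtype.lTensor K).lTensor K ((cotensorCoact φ δ).lTensor K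
        (cotensorCoact φ δ x)) = (freeCoact 𝕜 K W).lTensor K
          ((cotensor φ δ).subtype.lTensor K (cotensorCoact φ δ x)) := by
      rw [← LinearMap.comp_apply, ← LinearMap.lTensor_comp, cotensorCoact_spec,
        LinearMap.lTensor_comp, LinearMap.comp_apply]
    simp only [LinearMap.comp_apply, LinearEquiv.coe_coe]
    rw [e4, e2, ← e3, ← e2]
    exact e1.symm
  counit := by
    have hinj := lTensor_subtype_injective φ δ 𝕜
    ext x
    apply hinj
    have e2 := LinearMap.congr_fun (cotensorCoact_spec φ δ) x
    have e3 := LinearMap.congr_fun (freeCoact_counit (𝕜 := 𝕜) (K := K) (W := W)) x.1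
    simp only [LinearMap.comp_apply, Submodule.subtype_apply] at e2 e3
    rw [LinearMap.comp_apply, ← LinearMap.comp_apply, LinearMap.lTensor_comp_rTensor,
      ← LinearMap.rTensor_comp_lTensor, LinearMap.comp_apply, e2, e3]
    simp

variable {φ} in
/-- The map induced on cotensor products by a colinear map. -/
noncomputable def cotensorMap {δ : V →ₗ[𝕜] H ⊗[𝕜] V} {γ : W →ₗ[𝕜] H ⊗[𝕜] W} {f : V →ₗ[𝕜] W}
    (hf : γ ∘ₗ f = f.lTensor H ∘ₗ δ) : cotensor φ δ →ₗ[𝕜] cotensor φ γ :=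
  (f.lTensor K).restrict (fun x hx => by
    have h1 : cotensorRight φ W ∘ₗ f.lTensor K =
        (f.lTensor H).lTensor K ∘ₗ cotensorRight φ V := by
      ext k v
      simp only [TensorProduct.AlgebraTensorModule.curry_apply, LinearMap.restrictScalars_self,
        TensorProduct.curry_apply, LinearMap.comp_apply, LinearEquiv.coe_coe, cotensorRight,
        LinearMap.rTensor_tmul, LinearMap.lTensor_tmul]
      generalize (Coalgebra.comul k : K ⊗[𝕜] K) = y
      induction y using TensorProduct.induction_on with
      | zero => simp
      | add x y hx hy => simp only [map_add, TensorProduct.add_tmul, hx, hy]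
      | tmul a b => simp
    have hx' : δ.lTensor K x = cotensorRight φ V x := hx
    have h2 := LinearMap.congr_fun h1 x
    simp only [LinearMap.comp_apply] at h2
    change γ.lTensor K (f.lTensor K x) = cotensorRight φ W (f.lTensor K x)
    rw [h2, ← hx', ← LinearMap.comp_apply, ← LinearMap.lTensor_comp, hf, LinearMap.lTensor_comp,
      LinearMap.comp_apply])

theorem cotensorMap_colinear {δ : V →ₗ[𝕜] H ⊗[𝕜] V} {γ : W →ₗ[𝕜] H ⊗[𝕜] W} {f : V →ₗ[𝕜] W}
    (hf : γ ∘ₗ f = f.lTensor H ∘ₗ δ) : cotensorCoact φ γ ∘ₗ cotensorMap hf =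
      (cotensorMap hf).lTensor K ∘ₗ cotensorCoact φ δ := by
  have h1 : (cotensor φ γ).subtype ∘ₗ cotensorMap hf = f.lTensor K ∘ₗ (cotensor φ δ).subtype := rfl
  ext x
  apply lTensor_subtype_injective φ γ K
  have e1 := LinearMap.congr_fun (cotensorCoact_spec φ γ) (cotensorMap hf x)
  have e2 := LinearMap.congr_fun (cotensorCoact_spec φ δ) x
  have e3 := LinearMap.congr_fun (freeCoact_natural (K := K) f) x.1
  simp only [LinearMap.comp_apply] at e1 e2 e3
  simp only [LinearMap.comp_apply]
  rw [e1, ← LinearMap.comp_apply (LinearMap.lTensor K (cotensor φ γ).subtype),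
    ← LinearMap.lTensor_comp, h1, LinearMap.lTensor_comp, LinearMap.comp_apply, e2]
  exact e3

/-- Comodule induction `W ↦ K □_H W` along `φ : K → H`. -/
noncomputable def indComod : LComod 𝕜 H ⥤ LComod 𝕜 K where
  obj W := ⟨cotensor φ W.coact, cotensorCoact φ W.coact, cotensorCoact_isCoact φ W.coact⟩
  map f := ⟨cotensorMap f.comm, cotensorMap_colinear φ f.comm⟩
  map_id W := LComod.hom_ext (LinearMap.ext fun x => Subtype.ext (by
    change (LinearMap.id.lTensor K) x.1 = x.1
    rw [LinearMap.lTensor_id]; rfl))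
  map_comp f g := LComod.hom_ext (LinearMap.ext fun x => Subtype.ext
    (LinearMap.lTensor_comp_apply K g.toLin f.toLin x.1))

end Cotensor

/-! ### Structure maps of the induced Yetter--Drinfeld modules -/

section Formulas
variable {𝕜 : Type u} [Field 𝕜] {K H : Type u} [Ring K] [Ring H] [HopfAlgebra 𝕜 K]
  [HopfAlgebra 𝕜 H] (φ : K →ₐc[𝕜] H)
  {V : Type u} [AddCommGroup V] [Module 𝕜 V]

/-- The iterated coproduct `h ↦ (h₍₁₎ ⊗ h₍₃₎) ⊗ h₍₂₎`. -/
noncomputable def comulTri (𝕜 H : Type u) [Field 𝕜] [Ring H] [Bialgebra 𝕜 H] :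
    H →ₗ[𝕜] (H ⊗[𝕜] H) ⊗[𝕜] H :=
  (TensorProduct.assoc 𝕜 H H H).symm.toLinearMap ∘ₗ
    (TensorProduct.comm 𝕜 H H).toLinearMap.lTensor H ∘ₗ
    (Coalgebra.comul (R := 𝕜) (A := H)).lTensor H ∘ₗ Coalgebra.comul

/-- The map `(a ⊗ c) ⊗ b ↦ (l ⊗ v ↦ a l S(c) ⊗ φ(b) v)`. -/
noncomputable def indActAux (ρ : H →ₐ[𝕜] Module.End 𝕜 V) :
    (K ⊗[𝕜] K) ⊗[𝕜] K →ₗ[𝕜] Module.End 𝕜 (K ⊗[𝕜] V) :=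
  TensorProduct.homTensorHomMap (RingHom.id 𝕜) K V K V ∘ₗ
    TensorProduct.map
      (LinearMap.mul' 𝕜 (Module.End 𝕜 K) ∘ₗ TensorProduct.map (LinearMap.mul 𝕜 K)
        ((LinearMap.mul 𝕜 K).flip ∘ₗ HopfAlgebra.antipode 𝕜))
      (ρ.toLinearMap ∘ₗ (φ : K →ₗ[𝕜] H))

theorem indActAux_tmul (ρ : H →ₐ[𝕜] Module.End 𝕜 V) (a b c l : K) (v : V) :
    indActAux φ ρ ((a ⊗ₜ c) ⊗ₜ b) (l ⊗ₜ v) =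
      (a * (l * HopfAlgebra.antipode 𝕜 c)) ⊗ₜ ρ (φ b) v := rfl

/-- The map `k ↦ (l ⊗ v ↦ k₍₁₎ l S(k₍₃₎) ⊗ φ(k₍₂₎) v)`. -/
noncomputable def indAct (ρ : H →ₐ[𝕜] Module.End 𝕜 V) : K →ₗ[𝕜] Module.End 𝕜 (K ⊗[𝕜] V) :=
  indActAux φ ρ ∘ₗ comulTri 𝕜 K

/-- For a linear map `f : H → V`, the map
`(a ⊗ c) ⊗ b ↦ S(a) φ(f(b)⁽⁻¹⁾) c ⊗ f(b)⁽⁰⁾`. -/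
noncomputable def coindCoactAux (δ : V →ₗ[𝕜] K ⊗[𝕜] V) (f : H →ₗ[𝕜] V) :
    (H ⊗[𝕜] H) ⊗[𝕜] H →ₗ[𝕜] H ⊗[𝕜] V :=
  TensorProduct.lift (LinearMap.rTensorHom V) ∘ₗ
    TensorProduct.map
      (LinearMap.mul' 𝕜 (Module.End 𝕜 H) ∘ₗ TensorProduct.map
        (LinearMap.mul 𝕜 H ∘ₗ HopfAlgebra.antipode 𝕜) (LinearMap.mul 𝕜 H).flip)
      (resCoact φ δ ∘ₗ f)

theorem coindCoactAux_tmul (δ : V →ₗ[𝕜] K ⊗[𝕜] V) (f : H →ₗ[𝕜] V) (a b c : H) (k : K) (v : V)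
    (hb : δ (f b) = k ⊗ₜ v) : coindCoactAux φ δ f ((a ⊗ₜ c) ⊗ₜ b) =
      (HopfAlgebra.antipode 𝕜 a * (φ k * c)) ⊗ₜ v := by
  change LinearMap.rTensor V _ ((φ : K →ₗ[𝕜] H).rTensor V (δ (f b))) = _
  rw [hb]; rfl

/-- For a linear map `f : H → V`, the map
`h ↦ S(h₍₁₎) φ(f(h₍₂₎)⁽⁻¹⁾) h₍₃₎ ⊗ f(h₍₂₎)⁽⁰⁾`. -/
noncomputable def coindCoact (δ : V →ₗ[𝕜] K ⊗[𝕜] V) (f : H →ₗ[𝕜] V) : H →ₗ[𝕜] H ⊗[𝕜] V :=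
  coindCoactAux φ δ f ∘ₗ comulTri 𝕜 H

/-- Evaluation `f ↦ f(h)` on `Hom_K(H, V)`. -/
def homKEval (ρ : K →ₐ[𝕜] Module.End 𝕜 V) (h : H) : homK φ ρ →ₗ[𝕜] V :=
  LinearMap.applyₗ h ∘ₗ (homK φ ρ).subtype

end Formulas

end HopfInd

open HopfInd

/-! A Yetter–Drinfeld module is a module or comodule together with half-braidings against all
others. If a right adjoint `R` of a strong monoidal functor `G` satisfies the projection formula, a
half-braiding of `V` against the objects `G A` is carried by `lproj` and `rproj` to a half-braiding
of `R V` against all `A`, compatibly with the lax structure. The theorem is this principle for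
restriction along `φ`. The induced structures are found this way, but their axioms are checked
directly, in Sweedler notation.

Comodules. On `K □_H W ⊆ K ⊗ W` the map `lproj` is the restriction of the twist `a ⊗ (k ⊗ w) ↦ a⁽⁻¹⁾
k ⊗ (a⁽⁰⁾ ⊗ w)`, and `rproj` is its mirror image. The right twist is inverted by the antipode, the
left one by the inverse antipode (`twistRight_bijective`, `twistLeft_bijective`). Twists intertwine
the two maps whose equalizer is the cotensor product, and tensoring over a field preserves
equalizers, so the bijections restrict; this is `indAdj_projectionFormula`.

Write `k ▷ (l ⊗ v) = k₍₁₎ l ⊗ φ(k₍₂₎) v` and `(l ⊗ v) ◁ k = l k ⊗ v`. These operations commute, and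
the induced action is `k · x = (k₍₁₎ ▷ x) ◁ S(k₍₂₎)`. Equivalently `(k₍₁₎ · x) ◁ k₍₂₎ = k ▷ x`
(`sw_rightMul_indAct`), and this relation determines `k · x`, because convolution with a right
action is injective (`eq_of_sw_right_eq`). Stability of the cotensor product, the Yetter–Drinfeld
condition and compatibility with products are proved by convolving with such an action, after which
only the simpler operation `▷` remains. The Yetter–Drinfeld condition of `V` and the cotensor
equation meet in `IsYD.sw_leftAct`.

Modules. A finite projective `K`-module has a finite dual basis, and this makes `W ⊗ Hom_K(H, V) →
Hom_K(H, W^triv ⊗ V)` bijective (`homKTensor_bijective`). After this identification, `lproj` and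
`rproj` are convolution with the action on `A`, on the left and on the right. They are inverted by
convolution with `S` and with `S⁻¹`, and the inverse convolution turns maps that are `K`-linear for
the diagonal action into maps that are `K`-linear for the trivial action on `A`. This is
`coindAdj_projectionFormula`.

Taking `A = H` and evaluating the transported half-braiding on `f ⊗ 1` gives the relation `h₍₁₎
f⁽⁻¹⁾ ⊗ f⁽⁰⁾(h₍₂₎) = φ(f(h₍₁₎)⁽⁻¹⁾) h₍₂₎ ⊗ f(h₍₁₎)⁽⁰⁾` (`sw_homKCoact`). The left side depends
injectively on `f⁽⁻¹⁾ ⊗ f⁽⁰⁾`, so the relation determines the coaction, and solving it with `S`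
gives the stated formula. Coassociativity, the Yetter–Drinfeld condition, colinearity of the lax
structure and the braiding all follow from this relation, without use of the explicit formula. -/

namespace HopfInd

/-! ### Sweedler sums -/

-- A Sweedler computation is legitimate only when the summand is linear in every leg. Registering
-- linearity with `fun_prop` lets these side conditions be discharged automatically.
attribute [fun_prop] IsLinearMap

/-! ### Linearity of expressions in one variable. -/

section Linear
variable {𝕜 : Type*} [CommSemiring 𝕜] {A B C M N P : Type*} [AddCommMonoid A] [Module 𝕜 A]
  [AddCommMonoid B] [Module 𝕜 B] [AddCommMonoid C] [Module 𝕜 C] [AddCommMonoid M] [Module 𝕜 M]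
  [AddCommMonoid N] [Module 𝕜 N] [AddCommMonoid P] [Module 𝕜 P]

@[fun_prop] theorem isLinearMap_id : IsLinearMap 𝕜 (fun x : A => x) := ⟨fun _ _ => rfl, fun _ _ => rfl⟩

@[fun_prop] theorem isLinearMap_comp {f : B → C} {g : A → B} (hf : IsLinearMap 𝕜 f)
    (hg : IsLinearMap 𝕜 g) : IsLinearMap 𝕜 (fun x => f (g x)) :=
  ⟨fun x y => by rw [hg.map_add, hf.map_add], fun c x => by rw [hg.map_smul, hf.map_smul]⟩

@[fun_prop] theorem isLinearMap_linearMap (L : B →ₗ[𝕜] C) : IsLinearMap 𝕜 (fun x => L x) :=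
  L.isLinear

@[fun_prop] theorem isLinearMap_linearMap_apply {L : A → B →ₗ[𝕜] C} (hL : IsLinearMap 𝕜 L)
    (b : B) : IsLinearMap 𝕜 (fun x => L x b) :=
  ⟨fun x y => by rw [hL.map_add]; rfl, fun c x => by rw [hL.map_smul]; rfl⟩

@[fun_prop] theorem isLinearMap_linearEquiv (L : B ≃ₗ[𝕜] C) : IsLinearMap 𝕜 (fun x => L x) :=
  L.toLinearMap.isLinear

@[fun_prop] theorem isLinearMap_tmul_left {f : A → M} (hf : IsLinearMap 𝕜 f) (n : N) :
    IsLinearMap 𝕜 (fun x => f x ⊗ₜ[𝕜] n) :=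
  isLinearMap_comp (f := fun m : M => m ⊗ₜ[𝕜] n) ((TensorProduct.mk 𝕜 M N).flip n).isLinear hf

@[fun_prop] theorem isLinearMap_tmul_right {f : A → N} (hf : IsLinearMap 𝕜 f) (m : M) :
    IsLinearMap 𝕜 (fun x => m ⊗ₜ[𝕜] f x) :=
  isLinearMap_comp (f := fun n : N => m ⊗ₜ[𝕜] n) (TensorProduct.mk 𝕜 M N m).isLinear hf

@[fun_prop] theorem isLinearMap_smul_right {f : A → N} (hf : IsLinearMap 𝕜 f) (c : 𝕜) :
    IsLinearMap 𝕜 (fun x => c • f x) :=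
  isLinearMap_comp (c • (LinearMap.id : N →ₗ[𝕜] N)).isLinear hf

@[fun_prop] theorem isLinearMap_smul_left {f : A → 𝕜} (hf : IsLinearMap 𝕜 f) (n : N) :
    IsLinearMap 𝕜 (fun x => f x • n) :=
  isLinearMap_comp (LinearMap.toSpanSingleton 𝕜 N n).isLinear hf

end Linear

section Alg
variable {𝕜 : Type*} [CommSemiring 𝕜] {A H K M : Type*} [AddCommMonoid A] [Module 𝕜 A]
  [Semiring H] [Algebra 𝕜 H] [Semiring K] [Algebra 𝕜 K] [AddCommMonoid M] [Module 𝕜 M]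

@[fun_prop] theorem isLinearMap_mul_left {f : A → H} (hf : IsLinearMap 𝕜 f) (b : H) :
    IsLinearMap 𝕜 (fun x => f x * b) :=
  isLinearMap_comp (LinearMap.mulRight 𝕜 b).isLinear hf

@[fun_prop] theorem isLinearMap_mul_right {f : A → H} (hf : IsLinearMap 𝕜 f) (b : H) :
    IsLinearMap 𝕜 (fun x => b * f x) :=
  isLinearMap_comp (LinearMap.mulLeft 𝕜 b).isLinear hf

@[fun_prop] theorem isLinearMap_algHom (f : H →ₐ[𝕜] K) : IsLinearMap 𝕜 (fun x => f x) :=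
  f.toLinearMap.isLinear

end Alg

@[fun_prop] theorem isLinearMap_bialgHom {𝕜 K H : Type*} [CommSemiring 𝕜] [Semiring K] [Bialgebra 𝕜 K]
    [Semiring H] [Bialgebra 𝕜 H] (φ : K →ₐc[𝕜] H) : IsLinearMap 𝕜 (fun x => φ x) :=
  (φ : K →ₗ[𝕜] H).isLinear

/-! ### Calculus of sums over a chosen decomposition of a tensor. -/

section Sweedler
variable {𝕜 : Type*} [CommSemiring 𝕜] {A B C D M N P Q : Type*} [AddCommMonoid A] [Module 𝕜 A]
  [AddCommMonoid B] [Module 𝕜 B] [AddCommMonoid C] [Module 𝕜 C] [AddCommMonoid D] [Module 𝕜 D]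
  [AddCommMonoid M] [Module 𝕜 M]
  [AddCommMonoid N] [Module 𝕜 N] [AddCommMonoid P] [AddCommMonoid Q]

/-- The sum `∑ f aᵢ bᵢ`, for a chosen expression `t = ∑ aᵢ ⊗ bᵢ`. -/
noncomputable def sw (t : A ⊗[𝕜] B) (f : A → B → P) : P :=
  ∑ i ∈ (TensorProduct.exists_finset t).choose, f i.1 i.2

-- The decomposition depends on `t` alone, so linearity in a parameter of the summand needs no
-- linearity in the legs `a`, `b`.
@[fun_prop] theorem isLinearMap_sw_right [Module 𝕜 P] (t : A ⊗[𝕜] B) (f : C → A → B → P)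
    (h : ∀ a b, IsLinearMap 𝕜 (fun x => f x a b)) :
    IsLinearMap 𝕜 (fun x => sw t (f x)) :=
  ⟨fun x y => by simp only [sw, (h _ _).map_add, Finset.sum_add_distrib],
    fun c x => by simp only [sw, (h _ _).map_smul, Finset.smul_sum]⟩

theorem sw_tmul_self (t : A ⊗[𝕜] B) : sw t (fun a b => a ⊗ₜ[𝕜] b) = t :=
  (TensorProduct.exists_finset t).choose_spec.symm

theorem map_sw {F : Type*} [FunLike F P Q] [AddMonoidHomClass F P Q] (L : F) (t : A ⊗[𝕜] B)
    (f : A → B → P) : L (sw t f) = sw t (fun a b => L (f a b)) := map_sum ..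

/-- Both decompositions are fixed finite sets, so this is an interchange of finite sums and needs no
bilinearity. -/
theorem sw_comm (t : A ⊗[𝕜] B) (s : M ⊗[𝕜] N) (f : A → B → M → N → P) :
    sw t (fun a b => sw s (fun m n => f a b m n)) =
      sw s (fun m n => sw t (fun a b => f a b m n)) := Finset.sum_comm

variable [Module 𝕜 P] [Module 𝕜 Q]

theorem isLinearMap_map_sw {L : P → Q} (hL : IsLinearMap 𝕜 L) (t : A ⊗[𝕜] B)
    (f : A → B → P) : L (sw t f) = sw t (fun a b => L (f a b)) :=
  HopfInd.map_sw (hL.mk' L) t f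

/-- The linear map on a tensor product given by a function linear in both arguments. -/
noncomputable def bilift (f : A → B → P) (h₁ : ∀ b, IsLinearMap 𝕜 (fun a => f a b))
    (h₂ : ∀ a, IsLinearMap 𝕜 (fun b => f a b)) : A ⊗[𝕜] B →ₗ[𝕜] P :=
  TensorProduct.lift (LinearMap.mk₂ 𝕜 f (fun a a' b => (h₁ b).map_add a a')
    (fun c a b => (h₁ b).map_smul c a) (fun a b b' => (h₂ a).map_add b b')
    (fun c a b => (h₂ a).map_smul c b))

/-- Here the choice of decomposition becomes immaterial: for bilinear `f` the sum is the value of a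
linear map on `t`. Every lemma that changes the tensor under `sw` rests on this. -/
theorem bilift_apply (f : A → B → P) (h₁ : ∀ b, IsLinearMap 𝕜 (fun a => f a b))
    (h₂ : ∀ a, IsLinearMap 𝕜 (fun b => f a b)) (t : A ⊗[𝕜] B) :
    bilift f h₁ h₂ t = sw t f := by
  conv_lhs => rw [← sw_tmul_self t, map_sw]
  rfl

/-- The decomposition chosen for a pure tensor need not be the obvious one, hence the bilinearity
hypotheses. -/
theorem sw_tmul (a : A) (b : B) (f : A → B → P) (h₁ : ∀ b, IsLinearMap 𝕜 (fun a => f a b))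
    (h₂ : ∀ a, IsLinearMap 𝕜 (fun b => f a b)) : sw (a ⊗ₜ[𝕜] b) f = f a b := by
  rw [← bilift_apply f h₁ h₂]; rfl

theorem linearMap_apply_eq_sw (L : A ⊗[𝕜] B →ₗ[𝕜] P) (t : A ⊗[𝕜] B) :
    L t = sw t (fun a b => L (a ⊗ₜ b)) := by
  rw [← map_sw, sw_tmul_self]

@[fun_prop] theorem isLinearMap_sw_left {g : C → A ⊗[𝕜] B} (hg : IsLinearMap 𝕜 g) (f : A → B → P)
    (h₁ : ∀ b, IsLinearMap 𝕜 (fun a => f a b)) (h₂ : ∀ a, IsLinearMap 𝕜 (fun b => f a b)) :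
    IsLinearMap 𝕜 (fun x => sw (g x) f) := by
  simp only [← bilift_apply f h₁ h₂]
  exact isLinearMap_comp (bilift f h₁ h₂).isLinear hg

/-- Evaluate a sum over the image of a tensor under a linear map. -/
theorem sw_linearMap (L : C ⊗[𝕜] D →ₗ[𝕜] A ⊗[𝕜] B) (t : C ⊗[𝕜] D) (f : A → B → P)
    (h₁ : ∀ b, IsLinearMap 𝕜 (fun a => f a b)) (h₂ : ∀ a, IsLinearMap 𝕜 (fun b => f a b)) :
    sw (L t) f = sw t (fun c d => sw (L (c ⊗ₜ d)) f) := by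
  simp only [← bilift_apply f h₁ h₂]
  rw [← LinearMap.comp_apply, linearMap_apply_eq_sw]
  rfl

theorem sw_map (u : C →ₗ[𝕜] A) (v : D →ₗ[𝕜] B) (t : C ⊗[𝕜] D) (f : A → B → P)
    (h₁ : ∀ b, IsLinearMap 𝕜 (fun a => f a b)) (h₂ : ∀ a, IsLinearMap 𝕜 (fun b => f a b)) :
    sw (TensorProduct.map u v t) f = sw t (fun c d => f (u c) (v d)) := by
  rw [sw_linearMap _ _ _ h₁ h₂]
  simp only [TensorProduct.map_tmul, sw_tmul _ _ f h₁ h₂]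

theorem sw_rTensor (u : C →ₗ[𝕜] A) (t : C ⊗[𝕜] B) (f : A → B → P)
    (h₁ : ∀ b, IsLinearMap 𝕜 (fun a => f a b)) (h₂ : ∀ a, IsLinearMap 𝕜 (fun b => f a b)) :
    sw (u.rTensor B t) f = sw t (fun c d => f (u c) d) := sw_map u .id t f h₁ h₂

theorem sw_lTensor (v : D →ₗ[𝕜] B) (t : A ⊗[𝕜] D) (f : A → B → P)
    (h₁ : ∀ b, IsLinearMap 𝕜 (fun a => f a b)) (h₂ : ∀ a, IsLinearMap 𝕜 (fun b => f a b)) :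
    sw (v.lTensor A t) f = sw t (fun c d => f c (v d)) := sw_map .id v t f h₁ h₂

theorem sw_sw (s : C ⊗[𝕜] D) (g : C → D → A ⊗[𝕜] B) (f : A → B → P)
    (h₁ : ∀ b, IsLinearMap 𝕜 (fun a => f a b)) (h₂ : ∀ a, IsLinearMap 𝕜 (fun b => f a b)) :
    sw (sw s g) f = sw s (fun c d => sw (g c d) f) := by
  simp only [← bilift_apply f h₁ h₂, map_sw]

/-- Both sides are additive in `x`, which reduces the identity to pure tensors; this is the form in
which coassociativity is converted to sums. -/
theorem sw_assoc (x : (A ⊗[𝕜] B) ⊗[𝕜] C) (F : A → B → C → P)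
    (h₁ : ∀ b c, IsLinearMap 𝕜 (fun a => F a b c)) (h₂ : ∀ a c, IsLinearMap 𝕜 (fun b => F a b c))
    (h₃ : ∀ a b, IsLinearMap 𝕜 (fun c => F a b c)) :
    sw (TensorProduct.assoc 𝕜 A B C x) (fun a t => sw t (fun b c => F a b c)) =
      sw x (fun t c => sw t (fun a b => F a b c)) := by
  induction x using TensorProduct.induction_on with
  | zero => simp [← bilift_apply (fun (t : A ⊗[𝕜] B) c => sw t (fun a b => F a b c))
      (by intros; fun_prop) (by intros; fun_prop), ← bilift_apply (fun a (t : B ⊗[𝕜] C) =>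
        sw t (fun b c => F a b c)) (by intros; fun_prop) (by intros; fun_prop)]
  | add x y hx hy =>
    rw [map_add, (isLinearMap_sw_left isLinearMap_id _ _ _).map_add, hx, hy,
      (isLinearMap_sw_left isLinearMap_id _ _ _).map_add]
    all_goals intros; fun_prop
  | tmul t c =>
    rw [sw_tmul _ _ _ (by intros; fun_prop) (by intros; fun_prop)]
    induction t using TensorProduct.induction_on with
    | zero => simp [← bilift_apply (fun a b => F a b c)
        (by intros; fun_prop) (by intros; fun_prop), ← bilift_apply (fun a (t : B ⊗[𝕜] C) =>
          sw t (fun b c => F a b c)) (by intros; fun_prop) (by intros; fun_prop)]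
    | add x y hx hy =>
      rw [TensorProduct.add_tmul, map_add, (isLinearMap_sw_left isLinearMap_id _ _ _).map_add,
        hx, hy, (isLinearMap_sw_left isLinearMap_id _ _ _).map_add]
      all_goals intros; fun_prop
    | tmul a b =>
      rw [TensorProduct.assoc_tmul]
      repeat rw [sw_tmul _ _ _ (by intros; fun_prop) (by intros; fun_prop)]

end Sweedler



/-! ### Coalgebra and bialgebra axioms as rewriting rules for sums. -/

section Coalgebra
variable {𝕜 : Type*} [CommSemiring 𝕜] {A H P : Type*} [AddCommMonoid A] [Module 𝕜 A]
  [AddCommMonoid P] [Module 𝕜 P] [AddCommMonoid H] [Module 𝕜 H] [Coalgebra 𝕜 H]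

@[fun_prop] theorem isLinearMap_comul {f : A → H} (hf : IsLinearMap 𝕜 f) :
    IsLinearMap 𝕜 (fun x => Coalgebra.comul (R := 𝕜) (f x)) :=
  isLinearMap_comp (Coalgebra.comul (R := 𝕜) (A := H)).isLinear hf

@[fun_prop] theorem isLinearMap_counit {f : A → H} (hf : IsLinearMap 𝕜 f) :
    IsLinearMap 𝕜 (fun x => Coalgebra.counit (R := 𝕜) (f x)) :=
  isLinearMap_comp (Coalgebra.counit (R := 𝕜) (A := H)).isLinear hf

/-- Apply the trilinear function `F` to both sides of coassociativity. Used in both directions, it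
regroups the legs of an iterated coproduct. -/
theorem sw_comul_coassoc (h : H) (F : H → H → H → P)
    (h₁ : ∀ b c, IsLinearMap 𝕜 (fun a => F a b c)) (h₂ : ∀ a c, IsLinearMap 𝕜 (fun b => F a b c))
    (h₃ : ∀ a b, IsLinearMap 𝕜 (fun c => F a b c)) :
    sw (Coalgebra.comul (R := 𝕜) h) (fun a b => sw (Coalgebra.comul (R := 𝕜) a)
        (fun p q => F p q b)) =
      sw (Coalgebra.comul (R := 𝕜) h) (fun a b => sw (Coalgebra.comul (R := 𝕜) b)
        (fun p q => F a p q)) := by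
  have key := congr(sw $(Coalgebra.coassoc_apply (R := 𝕜) h)
    (fun a t => sw t (fun p q => F a p q)))
  rwa [sw_lTensor _ _ _ (by intros; fun_prop) (by intros; fun_prop),
    sw_assoc _ _ (by intros; fun_prop) (by intros; fun_prop) (by intros; fun_prop),
    sw_rTensor _ _ _ (by intros; fun_prop) (by intros; fun_prop)] at key

theorem sw_counit_left (h : H) (F : H → P) (hF : IsLinearMap 𝕜 F) :
    sw (Coalgebra.comul (R := 𝕜) h) (fun a b => Coalgebra.counit (R := 𝕜) a • F b) = F h := by
  have key := congr(sw $(Coalgebra.rTensor_counit_comul (R := 𝕜) h) (fun a t => a • F t))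
  rwa [sw_rTensor _ _ _ (by intros; fun_prop) (by intros; fun_prop),
    sw_tmul _ _ _ (by intros; fun_prop) (by intros; fun_prop), one_smul] at key

theorem sw_counit_right (h : H) (F : H → P) (hF : IsLinearMap 𝕜 F) :
    sw (Coalgebra.comul (R := 𝕜) h) (fun a b => Coalgebra.counit (R := 𝕜) b • F a) = F h := by
  have key := congr(sw $(Coalgebra.lTensor_counit_comul (R := 𝕜) h) (fun a t => t • F a))
  rwa [sw_lTensor _ _ _ (by intros; fun_prop) (by intros; fun_prop),
    sw_tmul _ _ _ (by intros; fun_prop) (by intros; fun_prop), one_smul] at key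

end Coalgebra

section Bialgebra
variable {𝕜 : Type*} [CommSemiring 𝕜] {A H K P : Type*} [AddCommMonoid A] [Module 𝕜 A]
  [AddCommMonoid P] [Module 𝕜 P] [Semiring H] [Bialgebra 𝕜 H] [Semiring K] [Bialgebra 𝕜 K]

theorem sw_comul_mul (a b : H) (F : H → H → P) (h₁ : ∀ b, IsLinearMap 𝕜 (fun a => F a b))
    (h₂ : ∀ a, IsLinearMap 𝕜 (fun b => F a b)) :
    sw (Coalgebra.comul (R := 𝕜) (a * b)) F = sw (Coalgebra.comul (R := 𝕜) a) (fun p q =>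
      sw (Coalgebra.comul (R := 𝕜) b) (fun r s => F (p * r) (q * s))) := by
  conv_lhs => rw [Bialgebra.comul_mul, ← sw_tmul_self (Coalgebra.comul a),
    ← sw_tmul_self (Coalgebra.comul b)]
  rw [isLinearMap_map_sw (L := fun t => sw (t * _) F) (by fun_prop)]
  congr 1; funext p q
  rw [isLinearMap_map_sw (L := fun t => sw (_ * t) F) (by fun_prop)]
  congr 1; funext r s
  rw [Algebra.TensorProduct.tmul_mul_tmul, sw_tmul _ _ _ h₁ h₂]

theorem sw_comul_one (F : H → H → P) (h₁ : ∀ b, IsLinearMap 𝕜 (fun a => F a b))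
    (h₂ : ∀ a, IsLinearMap 𝕜 (fun b => F a b)) :
    sw (Coalgebra.comul (R := 𝕜) (1 : H)) F = F 1 1 := by
  rw [Bialgebra.comul_one, Algebra.TensorProduct.one_def, sw_tmul _ _ _ h₁ h₂]

theorem sw_comul_bialgHom (φ : K →ₐc[𝕜] H) (k : K) (F : H → H → P)
    (h₁ : ∀ b, IsLinearMap 𝕜 (fun a => F a b)) (h₂ : ∀ a, IsLinearMap 𝕜 (fun b => F a b)) :
    sw (Coalgebra.comul (R := 𝕜) (φ k)) F =
      sw (Coalgebra.comul (R := 𝕜) k) (fun p q => F (φ p) (φ q)) := by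
  rw [← CoalgHomClass.map_comp_comul_apply]
  exact sw_map (φ : K →ₗ[𝕜] H) (φ : K →ₗ[𝕜] H) _ _ h₁ h₂

end Bialgebra

/-! ### Antipode identities as rewriting rules for sums. -/

section Hopf
variable {𝕜 : Type u} [Field 𝕜] {A : Type*} {H : Type u} {P : Type*} [AddCommMonoid A] [Module 𝕜 A]
  [AddCommMonoid P] [Module 𝕜 P] [Ring H] [HopfAlgebra 𝕜 H]

@[fun_prop] theorem isLinearMap_antipode {f : A → H} (hf : IsLinearMap 𝕜 f) :
    IsLinearMap 𝕜 (fun x => HopfAlgebra.antipode 𝕜 (f x)) :=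
  isLinearMap_comp (HopfAlgebra.antipode 𝕜 (A := H)).isLinear hf

theorem sw_antipode_mul (h : H) (F : H → P) (hF : IsLinearMap 𝕜 F) :
    sw (Coalgebra.comul (R := 𝕜) h) (fun a b => F (HopfAlgebra.antipode 𝕜 a * b)) =
      Coalgebra.counit (R := 𝕜) h • F 1 := by
  have key := congr(F $(HopfAlgebra.mul_antipode_rTensor_comul_apply (R := 𝕜) h))
  rw [linearMap_apply_eq_sw, sw_rTensor _ _ _ (by intros; fun_prop) (by intros; fun_prop),
    isLinearMap_map_sw hF, Algebra.algebraMap_eq_smul_one, hF.map_smul] at key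
  exact key

theorem sw_mul_antipode (h : H) (F : H → P) (hF : IsLinearMap 𝕜 F) :
    sw (Coalgebra.comul (R := 𝕜) h) (fun a b => F (a * HopfAlgebra.antipode 𝕜 b)) =
      Coalgebra.counit (R := 𝕜) h • F 1 := by
  have key := congr(F $(HopfAlgebra.mul_antipode_lTensor_comul_apply (R := 𝕜) h))
  rw [linearMap_apply_eq_sw, sw_lTensor _ _ _ (by intros; fun_prop) (by intros; fun_prop),
    isLinearMap_map_sw hF, Algebra.algebraMap_eq_smul_one, hF.map_smul] at key
  exact key

variable [InvertibleAntipode 𝕜 H]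

/-- The inverse antipode is an antipode for the opposite multiplication, so the legs occur in
reversed order compared with `sw_mul_antipode`. -/
theorem sw_mul_antipodeInv (h : H) (F : H → P) (hF : IsLinearMap 𝕜 F) :
    sw (Coalgebra.comul (R := 𝕜) h) (fun a b => F (b * antipodeInv 𝕜 H a)) =
      Coalgebra.counit (R := 𝕜) h • F 1 := by
  have key := congr(F $(LinearMap.congr_fun (mul_antipodeInv_right (𝕜 := 𝕜) (H := H)) h))
  simp only [LinearMap.comp_apply, Algebra.linearMap_apply] at key
  rw [← LinearMap.comp_apply, linearMap_apply_eq_sw,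
    sw_rTensor _ _ _ (by intros; fun_prop) (by intros; fun_prop),
    isLinearMap_map_sw hF, Algebra.algebraMap_eq_smul_one, hF.map_smul] at key
  exact key

theorem sw_antipodeInv_mul (h : H) (F : H → P) (hF : IsLinearMap 𝕜 F) :
    sw (Coalgebra.comul (R := 𝕜) h) (fun a b => F (antipodeInv 𝕜 H b * a)) =
      Coalgebra.counit (R := 𝕜) h • F 1 := by
  have key := congr(F $(LinearMap.congr_fun (mul_antipodeInv_left (𝕜 := 𝕜) (H := H)) h))
  simp only [LinearMap.comp_apply, Algebra.linearMap_apply] at key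
  rw [← LinearMap.comp_apply, linearMap_apply_eq_sw,
    sw_lTensor _ _ _ (by intros; fun_prop) (by intros; fun_prop),
    isLinearMap_map_sw hF, Algebra.algebraMap_eq_smul_one, hF.map_smul] at key
  exact key

theorem antipodeInv_mul (a b : H) :
    antipodeInv 𝕜 H (a * b) = antipodeInv 𝕜 H b * antipodeInv 𝕜 H a := by
  apply (InvertibleAntipode.bijective (𝕜 := 𝕜) (H := H)).1
  rw [HopfAlgebra.antipode_mul_antidistrib]
  simp only [antipode_antipodeInv]

end Hopf

/-! ### Comodule and Yetter–Drinfeld axioms as identities of sums. -/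

section Comodule
variable {𝕜 : Type u} [Field 𝕜] {H K V W U : Type u} {P : Type*} [Ring H] [Bialgebra 𝕜 H]
  [Ring K] [Bialgebra 𝕜 K] [AddCommGroup V] [Module 𝕜 V] [AddCommGroup W] [Module 𝕜 W]
  [AddCommGroup U] [Module 𝕜 U] [AddCommMonoid P] [Module 𝕜 P]

theorem IsCoact.sw_coassoc {δ : V →ₗ[𝕜] H ⊗[𝕜] V} (hδ : IsCoact δ) (v : V) (F : H → H → V → P)
    (h₁ : ∀ b c, IsLinearMap 𝕜 (fun a => F a b c)) (h₂ : ∀ a c, IsLinearMap 𝕜 (fun b => F a b c))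
    (h₃ : ∀ a b, IsLinearMap 𝕜 (fun c => F a b c)) :
    sw (δ v) (fun a w => sw (Coalgebra.comul (R := 𝕜) a) (fun p q => F p q w)) =
      sw (δ v) (fun a w => sw (δ w) (fun b u => F a b u)) := by
  have key := congr(sw $(LinearMap.congr_fun hδ.coassoc v)
    (fun a t => sw t (fun p q => F a p q)))
  simp only [LinearMap.comp_apply, LinearEquiv.coe_coe] at key
  rwa [sw_lTensor _ _ _ (by intros; fun_prop) (by intros; fun_prop),
    sw_assoc _ _ (by intros; fun_prop) (by intros; fun_prop) (by intros; fun_prop),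
    sw_rTensor _ _ _ (by intros; fun_prop) (by intros; fun_prop)] at key

theorem IsCoact.sw_counit {δ : V →ₗ[𝕜] H ⊗[𝕜] V} (hδ : IsCoact δ) (v : V) (F : V → P)
    (hF : IsLinearMap 𝕜 F) :
    sw (δ v) (fun a w => Coalgebra.counit (R := 𝕜) a • F w) = F v := by
  have key := congr(sw $(LinearMap.congr_fun hδ.counit v) (fun a t => a • F t))
  simp only [LinearMap.comp_apply, TensorProduct.mk_apply] at key
  rwa [sw_rTensor _ _ _ (by intros; fun_prop) (by intros; fun_prop),
    sw_tmul _ _ _ (by intros; fun_prop) (by intros; fun_prop), one_smul] at key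

/-- To be a coaction, in terms of sums. -/
theorem isCoact_of_sw {δ : V →ₗ[𝕜] H ⊗[𝕜] V}
    (h₁ : ∀ v, sw (δ v) (fun a w => sw (Coalgebra.comul (R := 𝕜) a)
        (fun p q => p ⊗ₜ[𝕜] (q ⊗ₜ[𝕜] w))) = sw (δ v) (fun a w => a ⊗ₜ[𝕜] δ w))
    (h₂ : ∀ v, sw (δ v) (fun a w => Coalgebra.counit (R := 𝕜) a • w) = v) : IsCoact δ where
  coassoc := by
    ext v
    simp only [LinearMap.comp_apply, LinearEquiv.coe_coe]
    rw [← sw_tmul_self (TensorProduct.assoc 𝕜 H H V _)]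
    have e : ∀ (a : H) (t : H ⊗[𝕜] V), a ⊗ₜ[𝕜] t = sw t (fun b c => a ⊗ₜ[𝕜] (b ⊗ₜ[𝕜] c)) := by
      intro a t
      conv_lhs => rw [← sw_tmul_self t]
      exact isLinearMap_map_sw (L := fun t => a ⊗ₜ[𝕜] t) (by fun_prop) _ _
    -- The second leg is itself expanded as a sum to bring the expression into the shape required by
    -- `sw_assoc`.
    rw [show (fun a t => a ⊗ₜ[𝕜] t : H → H ⊗[𝕜] V → _) =
      fun a t => sw t (fun b c => a ⊗ₜ[𝕜] (b ⊗ₜ[𝕜] c)) from funext fun a => funext fun t => e a t]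
    rw [sw_assoc _ _ (by intros; fun_prop) (by intros; fun_prop) (by intros; fun_prop),
      sw_rTensor _ _ _ (by intros; fun_prop) (by intros; fun_prop), h₁,
      linearMap_apply_eq_sw (LinearMap.lTensor H δ)]
    simp only [LinearMap.lTensor_tmul]
  counit := by
    ext v
    rw [LinearMap.comp_apply, linearMap_apply_eq_sw, TensorProduct.mk_apply]
    conv_rhs => rw [← h₂ v, isLinearMap_map_sw (L := fun t => (1 : 𝕜) ⊗ₜ[𝕜] t) (by fun_prop)]
    simp only [LinearMap.rTensor_tmul, TensorProduct.tmul_smul, TensorProduct.smul_tmul',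
      smul_eq_mul, mul_one]

theorem sw_colinear {δ : V →ₗ[𝕜] H ⊗[𝕜] V} {γ : W →ₗ[𝕜] H ⊗[𝕜] W} {f : V →ₗ[𝕜] W}
    (hf : γ ∘ₗ f = f.lTensor H ∘ₗ δ) (v : V) (F : H → W → P)
    (h₁ : ∀ b, IsLinearMap 𝕜 (fun a => F a b)) (h₂ : ∀ a, IsLinearMap 𝕜 (fun b => F a b)) :
    sw (γ (f v)) F = sw (δ v) (fun a w => F a (f w)) := by
  rw [← LinearMap.comp_apply, hf, LinearMap.comp_apply, sw_lTensor _ _ _ h₁ h₂]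

theorem sw_resCoact (φ : K →ₐc[𝕜] H) (δ : V →ₗ[𝕜] K ⊗[𝕜] V) (v : V) (F : H → V → P)
    (h₁ : ∀ b, IsLinearMap 𝕜 (fun a => F a b)) (h₂ : ∀ a, IsLinearMap 𝕜 (fun b => F a b)) :
    sw (resCoact φ δ v) F = sw (δ v) (fun a w => F (φ a) w) := by
  rw [resCoact, LinearMap.comp_apply, sw_rTensor _ _ _ h₁ h₂]; rfl

theorem tensorAct_eq_sw (ρ : H →ₐ[𝕜] Module.End 𝕜 V) (σ : H →ₐ[𝕜] Module.End 𝕜 W)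
    (h : H) (t : V ⊗[𝕜] W) : tensorAct ρ σ h t =
      sw (Coalgebra.comul (R := 𝕜) h) (fun a b => sw t (fun v w => ρ a v ⊗ₜ[𝕜] σ b w)) := by
  rw [linearMap_apply_eq_sw, sw_comm]
  congr 1; funext v w
  rw [tensorAct_tmul, linearMap_apply_eq_sw]; rfl

theorem tensorAct_tmul_eq_sw (ρ : H →ₐ[𝕜] Module.End 𝕜 V) (σ : H →ₐ[𝕜] Module.End 𝕜 W)
    (h : H) (v : V) (w : W) : tensorAct ρ σ h (v ⊗ₜ w) =
      sw (Coalgebra.comul (R := 𝕜) h) (fun a b => ρ a v ⊗ₜ[𝕜] σ b w) := by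
  rw [tensorAct_tmul, linearMap_apply_eq_sw]; rfl

theorem sw_tensorCoact (δ : V →ₗ[𝕜] H ⊗[𝕜] V) (γ : W →ₗ[𝕜] H ⊗[𝕜] W) (v : V) (w : W)
    (F : H → V ⊗[𝕜] W → P) (h₁ : ∀ b, IsLinearMap 𝕜 (fun a => F a b))
    (h₂ : ∀ a, IsLinearMap 𝕜 (fun b => F a b)) :
    sw (tensorCoact δ γ (v ⊗ₜ w)) F =
      sw (δ v) (fun a v' => sw (γ w) (fun b w' => F (a * b) (v' ⊗ₜ w'))) := by
  rw [tensorCoact, LinearMap.comp_apply, TensorProduct.map_tmul]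
  conv_lhs => rw [← sw_tmul_self (δ v), ← sw_tmul_self (γ w)]
  rw [isLinearMap_map_sw (L := fun t => sw (mulTensor H V W (t ⊗ₜ _)) F) (by fun_prop)]
  congr 1; funext p q
  rw [isLinearMap_map_sw (L := fun t => sw (mulTensor H V W (_ ⊗ₜ t)) F) (by fun_prop)]
  congr 1; funext r s
  rw [mulTensor_tmul, sw_tmul _ _ _ h₁ h₂]

theorem braid_tmul_eq_sw (δ : U →ₗ[𝕜] H ⊗[𝕜] V) (σ : H →ₐ[𝕜] Module.End 𝕜 W) (x : U) (w : W) :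
    braid δ σ (x ⊗ₜ w) = sw (δ x) (fun a v => σ a w ⊗ₜ[𝕜] v) := by
  rw [braid_tmul, linearMap_apply_eq_sw]; rfl

/-- The tensor-valued Yetter–Drinfeld condition paired with an arbitrary bilinear function; this is
the form used inside longer sums. -/
theorem IsYD.sw_eq {ρ : H →ₐ[𝕜] Module.End 𝕜 V} {δ : V →ₗ[𝕜] H ⊗[𝕜] V} (h : IsYD ρ δ) (k : H)
    (v : V) (F : H → V → P) (h₁ : ∀ b, IsLinearMap 𝕜 (fun a => F a b))
    (h₂ : ∀ a, IsLinearMap 𝕜 (fun b => F a b)) :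
    sw (Coalgebra.comul (R := 𝕜) k) (fun a b => sw (δ v) (fun p w => F (a * p) (ρ b w))) =
      sw (Coalgebra.comul (R := 𝕜) k) (fun a b => sw (δ (ρ a v)) (fun p w => F (p * b) w)) := by
  have key := congr(sw $(h k v) F)
  rw [linearMap_apply_eq_sw, linearMap_apply_eq_sw, sw_sw _ _ _ h₁ h₂, sw_sw _ _ _ h₁ h₂] at key
  simp only [ydLeft_tmul, ydRight_tmul, sw_map _ _ _ F h₁ h₂, sw_rTensor _ _ F h₁ h₂] at key
  exact key

theorem isYD_of_sw {ρ : H →ₐ[𝕜] Module.End 𝕜 V} {δ : V →ₗ[𝕜] H ⊗[𝕜] V}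
    (h : ∀ k v, sw (Coalgebra.comul (R := 𝕜) k)
        (fun a b => sw (δ v) (fun p w => (a * p) ⊗ₜ[𝕜] (ρ b w))) =
      sw (Coalgebra.comul (R := 𝕜) k)
        (fun a b => sw (δ (ρ a v)) (fun p w => (p * b) ⊗ₜ[𝕜] w))) : IsYD ρ δ := by
  intro k v
  rw [linearMap_apply_eq_sw, linearMap_apply_eq_sw (ydRight ρ δ v)]
  refine Eq.trans ?_ ((h k v).trans ?_) <;> congr 1 <;> funext a b
  · rw [ydLeft_tmul, linearMap_apply_eq_sw]; rfl
  · rw [ydRight_tmul, linearMap_apply_eq_sw]; rfl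

theorem freeCoact_tmul_eq_sw (k : K) (w : W) : freeCoact 𝕜 K W (k ⊗ₜ w) =
    sw (Coalgebra.comul (R := 𝕜) k) (fun a b => a ⊗ₜ[𝕜] (b ⊗ₜ[𝕜] w)) := by
  change ((TensorProduct.assoc 𝕜 K K W).toLinearMap ∘ₗ (TensorProduct.mk 𝕜 _ W).flip w)
    (Coalgebra.comul k) = _
  rw [linearMap_apply_eq_sw]; rfl

theorem cotensorRight_tmul_eq_sw (φ : K →ₐc[𝕜] H) (k : K) (w : W) : cotensorRight φ W (k ⊗ₜ w) =
    sw (Coalgebra.comul (R := 𝕜) k) (fun a b => a ⊗ₜ[𝕜] (φ b ⊗ₜ[𝕜] w)) := by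
  change ((TensorProduct.assoc 𝕜 K H W).toLinearMap ∘ₗ (TensorProduct.mk 𝕜 _ W).flip w ∘ₗ
    (φ : K →ₗ[𝕜] H).lTensor K) (Coalgebra.comul k) = _
  rw [linearMap_apply_eq_sw]; rfl

end Comodule

/-! ### The adjunction between restriction and induction of comodules -/

section Cotensor
variable {𝕜 : Type u} [Field 𝕜] {K H : Type u} [Ring K] [Ring H] [Bialgebra 𝕜 K] [Bialgebra 𝕜 H]
  (φ : K →ₐc[𝕜] H) {V W : Type u} [AddCommGroup V] [Module 𝕜 V] [AddCommGroup W] [Module 𝕜 W]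
  {P : Type*} [AddCommMonoid P] [Module 𝕜 P]

theorem cotensorRight_eq_sw (x : K ⊗[𝕜] W) : cotensorRight φ W x =
    sw x (fun k w => sw (Coalgebra.comul (R := 𝕜) k)
      (fun a b => a ⊗ₜ[𝕜] (φ b ⊗ₜ[𝕜] w))) := by
  rw [linearMap_apply_eq_sw]
  simp only [cotensorRight_tmul_eq_sw]

theorem freeCoact_eq_sw (x : K ⊗[𝕜] W) : freeCoact 𝕜 K W x =
    sw x (fun k w => sw (Coalgebra.comul (R := 𝕜) k)
      (fun a b => a ⊗ₜ[𝕜] (b ⊗ₜ[𝕜] w))) := by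
  rw [linearMap_apply_eq_sw]
  simp only [freeCoact_tmul_eq_sw]

/-- The working form of membership in the cotensor product: the coaction on the `W` leg may be
traded for `φ` of the second coproduct leg of the `K` factor. -/
theorem sw_cotensor {δ : W →ₗ[𝕜] H ⊗[𝕜] W} {x : K ⊗[𝕜] W} (hx : x ∈ cotensor φ δ)
    (F : K → H → W → P)
    (h₁ : ∀ b c, IsLinearMap 𝕜 (fun a => F a b c)) (h₂ : ∀ a c, IsLinearMap 𝕜 (fun b => F a b c))
    (h₃ : ∀ a b, IsLinearMap 𝕜 (fun c => F a b c)) :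
    sw x (fun k w => sw (δ w) (fun h v => F k h v)) =
      sw x (fun k w => sw (Coalgebra.comul (R := 𝕜) k) (fun a b => F a (φ b) w)) := by
  have hx' : δ.lTensor K x = cotensorRight φ W x := hx
  have key := congr(sw $hx' (fun a t => sw t (fun p q => F a p q)))
  rw [sw_lTensor _ _ _ (by intros; fun_prop) (by intros; fun_prop), cotensorRight_eq_sw,
    sw_sw _ _ _ (by intros; fun_prop) (by intros; fun_prop)] at key
  rw [key]
  congr 1; funext k w
  rw [sw_sw _ _ _ (by intros; fun_prop) (by intros; fun_prop)]
  congr 1; funext a b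
  rw [sw_tmul _ _ _ (by intros; fun_prop) (by intros; fun_prop),
    sw_tmul _ _ _ (by intros; fun_prop) (by intros; fun_prop)]

theorem resCoact_eq_sw (δ : V →ₗ[𝕜] K ⊗[𝕜] V) (v : V) :
    resCoact φ δ v = sw (δ v) (fun a w => φ a ⊗ₜ[𝕜] w) := by
  rw [← sw_resCoact φ δ v _ (by intros; fun_prop) (by intros; fun_prop), sw_tmul_self]

/-- Coassociativity of `δ`, with `φ` applied to the middle leg, is exactly the cotensor equation for
`δ v`. -/
theorem coact_mem_cotensor {δ : V →ₗ[𝕜] K ⊗[𝕜] V} (hδ : IsCoact δ) (v : V) :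
    δ v ∈ cotensor φ (resCoact φ δ) := by
  change (resCoact φ δ).lTensor K (δ v) = cotensorRight φ V (δ v)
  rw [cotensorRight_eq_sw, hδ.sw_coassoc _ _ (by intros; fun_prop) (by intros; fun_prop)
    (by intros; fun_prop), linearMap_apply_eq_sw]
  congr 1; funext k w
  rw [LinearMap.lTensor_tmul, resCoact_eq_sw,
    isLinearMap_map_sw (L := fun t => k ⊗ₜ[𝕜] t) (by fun_prop)]

/-- The unit `V → K □_H V` of the adjunction between restriction and induction. -/
noncomputable def indUnit {δ : V →ₗ[𝕜] K ⊗[𝕜] V} (hδ : IsCoact δ) :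
    V →ₗ[𝕜] cotensor φ (resCoact φ δ) :=
  δ.codRestrict _ (coact_mem_cotensor φ hδ)

/-- The inclusion of the cotensor product stays injective after tensoring with `K`, so
coassociativity may be checked in `K ⊗ (K ⊗ V)`. -/
theorem indUnit_colinear {δ : V →ₗ[𝕜] K ⊗[𝕜] V} (hδ : IsCoact δ) :
    cotensorCoact φ (resCoact φ δ) ∘ₗ indUnit φ hδ = (indUnit φ hδ).lTensor K ∘ₗ δ := by
  ext v
  apply lTensor_subtype_injective φ _ K
  have e := LinearMap.congr_fun (cotensorCoact_spec φ (resCoact φ δ)) (indUnit φ hδ v)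
  simp only [LinearMap.comp_apply] at e ⊢
  rw [e, ← LinearMap.comp_apply (LinearMap.lTensor _ _), ← LinearMap.lTensor_comp]
  exact LinearMap.congr_fun hδ.coassoc v

variable (𝕜 K W) in
/-- The map `k ⊗ w ↦ ε(k) w`. -/
noncomputable def counitTensor : K ⊗[𝕜] W →ₗ[𝕜] W :=
  (TensorProduct.lid 𝕜 W).toLinearMap ∘ₗ (Coalgebra.counit (R := 𝕜) (A := K)).rTensor W

@[simp] theorem counitTensor_tmul (k : K) (w : W) :
    counitTensor 𝕜 K W (k ⊗ₜ w) = Coalgebra.counit (R := 𝕜) k • w := rfl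

theorem IsCoact.counitTensor {δ : W →ₗ[𝕜] K ⊗[𝕜] W} (hδ : IsCoact δ) :
    counitTensor 𝕜 K W ∘ₗ δ = LinearMap.id := by
  rw [HopfInd.counitTensor, LinearMap.comp_assoc, hδ.counit]; ext; simp

theorem counitTensor_freeCoact :
    (counitTensor 𝕜 K W).lTensor K ∘ₗ freeCoact 𝕜 K W = LinearMap.id := by
  ext k w
  simp only [TensorProduct.AlgebraTensorModule.curry_apply, LinearMap.restrictScalars_self,
    TensorProduct.curry_apply, LinearMap.comp_apply, LinearMap.id_apply, freeCoact_tmul_eq_sw,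
    map_sw, LinearMap.lTensor_tmul, counitTensor_tmul, TensorProduct.tmul_smul]
  rw [sw_counit_right k (fun k => k ⊗ₜ[𝕜] w) (by fun_prop)]

/-- The counit `K □_H W → W` of the adjunction between restriction and induction. -/
noncomputable def indCounit (δ : W →ₗ[𝕜] H ⊗[𝕜] W) : cotensor φ δ →ₗ[𝕜] W :=
  counitTensor 𝕜 K W ∘ₗ (cotensor φ δ).subtype

/-- The right triangle identity in disguise; it also evaluates the lax structure below. -/
theorem indCounit_lTensor (δ : W →ₗ[𝕜] H ⊗[𝕜] W) :
    (indCounit φ δ).lTensor K ∘ₗ cotensorCoact φ δ = (cotensor φ δ).subtype := by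
  rw [indCounit, LinearMap.lTensor_comp, LinearMap.comp_assoc, cotensorCoact_spec,
    ← LinearMap.comp_assoc, counitTensor_freeCoact, LinearMap.id_comp]

/-- Both sides reduce to `k ⊗ w ↦ φ(k) ⊗ w` on the cotensor product: the right side by the triangle
identity, the left side by the cotensor equation followed by the counit axiom in `K`. -/
theorem indCounit_colinear (δ : W →ₗ[𝕜] H ⊗[𝕜] W) :
    δ ∘ₗ indCounit φ δ = (indCounit φ δ).lTensor H ∘ₗ resCoact (V := cotensor φ δ) φ (cotensorCoact φ δ) := by
  have e : (indCounit φ δ).lTensor H ∘ₗ resCoact (V := cotensor φ δ) φ (cotensorCoact φ δ) =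
      (φ : K →ₗ[𝕜] H).rTensor W ∘ₗ (cotensor φ δ).subtype := by
    rw [resCoact, ← LinearMap.comp_assoc, LinearMap.lTensor_comp_rTensor,
      ← LinearMap.rTensor_comp_lTensor, LinearMap.comp_assoc, indCounit_lTensor]
  rw [e]
  ext x
  have h := sw_cotensor φ x.2 (fun k h w => Coalgebra.counit (R := 𝕜) k • (h ⊗ₜ[𝕜] w))
    (by intros; fun_prop) (by intros; fun_prop) (by intros; fun_prop)
  simp only [← isLinearMap_map_sw (isLinearMap_smul_right isLinearMap_id _), sw_tmul_self] at h
  simp only [LinearMap.comp_apply, indCounit]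
  rw [linearMap_apply_eq_sw (counitTensor 𝕜 K W), linearMap_apply_eq_sw (LinearMap.rTensor W _)]
  simp only [map_sw, counitTensor_tmul, map_smul]
  refine h.trans ?_
  congr 1; funext k w
  exact sw_counit_left k (fun k => φ k ⊗ₜ[𝕜] w) (by fun_prop)

/-- Comodule induction is right adjoint to restriction. -/
noncomputable def indAdj : resComod φ ⊣ indComod φ :=
  Adjunction.mkOfUnitCounit
    { unit :=
        { app := fun V => ⟨indUnit φ V.isCoact, indUnit_colinear φ V.isCoact⟩
          naturality := fun V W f => LComod.hom_ext (LinearMap.ext fun v => Subtype.ext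
            (LinearMap.congr_fun f.comm v)) }
      counit :=
        { app := fun W => ⟨indCounit φ W.coact, indCounit_colinear φ W.coact⟩
          naturality := fun V W f => LComod.hom_ext (LinearMap.ext fun x => by
            change counitTensor 𝕜 K W.carrier (f.toLin.lTensor K x.1) =
              f.toLin (counitTensor 𝕜 K V.carrier x.1)
            rw [← LinearMap.comp_apply, ← LinearMap.comp_apply]
            congr 1
            ext k v; simp) }
      left_triangle := by
        ext V : 2
        exact LComod.hom_ext V.isCoact.counitTensor
      right_triangle := by
        ext W : 2
        refine LComod.hom_ext (LinearMap.ext fun x => Subtype.ext ?_)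
        exact LinearMap.congr_fun (indCounit_lTensor φ W.coact) x }

theorem lTensor_map_mulTensor {V' W' : Type u} [AddCommGroup V'] [Module 𝕜 V'] [AddCommGroup W']
    [Module 𝕜 W'] (f : V →ₗ[𝕜] V') (g : W →ₗ[𝕜] W') (x : K ⊗[𝕜] V) (y : K ⊗[𝕜] W) :
    (TensorProduct.map f g).lTensor K (mulTensor K V W (x ⊗ₜ y)) =
      mulTensor K V' W' (f.lTensor K x ⊗ₜ g.lTensor K y) :=
  (LinearMap.congr_fun (mulTensor_natural (H := K) f g) (x ⊗ₜ y)).symm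

/-- By construction the lax map is the unit of `R V ⊗ R W` followed by `R` of the two counits. The
unit is the coaction, a product of the two free coactions, and each counit collapses its free
coaction back to `x` or `y`. -/
theorem indAdj_lax (V W : LComod 𝕜 H) (x : cotensor φ V.coact) (y : cotensor φ W.coact) :
    ((lax (indAdj φ) V W).toLin (x ⊗ₜ[𝕜] y) : cotensor φ (tensorCoact V.coact W.coact)).1 =
      mulTensor K V.carrier W.carrier (x.1 ⊗ₜ[𝕜] y.1) := by
  have e := lTensor_map_mulTensor (V := ((indComod φ).obj V).carrier)
    (W := ((indComod φ).obj W).carrier) ((indAdj φ).counit.app V).toLin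
    ((indAdj φ).counit.app W).toLin (((indComod φ).obj V).coact x) (((indComod φ).obj W).coact y)
  have e1 : ((indAdj φ).counit.app V).toLin.lTensor K (((indComod φ).obj V).coact x) = x.1 :=
    LinearMap.congr_fun (indCounit_lTensor φ V.coact) x
  have e2 : ((indAdj φ).counit.app W).toLin.lTensor K (((indComod φ).obj W).coact y) = y.1 :=
    LinearMap.congr_fun (indCounit_lTensor φ W.coact) y
  exact e.trans congr(mulTensor K V.carrier W.carrier ($e1 ⊗ₜ $e2))

end Cotensor

/-! ### The projection formula for comodule induction -/

section IsIso
variable {𝕜 : Type u} [Field 𝕜] {H : Type u} [Ring H] [Bialgebra 𝕜 H]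

theorem LComod.isIso_of_bijective {V W : LComod 𝕜 H} (f : V ⟶ W)
    (hf : Function.Bijective f.toLin) : IsIso f := by
  have : f = (LComod.mkIso (LinearEquiv.ofBijective f.toLin hf) f.comm).hom := LComod.hom_ext rfl
  rw [this]; infer_instance

theorem LMod.isIso_of_bijective {V W : LMod 𝕜 H} (f : V ⟶ W)
    (hf : Function.Bijective f.toLin) : IsIso f := by
  have : f = (LMod.mkIso (LinearEquiv.ofBijective f.toLin hf) f.comm).hom := LMod.hom_ext rfl
  rw [this]; infer_instance

end IsIso

/-! ### Twist isomorphisms by a comodule. -/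

section Twist
variable {𝕜 : Type u} [Field 𝕜] {H A U U' : Type u} [Ring H]
  [AddCommGroup A] [Module 𝕜 A] [AddCommGroup U] [Module 𝕜 U] [AddCommGroup U'] [Module 𝕜 U']

section
variable [Bialgebra 𝕜 H] (δ : A →ₗ[𝕜] H ⊗[𝕜] A)

variable (U) in
/-- The map `a ⊗ (h ⊗ u) ↦ a⁽⁻¹⁾ h ⊗ (a⁽⁰⁾ ⊗ u)`. -/
noncomputable def twistLeft : A ⊗[𝕜] (H ⊗[𝕜] U) →ₗ[𝕜] H ⊗[𝕜] (A ⊗[𝕜] U) :=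
  mulTensor H A U ∘ₗ δ.rTensor (H ⊗[𝕜] U)

variable (U) in
/-- The map `(h ⊗ u) ⊗ a ↦ h a⁽⁻¹⁾ ⊗ (u ⊗ a⁽⁰⁾)`. -/
noncomputable def twistRight : (H ⊗[𝕜] U) ⊗[𝕜] A →ₗ[𝕜] H ⊗[𝕜] (U ⊗[𝕜] A) :=
  mulTensor H U A ∘ₗ δ.lTensor (H ⊗[𝕜] U)

theorem twistLeft_tmul (a : A) (h : H) (u : U) : twistLeft U δ (a ⊗ₜ (h ⊗ₜ u)) =
    sw (δ a) (fun p b => (p * h) ⊗ₜ[𝕜] (b ⊗ₜ[𝕜] u)) := by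
  change (mulTensor H A U ∘ₗ (TensorProduct.mk 𝕜 _ _).flip (h ⊗ₜ u)) (δ a) = _
  rw [linearMap_apply_eq_sw]; rfl

theorem twistRight_tmul (a : A) (h : H) (u : U) : twistRight U δ ((h ⊗ₜ u) ⊗ₜ a) =
    sw (δ a) (fun p b => (h * p) ⊗ₜ[𝕜] (u ⊗ₜ[𝕜] b)) := by
  change (mulTensor H U A ∘ₗ (TensorProduct.mk 𝕜 _ _) (h ⊗ₜ u)) (δ a) = _
  rw [linearMap_apply_eq_sw]; rfl

theorem twistLeft_natural (f : U →ₗ[𝕜] U') : twistLeft U' δ ∘ₗ (f.lTensor H).lTensor A =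
    (f.lTensor A).lTensor H ∘ₗ twistLeft U δ := by
  ext a h u
  simp [twistLeft_tmul, map_sw]

theorem twistRight_natural (f : U →ₗ[𝕜] U') : twistRight U' δ ∘ₗ (f.lTensor H).rTensor A =
    (f.rTensor A).lTensor H ∘ₗ twistRight U δ := by
  ext h u a
  simp [twistRight_tmul, map_sw]

end

variable [HopfAlgebra 𝕜 H] {δ : A →ₗ[𝕜] H ⊗[𝕜] A}

/-- Up to reordering of factors the twist is the map `braid` of the comodule `A` with the module `H
⊗ U`, which the inverse antipode inverts. -/
theorem twistLeft_bijective [InvertibleAntipode 𝕜 H] (hδ : IsCoact δ) :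
    Function.Bijective (twistLeft U δ) := by
  -- Here `H` acts on `H ⊗ U` by left multiplication on the first factor.
  let σ : H →ₐ[𝕜] Module.End 𝕜 (H ⊗[𝕜] U) := Algebra.lsmul 𝕜 𝕜 (H ⊗[𝕜] U)
  let e : A ⊗[𝕜] (H ⊗[𝕜] U) ≃ₗ[𝕜] H ⊗[𝕜] (A ⊗[𝕜] U) :=
    (LinearEquiv.ofLinearMap (braid δ σ) (braidInv δ σ) (braid_braidInv hδ σ)
      (braidInv_braid hδ σ)) ≪≫ₗ TensorProduct.assoc 𝕜 H U A ≪≫ₗ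
      (TensorProduct.comm 𝕜 U A).lTensor H
  have : twistLeft U δ = e.toLinearMap := by
    ext a h u
    simp only [TensorProduct.AlgebraTensorModule.curry_apply, LinearMap.restrictScalars_self,
      TensorProduct.curry_apply, twistLeft_tmul]
    change _ = (TensorProduct.comm 𝕜 U A).lTensor H (TensorProduct.assoc 𝕜 H U A
      (braid δ σ (a ⊗ₜ (h ⊗ₜ u))))
    rw [braid_tmul_eq_sw, map_sw, map_sw]
    rfl
  rw [this]; exact e.bijective

theorem twistRight_bijective (hδ : IsCoact δ) : Function.Bijective (twistRight U δ) := by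
  -- The inverse is `h ⊗ (u ⊗ a) ↦ (h S(a⁽⁻¹⁾) ⊗ u) ⊗ a⁽⁰⁾`: here `a⁽⁻¹⁾` multiplies on the right,
  -- so the ordinary antipode suffices.
  let g : H ⊗[𝕜] (U ⊗[𝕜] A) →ₗ[𝕜] (H ⊗[𝕜] U) ⊗[𝕜] A :=
    bilift (fun h t => sw t (fun u a => sw (δ a) (fun p b =>
      (((h * HopfAlgebra.antipode 𝕜 p) ⊗ₜ[𝕜] u) ⊗ₜ[𝕜] b))))
      (by intros; fun_prop) (by intros; fun_prop)
  have hg : ∀ h u a, g (h ⊗ₜ (u ⊗ₜ a)) = sw (δ a) (fun p b =>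
      (((h * HopfAlgebra.antipode 𝕜 p) ⊗ₜ[𝕜] u) ⊗ₜ[𝕜] b)) := by
    intro h u a
    rw [bilift_apply, sw_tmul _ _ _ (by intros; fun_prop) (by intros; fun_prop),
      sw_tmul _ _ _ (by intros; fun_prop) (by intros; fun_prop)]
  have h1 : twistRight U δ ∘ₗ g = LinearMap.id := by
    ext h u a
    simp only [TensorProduct.AlgebraTensorModule.curry_apply, LinearMap.restrictScalars_self,
      TensorProduct.curry_apply, LinearMap.comp_apply, hg, map_sw, twistRight_tmul,
      LinearMap.id_apply]
    rw [← hδ.sw_coassoc a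
      (fun p q c => (h * HopfAlgebra.antipode 𝕜 p * q) ⊗ₜ[𝕜] (u ⊗ₜ[𝕜] c)) (by intros; fun_prop)
      (by intros; fun_prop) (by intros; fun_prop)]
    simp only [mul_assoc]
    refine Eq.trans ?_ (hδ.sw_counit a (fun a => h ⊗ₜ[𝕜] (u ⊗ₜ[𝕜] a)) (by fun_prop))
    congr 1; funext p c
    rw [sw_antipode_mul p (fun p => (h * p) ⊗ₜ[𝕜] (u ⊗ₜ[𝕜] c)) (by fun_prop), mul_one]
  have h2 : g ∘ₗ twistRight U δ = LinearMap.id := by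
    ext h u a
    simp only [TensorProduct.AlgebraTensorModule.curry_apply, LinearMap.restrictScalars_self,
      TensorProduct.curry_apply, LinearMap.comp_apply, hg, map_sw, twistRight_tmul,
      LinearMap.id_apply]
    rw [← hδ.sw_coassoc a
      (fun p q c => ((h * p * HopfAlgebra.antipode 𝕜 q) ⊗ₜ[𝕜] u) ⊗ₜ[𝕜] c) (by intros; fun_prop)
      (by intros; fun_prop) (by intros; fun_prop)]
    simp only [mul_assoc]
    refine Eq.trans ?_ (hδ.sw_counit a (fun a => (h ⊗ₜ[𝕜] u) ⊗ₜ[𝕜] a) (by fun_prop))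
    congr 1; funext p c
    rw [sw_mul_antipode p (fun p => ((h * p) ⊗ₜ[𝕜] u) ⊗ₜ[𝕜] c) (by fun_prop), mul_one]
  exact Function.bijective_iff_has_inverse.2 ⟨g, LinearMap.congr_fun h2, LinearMap.congr_fun h1⟩

end Twist

/-- Tensoring over a field preserves equalizers; the statement for tensoring on the left is
transported along the symmetry. -/
theorem mem_range_rTensor_of_rTensor_eq {𝕜 : Type u} [Field 𝕜] {M N A : Type u} [AddCommGroup M]
    [Module 𝕜 M] [AddCommGroup N] [Module 𝕜 N] [AddCommGroup A] [Module 𝕜 A] (p q : M →ₗ[𝕜] N)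
    (y : M ⊗[𝕜] A) (h : p.rTensor A y = q.rTensor A y) :
    y ∈ LinearMap.range ((LinearMap.eqLocus p q).subtype.rTensor A) := by
  have e : ∀ (M N : Type u) [AddCommGroup M] [Module 𝕜 M] [AddCommGroup N] [Module 𝕜 N]
      (f : M →ₗ[𝕜] N) (x : M ⊗[𝕜] A), TensorProduct.comm 𝕜 N A (f.rTensor A x) =
        f.lTensor A (TensorProduct.comm 𝕜 M A x) := by
    intro M N _ _ _ _ f x
    simp only [← LinearEquiv.coe_coe, ← LinearMap.comp_apply]
    congr 1; ext m a; simp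
  have h2 : LinearMap.eqLocus (p.lTensor A) (q.lTensor A) =
      LinearMap.range ((LinearMap.eqLocus p q).subtype.lTensor A) :=
    Module.Flat.eqLocus_lTensor_eq 𝕜 A p q
  have h3 : TensorProduct.comm 𝕜 M A y ∈ LinearMap.eqLocus (p.lTensor A) (q.lTensor A) := by
    rw [LinearMap.mem_eqLocus, ← e, ← e, h]
  rw [h2] at h3
  obtain ⟨x, hx⟩ := h3
  refine ⟨(TensorProduct.comm 𝕜 (LinearMap.eqLocus p q) A).symm x,
    (TensorProduct.comm 𝕜 M A).injective ?_⟩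
  rw [e, LinearEquiv.apply_symm_apply, hx]

/-! ### Restriction of the twists to cotensor products. -/

section Projection
variable {𝕜 : Type u} [Field 𝕜] {K H A W : Type u} [Ring K] [Ring H]
  [AddCommGroup A] [Module 𝕜 A] [AddCommGroup W] [Module 𝕜 W]

section
variable [Bialgebra 𝕜 K] [Bialgebra 𝕜 H] (φ : K →ₐc[𝕜] H) {δ : A →ₗ[𝕜] K ⊗[𝕜] A}

/-- Multiplicativity of `Δ` and of `φ`, with coassociativity of `δ`: twisting commutes with one of
the two maps that define the cotensor product. `twistLeft_lTensor_tensorCoact` is the same for the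
other map. -/
theorem twistLeft_cotensorRight (hδ : IsCoact δ) :
    ((twistLeft W (resCoact φ δ)).lTensor K ∘ₗ twistLeft (H ⊗[𝕜] W) δ) ∘ₗ
      (cotensorRight φ W).lTensor A = cotensorRight φ (A ⊗[𝕜] W) ∘ₗ twistLeft W δ := by
  ext a k w
  simp only [TensorProduct.AlgebraTensorModule.curry_apply, LinearMap.restrictScalars_self,
    TensorProduct.curry_apply, LinearMap.comp_apply, LinearMap.lTensor_tmul,
    cotensorRight_tmul_eq_sw, twistLeft_tmul, map_sw]
  simp only [isLinearMap_map_sw (isLinearMap_tmul_right isLinearMap_id a), map_sw, twistLeft_tmul,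
    LinearMap.lTensor_tmul]
  simp (disch := intros; fun_prop) only [sw_comul_mul]
  rw [hδ.sw_coassoc a (fun r s b => sw (Coalgebra.comul (R := 𝕜) k) (fun c d =>
        (r * c) ⊗ₜ[𝕜] (φ (s * d) ⊗ₜ[𝕜] (b ⊗ₜ[𝕜] w)))) (by intros; fun_prop)
      (by intros; fun_prop) (by intros; fun_prop), sw_comm]
  congr 1; funext p b
  rw [← sw_comm]
  congr 1; funext r s
  rw [sw_resCoact φ δ b _ (by intros; fun_prop) (by intros; fun_prop),
    isLinearMap_map_sw (isLinearMap_tmul_right isLinearMap_id _)]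
  simp only [map_mul]

theorem twistRight_cotensorRight (hδ : IsCoact δ) :
    ((twistRight W (resCoact φ δ)).lTensor K ∘ₗ twistRight (H ⊗[𝕜] W) δ) ∘ₗ
      (cotensorRight φ W).rTensor A = cotensorRight φ (W ⊗[𝕜] A) ∘ₗ twistRight W δ := by
  ext k w a
  simp only [TensorProduct.AlgebraTensorModule.curry_apply, LinearMap.restrictScalars_self,
    TensorProduct.curry_apply, LinearMap.comp_apply, LinearMap.rTensor_tmul,
    cotensorRight_tmul_eq_sw, twistRight_tmul, map_sw]
  simp only [isLinearMap_map_sw (isLinearMap_tmul_left isLinearMap_id a), map_sw, twistRight_tmul,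
    LinearMap.lTensor_tmul]
  simp (disch := intros; fun_prop) only [sw_comul_mul]
  conv_rhs => rw [sw_comm]
  congr 1; funext c d
  rw [hδ.sw_coassoc a (fun r s b =>
        (c * r) ⊗ₜ[𝕜] (φ (d * s) ⊗ₜ[𝕜] (w ⊗ₜ[𝕜] b))) (by intros; fun_prop)
      (by intros; fun_prop) (by intros; fun_prop)]
  congr 1; funext p b
  rw [sw_resCoact φ δ b _ (by intros; fun_prop) (by intros; fun_prop),
    isLinearMap_map_sw (isLinearMap_tmul_right isLinearMap_id _)]
  simp only [map_mul]

theorem twistLeft_lTensor_tensorCoact (γ : W →ₗ[𝕜] H ⊗[𝕜] W) :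
    ((twistLeft W (resCoact φ δ)).lTensor K ∘ₗ twistLeft (H ⊗[𝕜] W) δ) ∘ₗ
      (γ.lTensor K).lTensor A = (tensorCoact (resCoact φ δ) γ).lTensor K ∘ₗ twistLeft W δ := by
  rw [LinearMap.comp_assoc, twistLeft_natural, ← LinearMap.comp_assoc, ← LinearMap.lTensor_comp,
    twistLeft, LinearMap.comp_assoc (LinearMap.lTensor A γ), LinearMap.rTensor_comp_lTensor]
  rfl

theorem twistRight_rTensor_tensorCoact (γ : W →ₗ[𝕜] H ⊗[𝕜] W) :
    ((twistRight W (resCoact φ δ)).lTensor K ∘ₗ twistRight (H ⊗[𝕜] W) δ) ∘ₗ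
      (γ.lTensor K).rTensor A = (tensorCoact γ (resCoact φ δ)).lTensor K ∘ₗ twistRight W δ := by
  rw [LinearMap.comp_assoc, twistRight_natural, ← LinearMap.comp_assoc, ← LinearMap.lTensor_comp,
    twistRight, LinearMap.comp_assoc (LinearMap.rTensor A γ), LinearMap.lTensor_comp_rTensor]
  rfl

end

variable [HopfAlgebra 𝕜 K] [HopfAlgebra 𝕜 H] (φ : K →ₐc[𝕜] H)

/-- By flatness `A ⊗ (K □_H W)` is an equalizer inside `A ⊗ (K ⊗ W)`. Its equation may be tested
after an injective map, and after the double twist it becomes the cotensor equation for `A ⊗ W`. -/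
theorem mem_range_lTensor_of_twistLeft_mem [InvertibleAntipode 𝕜 K] [InvertibleAntipode 𝕜 H]
    {δ : A →ₗ[𝕜] K ⊗[𝕜] A} (hδ : IsCoact δ) (γ : W →ₗ[𝕜] H ⊗[𝕜] W) (y : A ⊗[𝕜] (K ⊗[𝕜] W))
    (hy : twistLeft W δ y ∈ cotensor φ (tensorCoact (resCoact φ δ) γ)) :
    y ∈ LinearMap.range ((cotensor φ γ).subtype.lTensor A) := by
  have h : LinearMap.eqLocus ((γ.lTensor K).lTensor A) ((cotensorRight φ W).lTensor A) =
      LinearMap.range ((cotensor φ γ).subtype.lTensor A) :=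
    Module.Flat.eqLocus_lTensor_eq 𝕜 A (γ.lTensor K) (cotensorRight φ W)
  rw [← h, LinearMap.mem_eqLocus]
  have hinj : Function.Injective
      ((twistLeft W (resCoact φ δ)).lTensor K ∘ₗ twistLeft (H ⊗[𝕜] W) δ) := by
    rw [LinearMap.coe_comp]
    exact (Module.Flat.lTensor_preserves_injective_linearMap _
      (twistLeft_bijective (resCoact_isCoact φ hδ)).1).comp (twistLeft_bijective hδ).1
  apply hinj
  rw [← LinearMap.comp_apply, ← LinearMap.comp_apply, twistLeft_lTensor_tensorCoact,
    twistLeft_cotensorRight φ hδ]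
  exact hy

theorem mem_range_rTensor_of_twistRight_mem
    {δ : A →ₗ[𝕜] K ⊗[𝕜] A} (hδ : IsCoact δ) (γ : W →ₗ[𝕜] H ⊗[𝕜] W) (y : (K ⊗[𝕜] W) ⊗[𝕜] A)
    (hy : twistRight W δ y ∈ cotensor φ (tensorCoact γ (resCoact φ δ))) :
    y ∈ LinearMap.range ((cotensor φ γ).subtype.rTensor A) := by
  apply mem_range_rTensor_of_rTensor_eq (γ.lTensor K) (cotensorRight φ W)
  have hinj : Function.Injective
      ((twistRight W (resCoact φ δ)).lTensor K ∘ₗ twistRight (H ⊗[𝕜] W) δ) := by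
    rw [LinearMap.coe_comp]
    exact (Module.Flat.lTensor_preserves_injective_linearMap _
      (twistRight_bijective (resCoact_isCoact φ hδ)).1).comp (twistRight_bijective hδ).1
  apply hinj
  rw [← LinearMap.comp_apply, ← LinearMap.comp_apply, twistRight_rTensor_tensorCoact,
    twistRight_cotensorRight φ hδ]
  exact hy

theorem indAdj_lproj (A : LComod 𝕜 K) (X : LComod 𝕜 H)
    (z : A.carrier ⊗[𝕜] cotensor φ X.coact) :
    ((lproj (indAdj φ) A X).toLin z : cotensor φ (tensorCoact (resCoact φ A.coact) X.coact)).1 =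
      twistLeft X.carrier A.coact ((cotensor φ X.coact).subtype.lTensor A.carrier z) := by
  -- The same map with carriers unfolded, so that sums and coercions in the codomain are those of a
  -- submodule.
  let g : A.carrier ⊗[𝕜] cotensor φ X.coact →ₗ[𝕜] cotensor φ (tensorCoact (resCoact φ A.coact) X.coact) :=
    (lproj (indAdj φ) A X).toLin
  change (g z).1 = _
  induction z using TensorProduct.induction_on with
  | zero => simp only [map_zero, ZeroMemClass.coe_zero]
  | add x y hx hy => simp only [map_add, ← hx, ← hy, Submodule.coe_add]
  | tmul a x =>
    exact indAdj_lax φ ((resComod φ).obj A) X (indUnit φ A.isCoact a) x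

theorem indAdj_rproj (X : LComod 𝕜 H) (A : LComod 𝕜 K)
    (z : cotensor φ X.coact ⊗[𝕜] A.carrier) :
    ((rproj (indAdj φ) X A).toLin z : cotensor φ (tensorCoact X.coact (resCoact φ A.coact))).1 =
      twistRight X.carrier A.coact ((cotensor φ X.coact).subtype.rTensor A.carrier z) := by
  let g : cotensor φ X.coact ⊗[𝕜] A.carrier →ₗ[𝕜] cotensor φ (tensorCoact X.coact (resCoact φ A.coact)) :=
    (rproj (indAdj φ) X A).toLin
  change (g z).1 = _
  induction z using TensorProduct.induction_on with
  | zero => simp only [map_zero, ZeroMemClass.coe_zero]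
  | add x y hx hy => simp only [map_add, ← hx, ← hy, Submodule.coe_add]
  | tmul x a =>
    exact indAdj_lax φ X ((resComod φ).obj A) x (indUnit φ A.isCoact a)

/-- `lproj` and `rproj` are restrictions of bijective twists, which gives injectivity; a preimage
under the twist of an element of the cotensor product again comes from the cotensor product, which
gives surjectivity. -/
theorem indAdj_projectionFormula [InvertibleAntipode 𝕜 K] [InvertibleAntipode 𝕜 H] :
    ProjectionFormula (indAdj φ) := by
  refine ⟨fun A X => LComod.isIso_of_bijective _ ⟨?_, ?_⟩,
    fun X A => LComod.isIso_of_bijective _ ⟨?_, ?_⟩⟩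
  · intro x y hxy
    apply lTensor_subtype_injective φ X.coact A.carrier
    apply (twistLeft_bijective A.isCoact).1
    exact (indAdj_lproj φ A X x).symm.trans ((congrArg Subtype.val hxy).trans
      (indAdj_lproj φ A X y))
  · intro z
    let z' : cotensor φ (tensorCoact (resCoact φ A.coact) X.coact) := z
    obtain ⟨y, hy⟩ := (twistLeft_bijective (U := X.carrier) A.isCoact).2 z'.1
    obtain ⟨x, hx⟩ := mem_range_lTensor_of_twistLeft_mem φ A.isCoact X.coact y (hy ▸ z'.2)
    exact ⟨x, Subtype.ext ((indAdj_lproj φ A X x).trans (hx ▸ hy))⟩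
  · intro x y hxy
    apply Module.Flat.rTensor_preserves_injective_linearMap (M := A.carrier) _
      (cotensor φ X.coact).injective_subtype
    apply (twistRight_bijective A.isCoact).1
    exact (indAdj_rproj φ X A x).symm.trans ((congrArg Subtype.val hxy).trans
      (indAdj_rproj φ X A y))
  · intro z
    let z' : cotensor φ (tensorCoact X.coact (resCoact φ A.coact)) := z
    obtain ⟨y, hy⟩ := (twistRight_bijective (U := X.carrier) A.isCoact).2 z'.1
    obtain ⟨x, hx⟩ := mem_range_rTensor_of_twistRight_mem φ A.isCoact X.coact y (hy ▸ z'.2)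
    exact ⟨x, Subtype.ext ((indAdj_rproj φ X A x).trans (hx ▸ hy))⟩

end Projection

/-! ### Induced Yetter--Drinfeld modules over comodules: the action -/

section Cancel
variable {𝕜 : Type u} [Field 𝕜] {K M : Type u} [Ring K] [HopfAlgebra 𝕜 K]
  [AddCommGroup M] [Module 𝕜 M]

/-- Linear maps `K → M` into a right `K`-module agree when their convolutions with the identity of
`K` do. -/
theorem eq_of_sw_right_eq (r : K →ₗ[𝕜] Module.End 𝕜 M) (h_one : r 1 = LinearMap.id)
    (h_mul : ∀ a b m, r (a * b) m = r b (r a m)) {G G' : K → M}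
    (hG : IsLinearMap 𝕜 G) (hG' : IsLinearMap 𝕜 G')
    (h : ∀ k, sw (Coalgebra.comul (R := 𝕜) k) (fun a b => r b (G a)) =
      sw (Coalgebra.comul (R := 𝕜) k) (fun a b => r b (G' a))) (k : K) : G k = G' k := by
  -- `G` is recovered from its convolution with the action by convolving once more with the
  -- antipode.
  have key : ∀ {G : K → M}, IsLinearMap 𝕜 G → ∀ k, G k = sw (Coalgebra.comul (R := 𝕜) k)
      (fun a b => r (HopfAlgebra.antipode 𝕜 b) (sw (Coalgebra.comul (R := 𝕜) a)
        (fun p q => r q (G p)))) := by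
    intro G hG k
    simp only [map_sw, ← h_mul]
    rw [sw_comul_coassoc k (fun p q b => r (q * HopfAlgebra.antipode 𝕜 b) (G p))
      (by intros; fun_prop) (by intros; fun_prop) (by intros; fun_prop)]
    rw [← sw_counit_right k G hG]
    congr 1; funext a b
    rw [sw_mul_antipode b (fun b => r b (G a)) (by fun_prop), h_one]; rfl
  rw [key hG, key hG']
  simp only [h]

end Cancel

section Action
variable {𝕜 : Type u} [Field 𝕜] {K H : Type u} [Ring K] [Ring H] [HopfAlgebra 𝕜 K]
  [HopfAlgebra 𝕜 H] (φ : K →ₐc[𝕜] H)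
  {V W : Type u} [AddCommGroup V] [Module 𝕜 V] [AddCommGroup W] [Module 𝕜 W]

variable (𝕜 K V) in
/-- The right multiplication `k ↦ (l ⊗ v ↦ l k ⊗ v)`. -/
noncomputable def rightMul : K →ₗ[𝕜] Module.End 𝕜 (K ⊗[𝕜] V) :=
  LinearMap.rTensorHom V ∘ₗ (LinearMap.mul 𝕜 K).flip

@[simp] theorem rightMul_tmul (k l : K) (v : V) :
    rightMul 𝕜 K V k (l ⊗ₜ v) = (l * k) ⊗ₜ v := rfl

@[simp] theorem rightMul_one : rightMul 𝕜 K V 1 = LinearMap.id := by ext; simp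

theorem rightMul_mul (a b : K) (x : K ⊗[𝕜] V) :
    rightMul 𝕜 K V (a * b) x = rightMul 𝕜 K V b (rightMul 𝕜 K V a x) := by
  rw [← LinearMap.comp_apply]
  congr 1; ext; simp [mul_assoc]

/-- The left action `k (l ⊗ v) = k₍₁₎ l ⊗ φ(k₍₂₎) v`. -/
noncomputable def leftAct (ρ : H →ₐ[𝕜] Module.End 𝕜 V) : K →ₐ[𝕜] Module.End 𝕜 (K ⊗[𝕜] V) :=
  tensorAct (Algebra.lmul 𝕜 K) (ρ.comp (φ : K →ₐ[𝕜] H))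

variable (ρ : H →ₐ[𝕜] Module.End 𝕜 V)

theorem leftAct_tmul (k l : K) (v : V) : leftAct φ ρ k (l ⊗ₜ v) =
    sw (Coalgebra.comul (R := 𝕜) k) (fun a b => (a * l) ⊗ₜ[𝕜] ρ (φ b) v) :=
  tensorAct_tmul_eq_sw _ _ _ _ _

theorem leftAct_eq_sw (k : K) (x : K ⊗[𝕜] V) : leftAct φ ρ k x =
    sw x (fun l v => sw (Coalgebra.comul (R := 𝕜) k) (fun a b => (a * l) ⊗ₜ[𝕜] ρ (φ b) v)) := by
  rw [linearMap_apply_eq_sw]; simp only [leftAct_tmul]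

theorem rightMul_leftAct (a b : K) (x : K ⊗[𝕜] V) :
    rightMul 𝕜 K V b (leftAct φ ρ a x) = leftAct φ ρ a (rightMul 𝕜 K V b x) := by
  rw [← LinearMap.comp_apply, ← LinearMap.comp_apply]
  congr 1; ext l v
  simp [leftAct_tmul, map_sw, mul_assoc]

theorem indAct_tmul (k l : K) (v : V) : indAct φ ρ k (l ⊗ₜ v) =
    sw (Coalgebra.comul (R := 𝕜) k) (fun a b => sw (Coalgebra.comul (R := 𝕜) b) (fun b c =>
      (a * (l * HopfAlgebra.antipode 𝕜 c)) ⊗ₜ[𝕜] ρ (φ b) v)) := by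
  change (LinearMap.applyₗ (l ⊗ₜ[𝕜] v) ∘ₗ indActAux φ ρ ∘ₗ
    (TensorProduct.assoc 𝕜 K K K).symm.toLinearMap ∘ₗ
    (TensorProduct.comm 𝕜 K K).toLinearMap.lTensor K ∘ₗ
    (Coalgebra.comul (R := 𝕜) (A := K)).lTensor K) (Coalgebra.comul k) = _
  rw [linearMap_apply_eq_sw]
  congr 1; funext a b
  simp only [LinearMap.comp_apply, LinearMap.lTensor_tmul]
  change (LinearMap.applyₗ (l ⊗ₜ[𝕜] v) ∘ₗ indActAux φ ρ ∘ₗ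
    (TensorProduct.assoc 𝕜 K K K).symm.toLinearMap ∘ₗ TensorProduct.mk 𝕜 _ _ a ∘ₗ
    (TensorProduct.comm 𝕜 K K).toLinearMap) (Coalgebra.comul b) = _
  rw [linearMap_apply_eq_sw]
  rfl

/-- The induced action is `k₍₁₎ ▷ x ◁ S(k₍₂₎)`, with `▷` for `leftAct` and `◁` for `rightMul`. It
thus splits into two commuting operations that are easier to control, and this form replaces the
triple coproduct. -/
theorem indAct_eq_sw (k : K) (x : K ⊗[𝕜] V) : indAct φ ρ k x =
    sw (Coalgebra.comul (R := 𝕜) k) (fun a b =>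
      rightMul 𝕜 K V (HopfAlgebra.antipode 𝕜 b) (leftAct φ ρ a x)) := by
  rw [linearMap_apply_eq_sw]
  simp only [linearMap_apply_eq_sw (leftAct φ ρ _) x, map_sw]
  rw [sw_comm]
  congr 1; funext l v
  rw [indAct_tmul, ← sw_comul_coassoc k (fun a b c => (a * (l * HopfAlgebra.antipode 𝕜 c)) ⊗ₜ[𝕜]
    ρ (φ b) v) (by intros; fun_prop) (by intros; fun_prop) (by intros; fun_prop)]
  simp only [leftAct_tmul, map_sw, rightMul_tmul, mul_assoc]

/-- `k₍₁₎ x k₍₂₎`, for the induced action, is the left action. -/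
theorem sw_rightMul_indAct (k : K) (x : K ⊗[𝕜] V) :
    sw (Coalgebra.comul (R := 𝕜) k) (fun a b => rightMul 𝕜 K V b (indAct φ ρ a x)) =
      leftAct φ ρ k x := by
  simp only [indAct_eq_sw, map_sw, ← rightMul_mul]
  rw [sw_comul_coassoc k (fun p q b => rightMul 𝕜 K V (HopfAlgebra.antipode 𝕜 q * b)
    (leftAct φ ρ p x)) (by intros; fun_prop) (by intros; fun_prop) (by intros; fun_prop)]
  rw [← sw_counit_right (𝕜 := 𝕜) k (fun k => leftAct φ ρ k x) (by fun_prop)]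
  congr 1; funext a b
  rw [sw_antipode_mul b (fun b => rightMul 𝕜 K V b (leftAct φ ρ a x)) (by fun_prop)]
  simp

theorem indAct_one (x : K ⊗[𝕜] V) : indAct φ ρ 1 x = x := by
  rw [indAct_eq_sw, sw_comul_one _ (by intros; fun_prop) (by intros; fun_prop)]
  simp [HopfAlgebra.antipode_one]

/-- `S` reverses products while `◁` is a right action, and `▷` commutes with `◁`. -/
theorem indAct_mul (k l : K) (x : K ⊗[𝕜] V) :
    indAct φ ρ (k * l) x = indAct φ ρ k (indAct φ ρ l x) := by
  simp only [indAct_eq_sw, map_sw, rightMul_leftAct]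
  rw [sw_comul_mul _ _ _ (by intros; fun_prop) (by intros; fun_prop)]
  simp only [map_mul, HopfAlgebra.antipode_mul_antidistrib, rightMul_mul, Module.End.mul_apply]
  rw [sw_comm]

theorem lTensor_indAct {σ : H →ₐ[𝕜] Module.End 𝕜 W} {f : V →ₗ[𝕜] W}
    (hf : ∀ h, f ∘ₗ ρ h = σ h ∘ₗ f) (k : K) (x : K ⊗[𝕜] V) :
    f.lTensor K (indAct φ ρ k x) = indAct φ σ k (f.lTensor K x) := by
  rw [← LinearMap.comp_apply, ← LinearMap.comp_apply]
  congr 1; ext l v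
  have : ∀ h v, f (ρ h v) = σ h (f v) := fun h v => LinearMap.congr_fun (hf h) v
  simp [indAct_tmul, map_sw, this]

/-! The induced action preserves the cotensor product. -/

variable (V) in
/-- The right multiplication `k ↦ (l ⊗ (h ⊗ v) ↦ l k₍₁₎ ⊗ (h φ(k₍₂₎) ⊗ v))`. -/
noncomputable def rightMulDiag : K →ₗ[𝕜] Module.End 𝕜 (K ⊗[𝕜] (H ⊗[𝕜] V)) :=
  TensorProduct.homTensorHomMap (RingHom.id 𝕜) K (H ⊗[𝕜] V) K (H ⊗[𝕜] V) ∘ₗ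
    TensorProduct.map (LinearMap.mul 𝕜 K).flip (rightMul 𝕜 H V ∘ₗ (φ : K →ₗ[𝕜] H)) ∘ₗ
    Coalgebra.comul

theorem rightMulDiag_apply (k : K) (x : K ⊗[𝕜] (H ⊗[𝕜] V)) : rightMulDiag φ V k x =
    sw (Coalgebra.comul (R := 𝕜) k) (fun a b => (rightMul 𝕜 H V (φ b)).lTensor K
      (rightMul 𝕜 K (H ⊗[𝕜] V) a x)) := by
  change (LinearMap.applyₗ x ∘ₗ TensorProduct.homTensorHomMap (RingHom.id 𝕜) K (H ⊗[𝕜] V) K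
    (H ⊗[𝕜] V) ∘ₗ TensorProduct.map (LinearMap.mul 𝕜 K).flip
      (rightMul 𝕜 H V ∘ₗ (φ : K →ₗ[𝕜] H))) (Coalgebra.comul k) = _
  rw [linearMap_apply_eq_sw]
  congr 1; funext a b
  rw [← LinearMap.comp_apply (LinearMap.lTensor _ _)]
  change TensorProduct.map _ _ x = _
  congr 1; ext l h v
  rfl

theorem rightMulDiag_tmul (k l : K) (h : H) (v : V) : rightMulDiag φ V k (l ⊗ₜ (h ⊗ₜ v)) =
    sw (Coalgebra.comul (R := 𝕜) k) (fun a b => (l * a) ⊗ₜ[𝕜] ((h * φ b) ⊗ₜ[𝕜] v)) := by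
  rw [rightMulDiag_apply]; rfl

theorem rightMulDiag_one : rightMulDiag φ V 1 = LinearMap.id := by
  ext l h v
  simp only [TensorProduct.AlgebraTensorModule.curry_apply, LinearMap.restrictScalars_self,
    TensorProduct.curry_apply, rightMulDiag_tmul]
  rw [sw_comul_one _ (by intros; fun_prop) (by intros; fun_prop)]
  simp

theorem rightMulDiag_mul (a b : K) (x : K ⊗[𝕜] (H ⊗[𝕜] V)) :
    rightMulDiag φ V (a * b) x = rightMulDiag φ V b (rightMulDiag φ V a x) := by
  rw [← LinearMap.comp_apply]
  congr 1; ext l h v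
  simp only [TensorProduct.AlgebraTensorModule.curry_apply, LinearMap.restrictScalars_self,
    TensorProduct.curry_apply, LinearMap.comp_apply, rightMulDiag_tmul, map_sw]
  rw [sw_comul_mul _ _ _ (by intros; fun_prop) (by intros; fun_prop)]
  simp only [map_mul, mul_assoc]

/-- One of the two maps defining the cotensor product is right `K`-linear for the diagonal action
through `k₍₁₎ ⊗ φ(k₍₂₎)`. The other, `δ.lTensor K`, is linear only for multiplication on the first
factor (`lTensor_rightMul`); the Yetter–Drinfeld condition makes up for the difference. -/
theorem cotensorRight_rightMul (k : K) (x : K ⊗[𝕜] V) :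
    cotensorRight φ V (rightMul 𝕜 K V k x) = rightMulDiag φ V k (cotensorRight φ V x) := by
  rw [← LinearMap.comp_apply, ← LinearMap.comp_apply]
  congr 1; ext l v
  simp only [TensorProduct.AlgebraTensorModule.curry_apply, LinearMap.restrictScalars_self,
    TensorProduct.curry_apply, LinearMap.comp_apply, rightMulDiag_tmul, map_sw, rightMul_tmul,
    cotensorRight_tmul_eq_sw]
  rw [sw_comul_mul _ _ _ (by intros; fun_prop) (by intros; fun_prop)]
  simp only [map_mul]

theorem lTensor_rightMul (δ : V →ₗ[𝕜] H ⊗[𝕜] V) (k : K) (x : K ⊗[𝕜] V) :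
    δ.lTensor K (rightMul 𝕜 K V k x) = rightMul 𝕜 K (H ⊗[𝕜] V) k (δ.lTensor K x) := by
  rw [← LinearMap.comp_apply, ← LinearMap.comp_apply]
  congr 1; ext l v; simp

variable {ρ} {δ : V →ₗ[𝕜] H ⊗[𝕜] V}

/-- Apply the Yetter–Drinfeld condition at `φ` of the last two legs of `k`: `(φ(k₍₂₎) v)⁽⁻¹⁾
φ(k₍₃₎)` becomes `φ(k₍₂₎) v⁽⁻¹⁾`. The cotensor equation then replaces `l ⊗ v⁽⁻¹⁾` by `l₍₁₎ ⊗
φ(l₍₂₎)`, and multiplicativity of the coproduct reassembles the right side. -/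
theorem IsYD.sw_leftAct (h : IsYD ρ δ) {x : K ⊗[𝕜] V} (hx : x ∈ cotensor φ δ) (k : K) :
    sw (Coalgebra.comul (R := 𝕜) k) (fun a b => (rightMul 𝕜 H V (φ b)).lTensor K
      (δ.lTensor K (leftAct φ ρ a x))) = cotensorRight φ V (leftAct φ ρ k x) := by
  have e1 : ∀ (a b : K), (rightMul 𝕜 H V (φ b)).lTensor K (δ.lTensor K (leftAct φ ρ a x)) =
      sw (Coalgebra.comul (R := 𝕜) a) (fun p q => sw x (fun l v => (p * l) ⊗ₜ[𝕜]
        sw (δ (ρ (φ q) v)) (fun h w => (h * φ b) ⊗ₜ[𝕜] w))) := by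
    intro a b
    rw [leftAct_eq_sw, sw_comm]
    simp only [map_sw, LinearMap.lTensor_tmul]
    simp only [linearMap_apply_eq_sw (rightMul 𝕜 H V (φ b)) (δ _)]
    rfl
  -- The Yetter–Drinfeld condition, pulled back from `H` to `K` along `φ`.
  have e2 : ∀ y v, sw (Coalgebra.comul (R := 𝕜) y) (fun q b =>
      sw (δ (ρ (φ q) v)) (fun h w => (h * φ b) ⊗ₜ[𝕜] w)) =
      sw (Coalgebra.comul (R := 𝕜) y) (fun q b =>
      sw (δ v) (fun h w => (φ q * h) ⊗ₜ[𝕜] ρ (φ b) w)) := by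
    intro y v
    rw [← sw_comul_bialgHom φ y (fun q b => sw (δ (ρ q v)) (fun h w => (h * b) ⊗ₜ[𝕜] w))
      (by intros; fun_prop) (by intros; fun_prop),
      ← h.sw_eq (φ y) v _ (by intros; fun_prop) (by intros; fun_prop),
      sw_comul_bialgHom φ y _ (by intros; fun_prop) (by intros; fun_prop)]
  simp only [e1]
  rw [sw_comul_coassoc k (fun p q b => sw x (fun l v => (p * l) ⊗ₜ[𝕜]
        sw (δ (ρ (φ q) v)) (fun h w => (h * φ b) ⊗ₜ[𝕜] w)))
      (by intros; fun_prop) (by intros; fun_prop) (by intros; fun_prop)]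
  have e3 : ∀ a b, sw (Coalgebra.comul (R := 𝕜) b) (fun p q => sw x (fun l v => (a * l) ⊗ₜ[𝕜]
        sw (δ (ρ (φ p) v)) (fun h w => (h * φ q) ⊗ₜ[𝕜] w))) =
      sw (Coalgebra.comul (R := 𝕜) b) (fun p q => sw x (fun l v =>
        sw (Coalgebra.comul (R := 𝕜) l) (fun l m =>
          (a * l) ⊗ₜ[𝕜] (φ (p * m) ⊗ₜ[𝕜] ρ (φ q) v)))) := by
    intro a b
    rw [sw_comm]
    simp only [← isLinearMap_map_sw (isLinearMap_tmul_right isLinearMap_id _), e2]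
    simp only [isLinearMap_map_sw (isLinearMap_tmul_right isLinearMap_id _)]
    rw [sw_comm]
    congr 1; funext p q
    rw [sw_cotensor φ hx (fun l h v => (a * l) ⊗ₜ[𝕜] ((φ p * h) ⊗ₜ[𝕜] ρ (φ q) v))
      (by intros; fun_prop) (by intros; fun_prop) (by intros; fun_prop)]
    simp only [map_mul]
  simp only [e3]
  rw [leftAct_eq_sw, sw_comm]
  simp only [map_sw, cotensorRight_tmul_eq_sw]
  rw [← sw_comul_coassoc k (fun a p q => sw x (fun l v =>
        sw (Coalgebra.comul (R := 𝕜) l) (fun l m =>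
          (a * l) ⊗ₜ[𝕜] (φ (p * m) ⊗ₜ[𝕜] ρ (φ q) v))))
      (by intros; fun_prop) (by intros; fun_prop) (by intros; fun_prop)]
  congr 1; funext a b
  rw [sw_comm]
  congr 1; funext l v
  rw [sw_comul_mul _ _ _ (by intros; fun_prop) (by intros; fun_prop)]

/-- The cotensor equation for `k · x` is tested after convolution with the diagonal right action.
There `(k₍₁₎ · x) ◁ k₍₂₎` collapses to `k ▷ x`, and what remains is `IsYD.sw_leftAct`. -/
theorem IsYD.indAct_mem (h : IsYD ρ δ) {x : K ⊗[𝕜] V} (hx : x ∈ cotensor φ δ) (k : K) :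
    indAct φ ρ k x ∈ cotensor φ δ := by
  change δ.lTensor K (indAct φ ρ k x) = cotensorRight φ V (indAct φ ρ k x)
  refine eq_of_sw_right_eq (rightMulDiag φ V) (rightMulDiag_one φ) (rightMulDiag_mul φ)
    (G := fun k => δ.lTensor K (indAct φ ρ k x))
    (G' := fun k => cotensorRight φ V (indAct φ ρ k x)) (by fun_prop) (by fun_prop) ?_ k
  intro k
  simp only [← cotensorRight_rightMul]
  rw [← map_sw, sw_rightMul_indAct, ← h.sw_leftAct φ hx]
  simp only [rightMulDiag_apply, ← lTensor_rightMul]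
  rw [← sw_comul_coassoc k (fun a b c => (rightMul 𝕜 H V (φ c)).lTensor K
    (δ.lTensor K (rightMul 𝕜 K V b (indAct φ ρ a x))))]
  · congr 1; funext a b
    rw [← map_sw, ← map_sw, sw_rightMul_indAct]
  · intros; fun_prop
  · intros; fun_prop
  · intro a b
    -- Linearity in the map that is tensored is supplied by `LinearMap.lTensorHom`.
    exact isLinearMap_linearMap_apply (isLinearMap_comp (LinearMap.lTensorHom K).isLinear
      (by fun_prop)) _

/-- The action `k (l ⊗ v) = k₍₁₎ l S(k₍₃₎) ⊗ φ(k₍₂₎) v` on the cotensor product. -/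
noncomputable def cotensorAct (h : IsYD ρ δ) : K →ₐ[𝕜] Module.End 𝕜 (cotensor φ δ) :=
  AlgHom.ofLinearMap
    { toFun := fun k => (indAct φ ρ k).restrict fun x hx => h.indAct_mem φ hx k
      map_add' := fun k l => by ext x; simp
      map_smul' := fun c k => by ext x; simp }
    (LinearMap.ext fun x => Subtype.ext (indAct_one φ ρ x.1))
    (fun k l => LinearMap.ext fun x => Subtype.ext (indAct_mul φ ρ k l x.1))

theorem cotensorAct_coe (h : IsYD ρ δ) (k : K) (x : cotensor φ δ) :
    (cotensorAct φ h k x).1 = indAct φ ρ k x.1 := rfl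

end Action

/-! ### The induction functor on Yetter--Drinfeld modules -/

section IndYD
variable {𝕜 : Type u} [Field 𝕜] {K H : Type u} [Ring K] [Ring H] [HopfAlgebra 𝕜 K]
  [HopfAlgebra 𝕜 H] (φ : K →ₐc[𝕜] H)
  {V W A : Type u} [AddCommGroup V] [Module 𝕜 V] [AddCommGroup W] [Module 𝕜 W]
  [AddCommGroup A] [Module 𝕜 A] (ρ : H →ₐ[𝕜] Module.End 𝕜 V) (σ : H →ₐ[𝕜] Module.End 𝕜 W)

theorem freeCoact_rightMul (k : K) (x : K ⊗[𝕜] V) : freeCoact 𝕜 K V (rightMul 𝕜 K V k x) =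
    sw (Coalgebra.comul (R := 𝕜) k) (fun a b => sw (freeCoact 𝕜 K V x)
      (fun p y => (p * a) ⊗ₜ[𝕜] rightMul 𝕜 K V b y)) := by
  have e : ∀ x : K ⊗[𝕜] V, sw (freeCoact 𝕜 K V x) (fun p y => sw (Coalgebra.comul (R := 𝕜) k)
      (fun a b => (p * a) ⊗ₜ[𝕜] rightMul 𝕜 K V b y)) =
      bilift (fun p y => sw (Coalgebra.comul (R := 𝕜) k)
        (fun a b => (p * a) ⊗ₜ[𝕜] rightMul 𝕜 K V b y)) (by intros; fun_prop)
        (by intros; fun_prop) (freeCoact 𝕜 K V x) := fun x => (bilift_apply ..).symm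
  rw [sw_comm, e, ← LinearMap.comp_apply, ← LinearMap.comp_apply]
  congr 1; ext l v
  simp only [TensorProduct.AlgebraTensorModule.curry_apply, LinearMap.restrictScalars_self,
    TensorProduct.curry_apply, LinearMap.comp_apply, freeCoact_tmul_eq_sw, rightMul_tmul]
  rw [sw_comul_mul _ _ _ (by intros; fun_prop) (by intros; fun_prop), map_sw]
  simp (disch := intros; fun_prop) only [bilift_apply, sw_tmul, rightMul_tmul]

theorem freeCoact_leftAct (k : K) (x : K ⊗[𝕜] V) : freeCoact 𝕜 K V (leftAct φ ρ k x) =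
    sw (Coalgebra.comul (R := 𝕜) k) (fun a b => sw (freeCoact 𝕜 K V x)
      (fun p y => (a * p) ⊗ₜ[𝕜] leftAct φ ρ b y)) := by
  have e : ∀ x : K ⊗[𝕜] V, sw (freeCoact 𝕜 K V x) (fun p y => sw (Coalgebra.comul (R := 𝕜) k)
      (fun a b => (a * p) ⊗ₜ[𝕜] leftAct φ ρ b y)) =
      bilift (fun p y => sw (Coalgebra.comul (R := 𝕜) k)
        (fun a b => (a * p) ⊗ₜ[𝕜] leftAct φ ρ b y)) (by intros; fun_prop)
        (by intros; fun_prop) (freeCoact 𝕜 K V x) := fun x => (bilift_apply ..).symm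
  rw [sw_comm, e, ← LinearMap.comp_apply, ← LinearMap.comp_apply]
  congr 1; ext l v
  simp only [TensorProduct.AlgebraTensorModule.curry_apply, LinearMap.restrictScalars_self,
    TensorProduct.curry_apply, LinearMap.comp_apply, freeCoact_tmul_eq_sw, leftAct_tmul, map_sw]
  simp (disch := intros; fun_prop) only [bilift_apply, sw_tmul, sw_comul_mul]
  rw [sw_comul_coassoc k (fun c d b => sw (Coalgebra.comul (R := 𝕜) l) fun r s =>
    (c * r) ⊗ₜ[𝕜] ((d * s) ⊗ₜ[𝕜] ρ (φ b) v)) (by intros; fun_prop) (by intros; fun_prop)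
    (by intros; fun_prop), sw_comm]
  congr 1; funext a b
  simp only [leftAct_tmul]
  rw [sw_comm]
  simp only [isLinearMap_map_sw (isLinearMap_tmul_right isLinearMap_id _)]

/-- The Yetter--Drinfeld condition for the induced action and coaction on `K ⊗ V`. -/
theorem sw_freeCoact_indAct (k : K) (x : K ⊗[𝕜] V) :
    sw (Coalgebra.comul (R := 𝕜) k) (fun a b => sw (freeCoact 𝕜 K V x)
        (fun p y => (a * p) ⊗ₜ[𝕜] indAct φ ρ b y)) =
      sw (Coalgebra.comul (R := 𝕜) k) (fun a b => sw (freeCoact 𝕜 K V (indAct φ ρ a x))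
        (fun p y => (p * b) ⊗ₜ[𝕜] y)) := by
  -- Convolve with right multiplication on the inner factor `K ⊗ V`. Both sides then become the free
  -- coaction of `k ▷ x`: the left by `freeCoact_leftAct`, the right by `freeCoact_rightMul`.
  refine eq_of_sw_right_eq (LinearMap.lTensorHom K ∘ₗ rightMul 𝕜 K V) (by simp)
    (fun a b m => ?_) (G := fun k => sw (Coalgebra.comul (R := 𝕜) k) (fun a b =>
      sw (freeCoact 𝕜 K V x) (fun p y => (a * p) ⊗ₜ[𝕜] indAct φ ρ b y)))
    (G' := fun k => sw (Coalgebra.comul (R := 𝕜) k) (fun a b =>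
      sw (freeCoact 𝕜 K V (indAct φ ρ a x)) (fun p y => (p * b) ⊗ₜ[𝕜] y)))
    (by fun_prop) (by fun_prop) ?_ k
  · change (rightMul 𝕜 K V (a * b)).lTensor K m = (rightMul 𝕜 K V b).lTensor K
      ((rightMul 𝕜 K V a).lTensor K m)
    rw [← LinearMap.comp_apply, ← LinearMap.lTensor_comp]
    congr 2
    exact LinearMap.ext fun x => rightMul_mul a b x
  · intro k
    simp only [map_sw, LinearMap.comp_apply, LinearMap.coe_lTensorHom, LinearMap.lTensor_tmul]
    rw [sw_comul_coassoc k (fun a b c => sw (freeCoact 𝕜 K V x) fun p y =>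
        (a * p) ⊗ₜ[𝕜] rightMul 𝕜 K V c (indAct φ ρ b y)) (by intros; fun_prop)
        (by intros; fun_prop) (by intros; fun_prop),
      sw_comul_coassoc k (fun a b c => sw (freeCoact 𝕜 K V (indAct φ ρ a x)) fun p y =>
        (p * b) ⊗ₜ[𝕜] rightMul 𝕜 K V c y) (by intros; fun_prop)
        (by intros; fun_prop) (by intros; fun_prop)]
    simp only [← freeCoact_rightMul]
    rw [← map_sw, sw_rightMul_indAct, freeCoact_leftAct]
    congr 1; funext a b
    rw [sw_comm]
    simp only [← isLinearMap_map_sw (isLinearMap_tmul_right isLinearMap_id _), sw_rightMul_indAct]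

variable {ρ} {δ : V →ₗ[𝕜] H ⊗[𝕜] V}

/-- The condition already holds on all of `K ⊗ V` (`sw_freeCoact_indAct`); the cotensor product
inherits it along an injective inclusion. -/
theorem IsYD.cotensor (h : IsYD ρ δ) : IsYD (V := cotensor φ δ) (cotensorAct φ h)
    (cotensorCoact φ δ) := by
  refine isYD_of_sw fun k x => ?_
  apply lTensor_subtype_injective φ δ K
  have hs : ∀ x : HopfInd.cotensor φ δ,
      (HopfInd.cotensor φ δ).subtype.lTensor K (cotensorCoact φ δ x) =
        freeCoact 𝕜 K V x.1 := LinearMap.congr_fun (cotensorCoact_spec φ δ)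
  have key := sw_freeCoact_indAct φ ρ k x.1
  simp only [← hs, ← cotensorAct_coe φ h] at key
  simp (disch := intros; fun_prop) only [sw_lTensor] at key
  simp only [map_sw, LinearMap.lTensor_tmul]
  exact key

/-- In the product of `x` and `k ▷ y` the leg `k₍₁₎` stands between the two `K` factors and can be
moved onto `x` from the right. -/
theorem mulTensor_leftAct_right (k : K) (x : K ⊗[𝕜] V) (y : K ⊗[𝕜] W) :
    mulTensor K V W (x ⊗ₜ leftAct φ σ k y) = sw (Coalgebra.comul (R := 𝕜) k) (fun a b =>
      mulTensor K V W (rightMul 𝕜 K V a x ⊗ₜ (σ (φ b)).lTensor K y)) := by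
  induction x using TensorProduct.induction_on with
  | zero => simp [sw]
  | add x x' hx hx' => simp only [map_add, TensorProduct.add_tmul, hx, hx', sw,
      Finset.sum_add_distrib]
  | tmul l v =>
    induction y using TensorProduct.induction_on with
    | zero => simp [sw]
    | add x x' hx hx' => simp only [map_add, TensorProduct.tmul_add, hx, hx', sw,
        Finset.sum_add_distrib]
    | tmul m w =>
      rw [leftAct_tmul, isLinearMap_map_sw (isLinearMap_tmul_right isLinearMap_id _), map_sw]
      simp [mul_assoc]

theorem leftAct_mulTensor (k : K) (x : K ⊗[𝕜] V) (y : K ⊗[𝕜] W) :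
    leftAct φ (tensorAct ρ σ) k (mulTensor K V W (x ⊗ₜ y)) =
      sw (Coalgebra.comul (R := 𝕜) k) (fun a b =>
        mulTensor K V W (leftAct φ ρ a x ⊗ₜ (σ (φ b)).lTensor K y)) := by
  induction x using TensorProduct.induction_on with
  | zero => simp [sw]
  | add x x' hx hx' => simp only [map_add, TensorProduct.add_tmul, hx, hx', sw,
      Finset.sum_add_distrib]
  | tmul l v =>
    induction y using TensorProduct.induction_on with
    | zero => simp [sw]
    | add x x' hx hx' => simp only [map_add, TensorProduct.tmul_add, hx, hx', sw,
        Finset.sum_add_distrib]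
    | tmul m w =>
      simp only [mulTensor_tmul, leftAct_tmul, LinearMap.lTensor_tmul, tensorAct_tmul_eq_sw,
        isLinearMap_map_sw (isLinearMap_tmul_right isLinearMap_id _),
        isLinearMap_map_sw (isLinearMap_tmul_left isLinearMap_id _), map_sw]
      simp (disch := intros; fun_prop) only [sw_comul_bialgHom]
      rw [sw_comul_coassoc k (fun a b c => (a * l * m) ⊗ₜ[𝕜] (ρ (φ b) v ⊗ₜ[𝕜] σ (φ c) w))
        (by intros; fun_prop) (by intros; fun_prop) (by intros; fun_prop)]
      simp only [mul_assoc]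

theorem rightMul_mulTensor (k : K) (x : K ⊗[𝕜] V) (y : K ⊗[𝕜] W) :
    rightMul 𝕜 K (V ⊗[𝕜] W) k (mulTensor K V W (x ⊗ₜ y)) =
      mulTensor K V W (x ⊗ₜ rightMul 𝕜 K W k y) := by
  induction x using TensorProduct.induction_on with
  | zero => simp
  | add x x' hx hx' => simp only [map_add, TensorProduct.add_tmul, hx, hx']
  | tmul l v =>
    induction y using TensorProduct.induction_on with
    | zero => simp
    | add x x' hx hx' => simp only [map_add, TensorProduct.tmul_add, hx, hx']
    | tmul m w => simp [mul_assoc]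

/-- After convolution with `◁` the product of `k₍₁₎ · x` and `(k₍₂₎ · y) ◁ k₍₃₎` becomes that of
`k₍₁₎ · x` and `k₍₂₎ ▷ y`. Moving a leg across gives `k₍₁₎ ▷ x` times `φ(k₍₂₎) y`, which is `k ▷` of
the product of `x` and `y`. -/
theorem mulTensor_indAct (k : K) (x : K ⊗[𝕜] V) (y : K ⊗[𝕜] W) :
    sw (Coalgebra.comul (R := 𝕜) k) (fun a b =>
      mulTensor K V W (indAct φ ρ a x ⊗ₜ indAct φ σ b y)) =
    indAct φ (tensorAct ρ σ) k (mulTensor K V W (x ⊗ₜ y)) := by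
  refine eq_of_sw_right_eq (rightMul 𝕜 K (V ⊗[𝕜] W)) rightMul_one rightMul_mul
    (G := fun k => sw (Coalgebra.comul (R := 𝕜) k) (fun a b =>
      mulTensor K V W (indAct φ ρ a x ⊗ₜ indAct φ σ b y)))
    (G' := fun k => indAct φ (tensorAct ρ σ) k (mulTensor K V W (x ⊗ₜ y)))
    (by fun_prop) (by fun_prop) ?_ k
  intro k
  simp only [map_sw, sw_rightMul_indAct, rightMul_mulTensor]
  rw [sw_comul_coassoc k (fun a b c => mulTensor K V W
      (indAct φ ρ a x ⊗ₜ rightMul 𝕜 K W c (indAct φ σ b y))) (by intros; fun_prop)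
      (by intros; fun_prop) (by intros; fun_prop)]
  simp only [← map_sw, ← isLinearMap_map_sw (isLinearMap_tmul_right isLinearMap_id _),
    sw_rightMul_indAct]
  simp only [map_sw, mulTensor_leftAct_right]
  have hl : IsLinearMap 𝕜 (fun c : K => (σ (φ c)).lTensor K y) :=
    isLinearMap_linearMap_apply (isLinearMap_comp (LinearMap.lTensorHom K).isLinear
      (by fun_prop)) _
  rw [← sw_comul_coassoc k (fun a b c => mulTensor K V W
      (rightMul 𝕜 K V b (indAct φ ρ a x) ⊗ₜ (σ (φ c)).lTensor K y)) (by intros; fun_prop)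
      (by intros; fun_prop) (by intros; fun_prop)]
  simp only [← map_sw, ← isLinearMap_map_sw (isLinearMap_tmul_left isLinearMap_id _),
    sw_rightMul_indAct, leftAct_mulTensor]

/-- The middle leg acts on the field through the counit and disappears; the outer legs cancel by the
antipode axiom. -/
theorem indAct_unitAct (k : K) (c : 𝕜) : indAct φ (unitAct 𝕜 H) k (1 ⊗ₜ c) =
    Coalgebra.counit (R := 𝕜) k • ((1 : K) ⊗ₜ[𝕜] c) := by
  rw [indAct_tmul, ← sw_mul_antipode k (fun k => k ⊗ₜ[𝕜] c) (by fun_prop)]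
  congr 1; funext a b
  rw [← sw_counit_left b (fun b => (a * HopfAlgebra.antipode 𝕜 b) ⊗ₜ[𝕜] c) (by fun_prop)]
  congr 1; funext b d
  rw [unitAct_apply, CoalgHomClass.counit_comp_apply, one_mul, ← TensorProduct.tmul_smul,
    smul_eq_mul]

end IndYD

/-! ### The functor `F` for comodule induction and its lax structure. -/

section IndFunctor
variable {𝕜 : Type u} [Field 𝕜] {K H : Type u} [Ring K] [Ring H] [HopfAlgebra 𝕜 K]
  [HopfAlgebra 𝕜 H] (φ : K →ₐc[𝕜] H)

/-- The module underlying the induced Yetter--Drinfeld module. -/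
noncomputable def indYDMod (V : YD 𝕜 H) : LMod 𝕜 K := ⟨cotensor φ V.coact, cotensorAct φ V.isYD⟩

/-- Induction of Yetter--Drinfeld modules along `φ : K → H`. -/
noncomputable def indYD : YD 𝕜 H ⥤ YD 𝕜 K where
  obj V :=
    { toLMod := indYDMod φ V
      coact := ((indComod φ).obj V.toLComod).coact
      isCoact := ((indComod φ).obj V.toLComod).isCoact
      isYD := V.isYD.cotensor φ }
  map {V _} f :=
    { toLin := cotensorMap f.comm'
      comm := fun k => LinearMap.ext fun x => Subtype.ext (lTensor_indAct φ V.act f.comm k x.1)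
      comm' := cotensorMap_colinear φ f.comm' }
  map_id W := YD.hom_ext (LinearMap.ext fun x => Subtype.ext
    (LinearMap.lTensor_id_apply K W.carrier x.1))
  map_comp f g := YD.hom_ext (LinearMap.ext fun x => Subtype.ext
    (LinearMap.lTensor_comp_apply K g.toLin f.toLin x.1))

/-- This is `mulTensor_indAct`, read inside `K ⊗ (V ⊗ W)`. -/
theorem indYD_mu_comm (V W : YD 𝕜 H) (k : K) :
    (lax (indAdj φ) V.toLComod W.toLComod).toLin ∘ₗ
        tensorAct (indYDMod φ V).act (indYDMod φ W).act k =
      (indYDMod φ (V ⊗ W)).act k ∘ₗ (lax (indAdj φ) V.toLComod W.toLComod).toLin := by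
  let g : (indYDMod φ V).carrier ⊗[𝕜] (indYDMod φ W).carrier →ₗ[𝕜]
    (indYDMod φ (V ⊗ W)).carrier := (lax (indAdj φ) V.toLComod W.toLComod).toLin
  change g ∘ₗ tensorAct (indYDMod φ V).act (indYDMod φ W).act k =
    (indYDMod φ (V ⊗ W)).act k ∘ₗ g
  refine TensorProduct.ext' fun x y => ?_
  let i : (indYDMod φ (V ⊗ W)).carrier →ₗ[𝕜] K ⊗[𝕜] (V.carrier ⊗[𝕜] W.carrier) :=
    (cotensor φ (tensorCoact V.coact W.coact)).subtype
  have hi : Function.Injective i := Subtype.val_injective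
  have hg : ∀ (x : (indYDMod φ V).carrier) (y : (indYDMod φ W).carrier),
      i (g (x ⊗ₜ y)) = mulTensor K V.carrier W.carrier (Subtype.val x ⊗ₜ Subtype.val y) :=
    indAdj_lax φ V.toLComod W.toLComod
  have e : i ((indYDMod φ (V ⊗ W)).act k (g (x ⊗ₜ y))) =
      indAct φ (tensorAct V.act W.act) k (i (g (x ⊗ₜ y))) := rfl
  apply hi
  rw [LinearMap.comp_apply, LinearMap.comp_apply, e, hg, ← mulTensor_indAct, tensorAct_tmul_eq_sw,
    map_sw, map_sw]
  simp only [hg]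
  rfl

/-- The lax monoidal structure on induction of Yetter--Drinfeld modules. -/
noncomputable instance indYDLaxMonoidal : (indYD φ).LaxMonoidal :=
  letI := (indAdj φ).rightAdjointLaxMonoidal
  { ε := ⟨(laxUnit (indAdj φ)).toLin, fun k => LinearMap.ext fun c => Subtype.ext (by
        change (1 : K) ⊗ₜ[𝕜] (unitAct 𝕜 K k c) = indAct φ (unitAct 𝕜 H) k (1 ⊗ₜ c)
        rw [indAct_unitAct, unitAct_apply, ← TensorProduct.tmul_smul, smul_eq_mul]),
      (laxUnit (indAdj φ)).comm⟩
    μ := fun V W => ⟨(lax (indAdj φ) V.toLComod W.toLComod).toLin, indYD_mu_comm φ V W,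
      (lax (indAdj φ) V.toLComod W.toLComod).comm⟩
    -- The coherence laws are equations between linear maps, hence those of the right adjoint
    -- `indComod φ`.
    μ_natural_left := fun {V W} f U => YD.hom_ext congr(LComod.Hom.toLin
      $(Functor.LaxMonoidal.μ_natural_left (indComod φ) ((YD.forgetLComod 𝕜 H).map f) U.toLComod))
    μ_natural_right := fun {V W} U f => YD.hom_ext congr(LComod.Hom.toLin
      $(Functor.LaxMonoidal.μ_natural_right (indComod φ) U.toLComod ((YD.forgetLComod 𝕜 H).map f)))
    associativity := fun V W U => YD.hom_ext congr(LComod.Hom.toLin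
      $(Functor.LaxMonoidal.associativity (indComod φ) V.toLComod W.toLComod U.toLComod))
    left_unitality := fun V => YD.hom_ext congr(LComod.Hom.toLin
      $(Functor.LaxMonoidal.left_unitality (indComod φ) V.toLComod))
    right_unitality := fun V => YD.hom_ext congr(LComod.Hom.toLin
      $(Functor.LaxMonoidal.right_unitality (indComod φ) V.toLComod)) }

end IndFunctor

/-! ### Half-braidings and braiding of induced modules. -/

section Braid
variable {𝕜 : Type u} [Field 𝕜] {K H : Type u} [Ring K] [Ring H] [HopfAlgebra 𝕜 K]
  [HopfAlgebra 𝕜 H] (φ : K →ₐc[𝕜] H)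
  {V W A : Type u} [AddCommGroup V] [Module 𝕜 V] [AddCommGroup W] [Module 𝕜 W]
  [AddCommGroup A] [Module 𝕜 A] {ρ : H →ₐ[𝕜] Module.End 𝕜 V} (σ : H →ₐ[𝕜] Module.End 𝕜 W)
  {δ : V →ₗ[𝕜] H ⊗[𝕜] V}

theorem mulTensor_tmul_rightMul (m : K ⊗[𝕜] W) (b : K) (v : V) :
    mulTensor K W V (m ⊗ₜ (b ⊗ₜ v)) =
      mulTensor K W V (rightMul 𝕜 K W b m ⊗ₜ (1 ⊗ₜ v)) := by
  induction m using TensorProduct.induction_on with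
  | zero => simp
  | add x x' hx hx' => simp only [map_add, TensorProduct.add_tmul, hx, hx']
  | tmul l w => simp

/-- The braiding identity inside `K ⊗ (W ⊗ V)`. Multiplying `l₍₁₎ · y` by `l₍₂₎ ⊗ v` puts `l₍₂₎` to
the right of `l₍₁₎ · y`, and together they give `l ▷ y`. The cotensor equation for `x` then turns
the `φ(l₍₂₎)` acting on `W` into `v⁽⁻¹⁾`. -/
theorem sw_mulTensor_freeCoact (x : K ⊗[𝕜] V) (hx : x ∈ cotensor φ δ) (y : K ⊗[𝕜] W) :
    sw (freeCoact 𝕜 K V x) (fun k z => mulTensor K W V (indAct φ σ k y ⊗ₜ z)) =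
      (braid δ σ).lTensor K (mulTensor K V W (x ⊗ₜ y)) := by
  have e1 : sw (freeCoact 𝕜 K V x) (fun k z => mulTensor K W V (indAct φ σ k y ⊗ₜ z)) =
      sw x (fun l v => mulTensor K W V (leftAct φ σ l y ⊗ₜ (1 ⊗ₜ v))) := by
    rw [freeCoact_eq_sw]
    simp (disch := intros; fun_prop) only [sw_sw, sw_tmul]
    congr 1; funext l v
    rw [← sw_rightMul_indAct, isLinearMap_map_sw (L := fun t => mulTensor K W V (t ⊗ₜ _))
      (by fun_prop)]
    congr 1; funext a b
    exact mulTensor_tmul_rightMul _ _ _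
  rw [e1]
  clear e1
  induction y using TensorProduct.induction_on with
  | zero => simp [sw]
  | add y y' hy hy' => simp only [map_add, TensorProduct.tmul_add, TensorProduct.add_tmul,
      ← hy, ← hy', sw, Finset.sum_add_distrib]
  | tmul m w =>
    have h := sw_cotensor φ hx (fun l h v => (l * m) ⊗ₜ[𝕜] (σ h w ⊗ₜ[𝕜] v)) (by intros; fun_prop)
      (by intros; fun_prop) (by intros; fun_prop)
    have e2 : (braid δ σ).lTensor K (mulTensor K V W (x ⊗ₜ (m ⊗ₜ w))) =
        sw x (fun l v => (l * m) ⊗ₜ[𝕜] braid δ σ (v ⊗ₜ w)) := by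
      conv_lhs => rw [← sw_tmul_self x]
      rw [isLinearMap_map_sw (L := fun t => (braid δ σ).lTensor K (mulTensor K V W (t ⊗ₜ _)))
        (by fun_prop)]
      simp only [mulTensor_tmul, LinearMap.lTensor_tmul]
    rw [e2]
    simp only [braid_tmul_eq_sw, isLinearMap_map_sw (isLinearMap_tmul_right isLinearMap_id _)]
    rw [h]
    congr 1; funext l v
    rw [leftAct_tmul, isLinearMap_map_sw (L := fun t => mulTensor K W V (t ⊗ₜ _))
      (by fun_prop)]
    simp

/-- The half-braidings of `K ⊗ V` and of `V` agree. -/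
theorem twistRight_braid_indAct {κ : A →ₗ[𝕜] K ⊗[𝕜] A} (hκ : IsCoact κ) (a : A) (x : K ⊗[𝕜] V) :
    sw (κ a) (fun p b => twistRight V κ (indAct φ ρ p x ⊗ₜ b)) =
      (braid (resCoact φ κ) ρ).lTensor K (twistLeft V κ (a ⊗ₜ x)) := by
  have e1 : ∀ (y : K ⊗[𝕜] V) (b : A), twistRight V κ (y ⊗ₜ b) = sw (κ b) (fun q c =>
      TensorProduct.assoc 𝕜 K V A (rightMul 𝕜 K V q y ⊗ₜ c)) := by
    intro y b
    induction y using TensorProduct.induction_on with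
    | zero => simp [sw]
    | add y y' hy hy' => simp only [map_add, TensorProduct.add_tmul,
        hy, hy', sw, Finset.sum_add_distrib]
    | tmul l v => rw [twistRight_tmul]; rfl
  simp only [e1]
  -- By coassociativity the two coaction legs of `a` become the coproduct legs of `a⁽⁻¹⁾`, so that
  -- the induced action followed by right multiplication collapses to `a⁽⁻¹⁾ ▷ x`. No cotensor
  -- equation for `x` is needed.
  rw [← hκ.sw_coassoc a (fun p q c => TensorProduct.assoc 𝕜 K V A
    (rightMul 𝕜 K V q (indAct φ ρ p x) ⊗ₜ c)) (by intros; fun_prop)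
      (by intros; fun_prop) (by intros; fun_prop)]
  simp only [← map_sw, ← isLinearMap_map_sw (isLinearMap_tmul_left isLinearMap_id _),
    sw_rightMul_indAct]
  induction x using TensorProduct.induction_on with
  | zero => simp [sw]
  | add y y' hy hy' =>
    simp only [map_add, TensorProduct.add_tmul, TensorProduct.tmul_add, sw,
      Finset.sum_add_distrib] at hy hy' ⊢
    rw [hy, hy']
  | tmul l v =>
    simp only [leftAct_tmul, twistLeft_tmul, map_sw, LinearMap.lTensor_tmul, braid_tmul_eq_sw,
      isLinearMap_map_sw (isLinearMap_tmul_left isLinearMap_id _), TensorProduct.assoc_tmul]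
    rw [hκ.sw_coassoc a (fun p q c => (p * l) ⊗ₜ[𝕜] (ρ (φ q) v ⊗ₜ[𝕜] c)) (by intros; fun_prop)
      (by intros; fun_prop) (by intros; fun_prop)]
    simp (disch := intros; fun_prop) only [sw_resCoact,
      isLinearMap_map_sw (isLinearMap_tmul_right isLinearMap_id _)]

/-- The comodule underlying the induced Yetter--Drinfeld module is the induced comodule. -/
noncomputable def indYDForget : indYD φ ⋙ YD.forgetLComod 𝕜 K ≅ YD.forgetLComod 𝕜 H ⋙ indComod φ :=
  NatIso.ofComponents (fun _ => Iso.refl _) (fun _ => rfl)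

theorem indYD_halfBraiding (V : YD 𝕜 H) (A : LComod 𝕜 K) :
    -- The components of `indYDForget φ` are identities and drop out; the rest is
    -- `twistRight_braid_indAct`.
    YD.halfBraidingComod ((indYD φ).obj V) A ≫ ((indYDForget φ).hom.app V ▷ A) ≫
        rproj (indAdj φ) ((YD.forgetLComod 𝕜 H).obj V) A =
      (A ◁ (indYDForget φ).hom.app V) ≫ lproj (indAdj φ) A ((YD.forgetLComod 𝕜 H).obj V) ≫
        (indComod φ).map (YD.halfBraidingComod V ((resComod φ).obj A)) := by
  have h1 : (indYDForget φ).hom.app V ▷ A = 𝟙 _ := MonoidalCategory.id_whiskerRight _ _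
  have h2 : A ◁ (indYDForget φ).hom.app V = 𝟙 _ := MonoidalCategory.whiskerLeft_id _ _
  rw [h1, h2]
  erw [Category.id_comp, Category.id_comp]
  apply LComod.hom_ext
  refine TensorProduct.ext' fun (a : A.carrier) (x : cotensor φ V.coact) => Subtype.ext ?_
  refine Eq.trans ?_ ((twistRight_braid_indAct φ (ρ := V.act) A.isCoact a x.1).trans ?_)
  · refine (indAdj_rproj φ V.toLComod A (braid (W := cotensor φ V.coact) A.coact
      (cotensorAct φ V.isYD) (a ⊗ₜ x))).trans ?_
    rw [braid_tmul_eq_sw, map_sw, map_sw]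
    rfl
  · exact congr((braid (resCoact φ A.coact) V.act).lTensor K
      $(indAdj_lproj φ A V.toLComod (a ⊗ₜ x))).symm

variable [InvertibleAntipode 𝕜 K] [InvertibleAntipode 𝕜 H]

noncomputable instance indYDLaxBraided : (indYD φ).LaxBraided where
  braided V W := by
    apply YD.hom_ext
    let g : ∀ V W : YD 𝕜 H, cotensor φ V.coact ⊗[𝕜] cotensor φ W.coact →ₗ[𝕜]
      cotensor φ (tensorCoact V.coact W.coact) :=
        fun V W => (lax (indAdj φ) V.toLComod W.toLComod).toLin
    have hg : ∀ V W x y, (g V W (x ⊗ₜ y)).1 = mulTensor K V.carrier W.carrier (x.1 ⊗ₜ y.1) :=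
      fun V W => indAdj_lax φ V.toLComod W.toLComod
    refine TensorProduct.ext' fun (x : cotensor φ V.coact) (y : cotensor φ W.coact) =>
      Subtype.ext ?_
    -- The equation is compared in the ambient `K ⊗ (W ⊗ V)`, where the lax maps are `mulTensor`.
    change (braid V.coact W.act).lTensor K (g V W (x ⊗ₜ y)).1 =
      (cotensor φ (tensorCoact W.coact V.coact)).subtype
        (g W V (braid (U := cotensor φ V.coact) (V := cotensor φ V.coact)
          (W := cotensor φ W.coact) (cotensorCoact φ V.coact)
          (cotensorAct φ W.isYD) (x ⊗ₜ y)))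
    rw [hg, ← sw_mulTensor_freeCoact φ W.act x.1 x.2 y.1]
    have hs : (cotensor φ V.coact).subtype.lTensor K (cotensorCoact φ V.coact x) =
        freeCoact 𝕜 K V.carrier x.1 := LinearMap.congr_fun (cotensorCoact_spec φ V.coact) x
    rw [← hs, sw_lTensor _ _ _ (by intros; fun_prop) (by intros; fun_prop), braid_tmul_eq_sw,
      map_sw, map_sw]
    simp only [Submodule.subtype_apply, hg]
    rfl

end Braid

/-! ### Coinduction of modules -/

section HomK
variable {𝕜 : Type u} [Field 𝕜] {K H : Type u} [Ring K] [Ring H] [HopfAlgebra 𝕜 K]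
  [HopfAlgebra 𝕜 H]
  (φ : K →ₐc[𝕜] H) {V A : Type u} [AddCommGroup V] [Module 𝕜 V] [AddCommGroup A] [Module 𝕜 A]
  (ρ : K →ₐ[𝕜] Module.End 𝕜 V)

@[fun_prop] theorem isLinearMap_subtype_val {M : Type u} [AddCommGroup M] [Module 𝕜 M]
    {p : Submodule 𝕜 M} {f : A → p} (hf : IsLinearMap 𝕜 f) : IsLinearMap 𝕜 (fun x => (f x).1) :=
  isLinearMap_comp p.subtype.isLinear hf

/-- Finite dual bases of `H` as a left `K`-module via `φ`. -/
def HasDualBasis : Prop :=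
  ∃ (n : ℕ) (b : Fin n → H) (β : Fin n → H →ₗ[𝕜] K),
    (∀ i k h, β i (φ k * h) = k * β i h) ∧ ∀ h, ∑ i, φ (β i h) * b i = h

/-- `H` is a direct summand of some `Kⁿ`: the `b i` are the images of the standard basis and the `β
i` are the coordinates of a section. -/
theorem hasDualBasis_of_finite_projective
    (h : letI : Module K H := Module.compHom H ((φ : K →ₐ[𝕜] H) : K →+* H);
      Module.Finite K H ∧ Module.Projective K H) : HasDualBasis φ := by
  let _ : Module K H := Module.compHom H ((φ : K →ₐ[𝕜] H) : K →+* H)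
  obtain ⟨_, _⟩ := h
  have hs : ∀ (k : K) (x : H), k • x = φ k * x := fun _ _ => rfl
  obtain ⟨n, f, g, -, -, hfg⟩ := Module.Finite.exists_comp_eq_id_of_projective K H
  -- The two scalar actions of `𝕜` on `H` agree, so `K`-linear forms are `𝕜`-linear.
  have hc : ∀ (c : 𝕜) (x : H), (algebraMap 𝕜 K c) • x = c • x := fun c x => by
    rw [hs, AlgHomClass.commutes, Algebra.smul_def]
  refine ⟨n, fun i => f (Pi.single i 1), fun i =>
    { toFun := fun h => g h i
      map_add' := fun x y => by simp
      map_smul' := fun c x => by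
        rw [← hc, map_smul, Pi.smul_apply, smul_eq_mul, RingHom.id_apply, Algebra.smul_def] },
    fun i k h => ?_, fun h => ?_⟩
  · change g (φ k * h) i = k * g h i
    rw [← hs, map_smul]; rfl
  · have := LinearMap.congr_fun hfg h
    rw [LinearMap.comp_apply, LinearMap.id_apply, ← LinearMap.sum_single_apply (fun _ => K) (g h),
      map_sum] at this
    refine Eq.trans (Finset.sum_congr rfl fun i _ => ?_) this
    change φ (g h i) * f (Pi.single i 1) = f (Pi.single i (g h i))
    rw [← hs, ← map_smul, ← Pi.single_smul, smul_eq_mul, mul_one]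

variable {φ}

theorem homKTensor_tmul_apply (a : A) (f : homK φ ρ) (h : H) :
    (homKTensor φ A ρ (a ⊗ₜ f)).1 h = a ⊗ₜ[𝕜] f.1 h := rfl

theorem homKTensor_apply (x : A ⊗[𝕜] homK φ ρ) (h : H) :
    (homKTensor φ A ρ x).1 h = sw x (fun a f => a ⊗ₜ[𝕜] f.1 h) := by
  have : (homKTensor φ A ρ x).1 h = (homKEval φ (trivTensorAct A ρ) h ∘ₗ homKTensor φ A ρ) x := rfl
  rw [this, linearMap_apply_eq_sw]
  rfl

theorem trivTensorAct_apply (k : K) (t : A ⊗[𝕜] V) :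
    trivTensorAct A ρ k t = (ρ k).lTensor A t := by
  rw [linearMap_apply_eq_sw, linearMap_apply_eq_sw (LinearMap.lTensor _ _)]
  rfl

/-- The map `v ↦ (h ↦ β(h) v)` for a left `K`-linear form `β` on `H`. -/
def homKMk (β : H →ₗ[𝕜] K) (hβ : ∀ k h, β (φ k * h) = k * β h) : V →ₗ[𝕜] homK φ ρ where
  toFun v := ⟨orbit ρ v ∘ₗ β, fun k h => by simp [hβ]⟩
  map_add' v w := by ext; simp
  map_smul' c v := by ext; simp

/-- A `K`-linear `f` is recovered from its values on the dual basis, `f h = ∑ β i h · f (b i)`. The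
inverse therefore sends `g` to the sum over `i` of the values `g (b i)`, each with its `V` leg `v`
replaced by the map `h ↦ β i h · v`. -/
theorem homKTensor_bijective (hφ : HasDualBasis φ) : Function.Bijective (homKTensor φ A ρ) := by
  obtain ⟨n, b, β, h₁, h₂⟩ := hφ
  let B : homK φ (trivTensorAct A ρ) →ₗ[𝕜] A ⊗[𝕜] homK φ ρ :=
    ∑ i, (homKMk ρ (β i) (h₁ i)).lTensor A ∘ₗ homKEval φ (trivTensorAct A ρ) (b i)
  have hB : ∀ g, B g = ∑ i, (homKMk ρ (β i) (h₁ i)).lTensor A (g.1 (b i)) := fun g => by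
    simp only [B, LinearMap.sum_apply, LinearMap.comp_apply]
    rfl
  have hsum : ∀ {U : Type u} [AddCommGroup U] [Module 𝕜 U] (σ : K →ₐ[𝕜] Module.End 𝕜 U)
      (f : homK φ σ) (h : H), ∑ i, σ (β i h) (f.1 (b i)) = f.1 h := fun σ f h => by
    conv_rhs => rw [← h₂ h, map_sum]
    exact Finset.sum_congr rfl fun i _ => (f.2 _ _).symm
  refine Function.bijective_iff_has_inverse.2 ⟨B, fun x => ?_, fun g => ?_⟩
  · rw [← LinearMap.comp_apply]
    refine LinearMap.congr_fun (TensorProduct.ext' (g := B ∘ₗ homKTensor φ A ρ)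
      (h := LinearMap.id) fun a f => ?_) x
    rw [LinearMap.comp_apply, hB]
    simp only [homKTensor_tmul_apply, LinearMap.lTensor_tmul, LinearMap.id_apply]
    rw [← TensorProduct.tmul_sum]
    congr 1
    refine Subtype.ext (LinearMap.ext fun h => ?_)
    rw [← hsum ρ f h, AddSubmonoidClass.coe_finsetSum, LinearMap.sum_apply]
    rfl
  · refine Subtype.ext (LinearMap.ext fun h => ?_)
    rw [hB, map_sum, AddSubmonoidClass.coe_finsetSum, LinearMap.sum_apply, ← hsum _ g h]
    refine Finset.sum_congr rfl fun i _ => ?_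
    rw [trivTensorAct_apply, homKTensor_apply,
      sw_lTensor _ _ _ (by intros; fun_prop) (by intros; fun_prop), linearMap_apply_eq_sw]
    rfl

/-- A `K`-linear map is determined by its values on the finitely many `b i`, so `Hom_K(H, V)` embeds
in `Vⁿ`. -/
theorem homK_finite (hφ : HasDualBasis φ) [Module.Finite 𝕜 V] : Module.Finite 𝕜 (homK φ ρ) := by
  obtain ⟨n, b, β, h₁, h₂⟩ := hφ
  let E : homK φ ρ →ₗ[𝕜] (Fin n → V) := LinearMap.pi fun i => homKEval φ ρ (b i)
  refine Module.Finite.of_injective E fun f g hfg => Subtype.ext (LinearMap.ext fun h => ?_)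
  have : ∀ i, f.1 (b i) = g.1 (b i) := fun i => congrFun hfg i
  rw [← h₂ h, map_sum, map_sum]
  refine Finset.sum_congr rfl fun i _ => ?_
  rw [f.2, g.2, this]

end HomK

/-! ### Invertibility of convolution with an action. -/

section Convolution
variable {𝕜 : Type u} [Field 𝕜] {H M : Type u} [Ring H] [HopfAlgebra 𝕜 H]
  [AddCommGroup M] [Module 𝕜 M]

/-- The map `h ↦ L(h₍₁₎) g(h₍₂₎)`. -/
noncomputable def convLeft (L : H →ₗ[𝕜] Module.End 𝕜 M) (g : H →ₗ[𝕜] M) : H →ₗ[𝕜] M :=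
  IsLinearMap.mk' (fun h => sw (Coalgebra.comul (R := 𝕜) h) (fun a b => L a (g b)))
    (by fun_prop)

theorem convLeft_apply (L : H →ₗ[𝕜] Module.End 𝕜 M) (g : H →ₗ[𝕜] M) (h : H) :
    convLeft L g h = sw (Coalgebra.comul (R := 𝕜) h) (fun a b => L a (g b)) := rfl

/-- The map `h ↦ L(h₍₂₎) g(h₍₁₎)`. -/
noncomputable def convRight (L : H →ₗ[𝕜] Module.End 𝕜 M) (g : H →ₗ[𝕜] M) : H →ₗ[𝕜] M :=
  IsLinearMap.mk' (fun h => sw (Coalgebra.comul (R := 𝕜) h) (fun a b => L b (g a)))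
    (by fun_prop)

theorem convRight_apply (L : H →ₗ[𝕜] Module.End 𝕜 M) (g : H →ₗ[𝕜] M) (h : H) :
    convRight L g h = sw (Coalgebra.comul (R := 𝕜) h) (fun a b => L b (g a)) := rfl

/-- An algebra map is convolution invertible with inverse its composite with `S`. For `convRight`
the legs are opposite and `S⁻¹` takes the place of `S`. -/
theorem convLeft_convLeft_antipode (L : H →ₐ[𝕜] Module.End 𝕜 M) (g : H →ₗ[𝕜] M) :
    convLeft L.toLinearMap (convLeft (L.toLinearMap ∘ₗ HopfAlgebra.antipode 𝕜) g) = g := by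
  ext h
  simp only [convLeft_apply, map_sw, LinearMap.comp_apply, AlgHom.toLinearMap_apply]
  rw [← sw_comul_coassoc h (fun a b c => L a (L (HopfAlgebra.antipode 𝕜 b) (g c)))
    (by intros; fun_prop) (by intros; fun_prop) (by intros; fun_prop)]
  simp only [← Module.End.mul_apply, ← map_mul]
  have e : ∀ (k : H) (m : M), sw (Coalgebra.comul (R := 𝕜) k)
      (fun a b => L (a * HopfAlgebra.antipode 𝕜 b) m) = Coalgebra.counit (R := 𝕜) k • m := fun k m =>
    (sw_mul_antipode k (fun x => L x m) (by fun_prop)).trans (by rw [map_one, Module.End.one_apply])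
  simp only [e]
  exact sw_counit_left h g (by fun_prop)

theorem convLeft_antipode_convLeft (L : H →ₐ[𝕜] Module.End 𝕜 M) (g : H →ₗ[𝕜] M) :
    convLeft (L.toLinearMap ∘ₗ HopfAlgebra.antipode 𝕜) (convLeft L.toLinearMap g) = g := by
  ext h
  simp only [convLeft_apply, map_sw, LinearMap.comp_apply, AlgHom.toLinearMap_apply]
  rw [← sw_comul_coassoc h (fun a b c => L (HopfAlgebra.antipode 𝕜 a) (L b (g c)))
    (by intros; fun_prop) (by intros; fun_prop) (by intros; fun_prop)]
  simp only [← Module.End.mul_apply, ← map_mul]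
  have e : ∀ (k : H) (m : M), sw (Coalgebra.comul (R := 𝕜) k)
      (fun a b => L (HopfAlgebra.antipode 𝕜 a * b) m) = Coalgebra.counit (R := 𝕜) k • m := fun k m =>
    (sw_antipode_mul k (fun x => L x m) (by fun_prop)).trans (by rw [map_one, Module.End.one_apply])
  simp only [e]
  exact sw_counit_left h g (by fun_prop)

variable [InvertibleAntipode 𝕜 H]

theorem convRight_convRight_antipodeInv (L : H →ₐ[𝕜] Module.End 𝕜 M) (g : H →ₗ[𝕜] M) :
    convRight L.toLinearMap (convRight (L.toLinearMap ∘ₗ antipodeInv 𝕜 H) g) = g := by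
  ext h
  simp only [convRight_apply, map_sw, LinearMap.comp_apply, AlgHom.toLinearMap_apply]
  rw [sw_comul_coassoc h (fun a b c => L c (L (antipodeInv 𝕜 H b) (g a)))
    (by intros; fun_prop) (by intros; fun_prop) (by intros; fun_prop)]
  simp only [← Module.End.mul_apply, ← map_mul]
  have e : ∀ (k : H) (m : M), sw (Coalgebra.comul (R := 𝕜) k)
      (fun a b => L (b * antipodeInv 𝕜 H a) m) = Coalgebra.counit (R := 𝕜) k • m := fun k m =>
    (sw_mul_antipodeInv k (fun x => L x m) (by fun_prop)).trans (by rw [map_one, Module.End.one_apply])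
  simp only [e]
  exact sw_counit_right h g (by fun_prop)

theorem convRight_antipodeInv_convRight (L : H →ₐ[𝕜] Module.End 𝕜 M) (g : H →ₗ[𝕜] M) :
    convRight (L.toLinearMap ∘ₗ antipodeInv 𝕜 H) (convRight L.toLinearMap g) = g := by
  ext h
  simp only [convRight_apply, map_sw, LinearMap.comp_apply, AlgHom.toLinearMap_apply]
  rw [sw_comul_coassoc h (fun a b c => L (antipodeInv 𝕜 H c) (L b (g a)))
    (by intros; fun_prop) (by intros; fun_prop) (by intros; fun_prop)]
  simp only [← Module.End.mul_apply, ← map_mul]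
  have e : ∀ (k : H) (m : M), sw (Coalgebra.comul (R := 𝕜) k)
      (fun a b => L (antipodeInv 𝕜 H b * a) m) = Coalgebra.counit (R := 𝕜) k • m := fun k m =>
    (sw_antipodeInv_mul k (fun x => L x m) (by fun_prop)).trans (by rw [map_one, Module.End.one_apply])
  simp only [e]
  exact sw_counit_right h g (by fun_prop)

end Convolution

/-! ### The adjunction between restriction and coinduction. -/

section Adjunction
variable {𝕜 : Type u} [Field 𝕜] {K H : Type u} [Ring K] [Ring H] [HopfAlgebra 𝕜 K]
  [HopfAlgebra 𝕜 H]
  (φ : K →ₐc[𝕜] H)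

/-- The unit `w ↦ (h ↦ h w)` of the adjunction between restriction and coinduction. -/
def coindUnit (W : LMod 𝕜 H) : W ⟶ (coind φ).obj ((resMod φ).obj W) where
  toLin :=
    { toFun := fun w => (⟨orbit W.act w, fun k h => by simp⟩ :
        homK φ (W.act.comp (φ : K →ₐ[𝕜] H)))
      map_add' := fun v w => Subtype.ext (LinearMap.ext fun h => (W.act h).map_add v w)
      map_smul' := fun c w => Subtype.ext (LinearMap.ext fun h => (W.act h).map_smul c w) }
  comm h := LinearMap.ext fun w => Subtype.ext (LinearMap.ext fun g =>
    congr($(W.act.map_mul g h) w).symm)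

/-- The counit `f ↦ f(1)` of the adjunction between restriction and coinduction. -/
def coindCounit (V : LMod 𝕜 K) : (resMod φ).obj ((coind φ).obj V) ⟶ V where
  toLin := homKEval φ V.act 1
  comm k := LinearMap.ext fun (f : homK φ V.act) => by
    change f.1 (1 * φ k) = V.act k (f.1 1)
    rw [← f.2, one_mul, mul_one]

/-- Coinduction is right adjoint to restriction. -/
def coindAdj : resMod φ ⊣ coind φ :=
  Adjunction.mkOfUnitCounit
    { unit :=
        { app := coindUnit φ
          naturality := fun V W f => LMod.hom_ext (LinearMap.ext fun v => Subtype.ext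
            (LinearMap.ext fun h => congr($(f.comm h) v).symm)) }
      counit :=
        { app := coindCounit φ
          naturality := fun V W f => rfl }
      left_triangle := by
        ext W : 2
        exact LMod.hom_ext (LinearMap.ext fun w => congr($(W.act.map_one) w))
      right_triangle := by
        ext V : 2
        refine LMod.hom_ext (LinearMap.ext fun (f : homK φ V.act) => Subtype.ext
          (LinearMap.ext fun h => ?_))
        change f.1 (1 * h) = f.1 h
        rw [one_mul] }

/-- The transpose of the two counits: evaluating at `h` means acting by `h` diagonally and then
evaluating both factors at `1`. -/
theorem coindAdj_lax (V W : LMod 𝕜 K) (f : homK φ V.act) (g : homK φ W.act) (h : H) :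
    ((lax (coindAdj φ) V W).toLin (f ⊗ₜ[𝕜] g) : homK φ (tensorAct V.act W.act)).1 h =
      sw (Coalgebra.comul (R := 𝕜) h) (fun a b => f.1 a ⊗ₜ[𝕜] g.1 b) := by
  have e : ((lax (coindAdj φ) V W).toLin (f ⊗ₜ[𝕜] g) : homK φ (tensorAct V.act W.act)).1 h =
      TensorProduct.map (homKEval φ V.act 1) (homKEval φ W.act 1)
        (tensorAct (homKAct φ V.act) (homKAct φ W.act) h (f ⊗ₜ g)) := rfl
  rw [e, tensorAct_tmul_eq_sw, map_sw]
  congr 1; funext a b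
  change f.1 (1 * a) ⊗ₜ[𝕜] g.1 (1 * b) = _
  rw [one_mul, one_mul]

theorem coindAdj_laxUnit (c : 𝕜) (h : H) :
    ((laxUnit (coindAdj φ)).toLin c : homK φ (unitAct 𝕜 K)).1 h =
      Coalgebra.counit (R := 𝕜) h * c := rfl

theorem coindAdj_lproj (A : LMod 𝕜 H) (X : LMod 𝕜 K) (z : A.carrier ⊗[𝕜] homK φ X.act) (h : H) :
    ((lproj (coindAdj φ) A X).toLin z :
      homK φ (tensorAct (A.act.comp (φ : K →ₐ[𝕜] H)) X.act)).1 h =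
      sw (Coalgebra.comul (R := 𝕜) h) (fun a b => sw z (fun p f => A.act a p ⊗ₜ[𝕜] f.1 b)) := by
  let g : A.carrier ⊗[𝕜] homK φ X.act →ₗ[𝕜] homK φ (tensorAct (A.act.comp (φ : K →ₐ[𝕜] H)) X.act) :=
    (lproj (coindAdj φ) A X).toLin
  have e : ((lproj (coindAdj φ) A X).toLin z :
      homK φ (tensorAct (A.act.comp (φ : K →ₐ[𝕜] H)) X.act)).1 h =
        (homKEval φ (tensorAct (A.act.comp (φ : K →ₐ[𝕜] H)) X.act) h ∘ₗ g) z := rfl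
  rw [e, linearMap_apply_eq_sw, sw_comm]
  congr 1; funext a f
  exact coindAdj_lax φ ((resMod φ).obj A) X ((coindUnit φ A).toLin a) f h

theorem coindAdj_rproj (X : LMod 𝕜 K) (A : LMod 𝕜 H) (z : homK φ X.act ⊗[𝕜] A.carrier) (h : H) :
    ((rproj (coindAdj φ) X A).toLin z :
      homK φ (tensorAct X.act (A.act.comp (φ : K →ₐ[𝕜] H)))).1 h =
      sw (Coalgebra.comul (R := 𝕜) h) (fun a b => sw z (fun f p => f.1 a ⊗ₜ[𝕜] A.act b p)) := by
  let g : homK φ X.act ⊗[𝕜] A.carrier →ₗ[𝕜] homK φ (tensorAct X.act (A.act.comp (φ : K →ₐ[𝕜] H))) :=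
    (rproj (coindAdj φ) X A).toLin
  have e : ((rproj (coindAdj φ) X A).toLin z :
      homK φ (tensorAct X.act (A.act.comp (φ : K →ₐ[𝕜] H)))).1 h =
        (homKEval φ (tensorAct X.act (A.act.comp (φ : K →ₐ[𝕜] H))) h ∘ₗ g) z := rfl
  rw [e, linearMap_apply_eq_sw, sw_comm]
  congr 1; funext f a
  exact coindAdj_lax φ X ((resMod φ).obj A) f ((coindUnit φ A).toLin a) h

end Adjunction

/-! ### The projection formula for coinduction -/

section CoindProjection
variable {𝕜 : Type u} [Field 𝕜] {K H : Type u} [Ring K] [Ring H] [HopfAlgebra 𝕜 K]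
  [HopfAlgebra 𝕜 H] (φ : K →ₐc[𝕜] H) {V A : Type u} [AddCommGroup V] [Module 𝕜 V]
  [AddCommGroup A] [Module 𝕜 A] (τ : H →ₐ[𝕜] Module.End 𝕜 A) (ρ : K →ₐ[𝕜] Module.End 𝕜 V)

variable (V) in
/-- The action `h (a ⊗ v) = h a ⊗ v`. -/
noncomputable def actLeft : H →ₐ[𝕜] Module.End 𝕜 (A ⊗[𝕜] V) :=
  (Module.endTensorEndAlgHom (R := 𝕜) (S := 𝕜) (A := 𝕜)).comp
    (Algebra.TensorProduct.includeLeft.comp τ)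

@[simp] theorem actLeft_tmul (h : H) (a : A) (v : V) :
    actLeft V τ h (a ⊗ₜ v) = τ h a ⊗ₜ[𝕜] v := rfl

variable (V) in
/-- The action `h (v ⊗ a) = v ⊗ h a`. -/
noncomputable def actRight : H →ₐ[𝕜] Module.End 𝕜 (V ⊗[𝕜] A) :=
  (Module.endTensorEndAlgHom (R := 𝕜) (S := 𝕜) (A := 𝕜)).comp
    (Algebra.TensorProduct.includeRight.comp τ)

@[simp] theorem actRight_tmul (h : H) (v : V) (a : A) :
    actRight V τ h (v ⊗ₜ a) = v ⊗ₜ[𝕜] τ h a := rfl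

/-- Identifies `lproj` with `homKTensor` followed by left convolution with the action on `A`. Both
factors are invertible, which is the projection formula. -/
theorem convLeft_actLeft (x : A ⊗[𝕜] homK φ ρ) (h : H) :
    convLeft (actLeft V τ).toLinearMap (homKTensor φ A ρ x).1 h =
      sw (Coalgebra.comul (R := 𝕜) h) (fun a b => sw x (fun p f => τ a p ⊗ₜ[𝕜] f.1 b)) := by
  simp only [convLeft_apply, homKTensor_apply, map_sw, AlgHom.toLinearMap_apply, actLeft_tmul]

theorem convRight_actRight (z : homK φ ρ ⊗[𝕜] A) (h : H) :
    convRight (actRight V τ).toLinearMap ((TensorProduct.comm 𝕜 A V).toLinearMap ∘ₗ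
        (homKTensor φ A ρ (TensorProduct.comm 𝕜 _ _ z)).1) h =
      sw (Coalgebra.comul (R := 𝕜) h) (fun a b => sw z (fun f p => f.1 a ⊗ₜ[𝕜] τ b p)) := by
  have e : ∀ a, (homKTensor φ A ρ (TensorProduct.comm 𝕜 _ _ z)).1 a =
      sw z (fun f p => p ⊗ₜ[𝕜] f.1 a) := fun a => by
    rw [homKTensor_apply, ← LinearEquiv.coe_coe,
      sw_linearMap _ _ _ (by intros; fun_prop) (by intros; fun_prop)]
    congr 1; funext f p
    exact sw_tmul _ _ _ (by intros; fun_prop) (by intros; fun_prop)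
  simp only [convRight_apply, LinearMap.comp_apply, e, map_sw, AlgHom.toLinearMap_apply,
    LinearEquiv.coe_coe, TensorProduct.comm_tmul, actRight_tmul]

theorem tensorAct_comp_apply (k : K) (t : A ⊗[𝕜] V) :
    tensorAct (τ.comp (φ : K →ₐ[𝕜] H)) ρ k t = sw (Coalgebra.comul (R := 𝕜) k) (fun a b =>
      actLeft V τ (φ a) (trivTensorAct A ρ b t)) := by
  rw [tensorAct_eq_sw]
  congr 1; funext a b
  conv_rhs => rw [← sw_tmul_self t, map_sw, map_sw]
  rfl

theorem tensorAct_comp_apply_right (k : K) (t : V ⊗[𝕜] A) :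
    tensorAct ρ (τ.comp (φ : K →ₐ[𝕜] H)) k t = sw (Coalgebra.comul (R := 𝕜) k) (fun a b =>
      actRight V τ (φ b) (actLeft A ρ a t)) := by
  rw [tensorAct_eq_sw]
  congr 1; funext a b
  conv_rhs => rw [← sw_tmul_self t, map_sw, map_sw]
  rfl

variable {φ}

/-- The inverse convolution changes the `K`-structure: for `g` linear for the diagonal action, the
legs `S(φ(k₍₁₎)) φ(k₍₂₎)` cancel on `A`, and only `k` acting on `V` survives. -/
theorem convLeft_antipode_mem (g : homK φ (tensorAct (τ.comp (φ : K →ₐ[𝕜] H)) ρ)) :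
    convLeft ((actLeft V τ).toLinearMap ∘ₗ HopfAlgebra.antipode 𝕜) g.1 ∈
      homK φ (trivTensorAct A ρ) := by
  intro k h
  simp only [convLeft_apply, LinearMap.comp_apply, AlgHom.toLinearMap_apply]
  simp (disch := intros; fun_prop) only [sw_comul_mul, sw_comul_bialgHom, g.2 _ _,
    HopfAlgebra.antipode_mul_antidistrib, map_mul, Module.End.mul_apply, tensorAct_comp_apply]
  rw [sw_comm, map_sw]
  congr 1; funext a b
  -- Regroup so that the first two legs of `k`, which act on `A`, are adjacent and come from one
  -- coproduct.
  simp only [map_sw]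
  rw [← sw_comul_coassoc k (fun p q r => actLeft V τ (HopfAlgebra.antipode 𝕜 a)
    (actLeft V τ (HopfAlgebra.antipode 𝕜 (φ p)) (actLeft V τ (φ q)
      (trivTensorAct A ρ r (g.1 b))))) (by intros; fun_prop) (by intros; fun_prop)
      (by intros; fun_prop)]
  have e : ∀ (k : K) (m : A ⊗[𝕜] V), sw (Coalgebra.comul (R := 𝕜) k) (fun p q =>
      actLeft V τ (HopfAlgebra.antipode 𝕜 a)
      (actLeft V τ (HopfAlgebra.antipode 𝕜 (φ p)) (actLeft V τ (φ q) m))) =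
        Coalgebra.counit (R := 𝕜) k • actLeft V τ (HopfAlgebra.antipode 𝕜 a) m := fun k m => by
    have h1 := sw_antipode_mul (𝕜 := 𝕜) (φ k) (fun x => actLeft V τ (HopfAlgebra.antipode 𝕜 a)
      (actLeft V τ x m)) (by fun_prop)
    rw [sw_comul_bialgHom φ k _ (by intros; fun_prop) (by intros; fun_prop),
      CoalgHomClass.counit_comp_apply] at h1
    simpa only [map_mul, Module.End.mul_apply, map_one, Module.End.one_apply] using h1
  simp only [e]
  rw [sw_counit_left k (fun r => actLeft V τ (HopfAlgebra.antipode 𝕜 a)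
    (trivTensorAct A ρ r (g.1 b))) (by fun_prop), trivTensorAct_apply, trivTensorAct_apply]
  conv_lhs => rw [← sw_tmul_self (g.1 b), map_sw, map_sw]
  conv_rhs => rw [← sw_tmul_self (g.1 b), map_sw, map_sw]
  rfl

/-- Mirror image of `convLeft_antipode_mem`: here `S⁻¹(φ(k₍₃₎)) φ(k₍₂₎)` cancels. The symmetry moves
`A` to the left, where `homKTensor` expects it. -/
theorem convRight_antipodeInv_mem [InvertibleAntipode 𝕜 H]
    (g : homK φ (tensorAct ρ (τ.comp (φ : K →ₐ[𝕜] H)))) :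
    (TensorProduct.comm 𝕜 V A).toLinearMap ∘ₗ
      convRight ((actRight V τ).toLinearMap ∘ₗ antipodeInv 𝕜 H) g.1 ∈
        homK φ (trivTensorAct A ρ) := by
  intro k h
  simp only [convRight_apply, LinearMap.comp_apply, AlgHom.toLinearMap_apply]
  simp (disch := intros; fun_prop) only [sw_comul_mul, sw_comul_bialgHom, g.2 _ _,
    antipodeInv_mul, map_mul, Module.End.mul_apply, tensorAct_comp_apply_right]
  rw [sw_comm, LinearEquiv.coe_coe, map_sw, map_sw, map_sw]
  congr 1; funext a b
  simp only [map_sw]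
  rw [sw_comul_coassoc k (fun p q r => TensorProduct.comm 𝕜 V A
    (actRight V τ (antipodeInv 𝕜 H b) (actRight V τ (antipodeInv 𝕜 H (φ r)) (actRight V τ (φ q)
      (actLeft A ρ p (g.1 a)))))) (by intros; fun_prop) (by intros; fun_prop)
      (by intros; fun_prop)]
  have e : ∀ (k : K) (m : V ⊗[𝕜] A), sw (Coalgebra.comul (R := 𝕜) k) (fun p q =>
      TensorProduct.comm 𝕜 V A (actRight V τ (antipodeInv 𝕜 H b)
      (actRight V τ (antipodeInv 𝕜 H (φ q)) (actRight V τ (φ p) m)))) =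
        Coalgebra.counit (R := 𝕜) k • TensorProduct.comm 𝕜 V A
          (actRight V τ (antipodeInv 𝕜 H b) m) := fun k m => by
    have h1 := sw_antipodeInv_mul (𝕜 := 𝕜) (φ k) (fun x => TensorProduct.comm 𝕜 V A
      (actRight V τ (antipodeInv 𝕜 H b) (actRight V τ x m))) (by fun_prop)
    rw [sw_comul_bialgHom φ k _ (by intros; fun_prop) (by intros; fun_prop),
      CoalgHomClass.counit_comp_apply] at h1
    simpa only [map_mul, Module.End.mul_apply, map_one, Module.End.one_apply] using h1
  simp only [e]
  rw [sw_counit_right k (fun r => TensorProduct.comm 𝕜 V A (actRight V τ (antipodeInv 𝕜 H b)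
    (actLeft A ρ r (g.1 a)))) (by fun_prop), trivTensorAct_apply]
  conv_lhs => rw [← sw_tmul_self (g.1 a), map_sw, map_sw, map_sw]
  conv_rhs => rw [← sw_tmul_self (g.1 a), map_sw, map_sw, map_sw]
  rfl

/-- Injectivity of `lproj` for an arbitrary action, stated elementwise. All later equalities in `A ⊗
Hom_K(H, V)` are proved by it, with `A` equal to `H` or `H ⊗ H`. -/
theorem eq_of_sw_act_left (hφ : HasDualBasis φ) {x y : A ⊗[𝕜] homK φ ρ}
    (hxy : ∀ h, sw (Coalgebra.comul (R := 𝕜) h)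
        (fun a b => sw x (fun p f => τ a p ⊗ₜ[𝕜] f.1 b)) =
      sw (Coalgebra.comul (R := 𝕜) h) (fun a b => sw y (fun p f => τ a p ⊗ₜ[𝕜] f.1 b))) :
    x = y := by
  simp only [← convLeft_actLeft] at hxy
  apply (homKTensor_bijective ρ hφ).1
  apply Subtype.ext
  rw [← convLeft_antipode_convLeft (actLeft V τ) (homKTensor φ A ρ x).1, LinearMap.ext hxy,
    convLeft_antipode_convLeft]

/-- Surjectivity of `lproj`, keeping track of the preimage: its image under `homKTensor` is the
convolution of `g` with the antipode. The explicit coaction formula is read off from this. -/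
theorem exists_sw_act_left (hφ : HasDualBasis φ)
    (g : homK φ (tensorAct (τ.comp (φ : K →ₐ[𝕜] H)) ρ)) : ∃ x : A ⊗[𝕜] homK φ ρ,
      homKTensor φ A ρ x =
        ⟨convLeft ((actLeft V τ).toLinearMap ∘ₗ HopfAlgebra.antipode 𝕜) g.1,
          convLeft_antipode_mem τ ρ g⟩ ∧
      ∀ h, sw (Coalgebra.comul (R := 𝕜) h)
        (fun a b => sw x (fun p f => τ a p ⊗ₜ[𝕜] f.1 b)) = g.1 h := by
  obtain ⟨x, hx⟩ := (homKTensor_bijective ρ hφ).2 ⟨_, convLeft_antipode_mem τ ρ g⟩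
  refine ⟨x, hx, fun h => ?_⟩
  rw [← convLeft_actLeft, hx, convLeft_convLeft_antipode]

theorem eq_of_sw_act_right [InvertibleAntipode 𝕜 H] (hφ : HasDualBasis φ)
    {x y : homK φ ρ ⊗[𝕜] A} (hxy : ∀ h, sw (Coalgebra.comul (R := 𝕜) h)
        (fun a b => sw x (fun f p => f.1 a ⊗ₜ[𝕜] τ b p)) =
      sw (Coalgebra.comul (R := 𝕜) h) (fun a b => sw y (fun f p => f.1 a ⊗ₜ[𝕜] τ b p))) :
    x = y := by
  simp only [← convRight_actRight] at hxy
  apply (TensorProduct.comm 𝕜 (homK φ ρ) A).injective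
  apply (homKTensor_bijective ρ hφ).1
  apply Subtype.ext
  have h1 := convRight_antipodeInv_convRight (actRight V τ)
    ((TensorProduct.comm 𝕜 A V).toLinearMap ∘ₗ
      (homKTensor φ A ρ (TensorProduct.comm 𝕜 _ _ x)).1)
  rw [LinearMap.ext hxy, convRight_antipodeInv_convRight] at h1
  exact LinearMap.ext fun h => (TensorProduct.comm 𝕜 A V).injective
    (LinearMap.congr_fun h1 h).symm

theorem exists_sw_act_right [InvertibleAntipode 𝕜 H] (hφ : HasDualBasis φ)
    (g : homK φ (tensorAct ρ (τ.comp (φ : K →ₐ[𝕜] H)))) : ∃ x : homK φ ρ ⊗[𝕜] A,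
      ∀ h, sw (Coalgebra.comul (R := 𝕜) h)
        (fun a b => sw x (fun f p => f.1 a ⊗ₜ[𝕜] τ b p)) = g.1 h := by
  obtain ⟨y, hy⟩ := (homKTensor_bijective ρ hφ).2 ⟨_, convRight_antipodeInv_mem τ ρ g⟩
  refine ⟨(TensorProduct.comm 𝕜 _ _).symm y, fun h => ?_⟩
  rw [← convRight_actRight, LinearEquiv.apply_symm_apply, hy, ← LinearMap.comp_assoc,
    show (TensorProduct.comm 𝕜 A V).toLinearMap ∘ₗ (TensorProduct.comm 𝕜 V A).toLinearMap =
      LinearMap.id from TensorProduct.ext' fun _ _ => rfl, LinearMap.id_comp,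
    convRight_convRight_antipodeInv]

theorem coindAdj_projectionFormula [InvertibleAntipode 𝕜 H] (hφ : HasDualBasis φ) :
    ProjectionFormula (coindAdj φ) := by
  refine ⟨fun A X => LMod.isIso_of_bijective _ ⟨fun x y hxy => ?_, fun z => ?_⟩,
    fun X A => LMod.isIso_of_bijective _ ⟨fun x y hxy => ?_, fun z => ?_⟩⟩
  · exact eq_of_sw_act_left A.act X.act hφ fun h => (coindAdj_lproj φ A X x h).symm.trans
      ((congrArg (fun f : homK φ (tensorAct (A.act.comp (φ : K →ₐ[𝕜] H)) X.act) => f.1 h)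
        hxy).trans (coindAdj_lproj φ A X y h))
  · obtain ⟨x, -, hx⟩ := exists_sw_act_left A.act X.act hφ z
    exact ⟨x, Subtype.ext (LinearMap.ext fun h => (coindAdj_lproj φ A X x h).trans (hx h))⟩
  · exact eq_of_sw_act_right A.act X.act hφ fun h => (coindAdj_rproj φ X A x h).symm.trans
      ((congrArg (fun f : homK φ (tensorAct X.act (A.act.comp (φ : K →ₐ[𝕜] H))) => f.1 h)
        hxy).trans (coindAdj_rproj φ X A y h))
  · obtain ⟨x, hx⟩ := exists_sw_act_right A.act X.act hφ z
    exact ⟨x, Subtype.ext (LinearMap.ext fun h => (coindAdj_rproj φ X A x h).trans (hx h))⟩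

end CoindProjection

/-! ### The Yetter--Drinfeld structure on coinduced modules -/

section HomKCoact
variable {𝕜 : Type u} [Field 𝕜] {K H : Type u} [Ring K] [Ring H] [HopfAlgebra 𝕜 K]
  [HopfAlgebra 𝕜 H] {φ : K →ₐc[𝕜] H} {V W P : Type u} [AddCommGroup V] [Module 𝕜 V]
  [AddCommGroup W] [Module 𝕜 W] [AddCommGroup P] [Module 𝕜 P]
  {ρ : K →ₐ[𝕜] Module.End 𝕜 V} {δ : V →ₗ[𝕜] K ⊗[𝕜] V}

theorem coindCoact_eq_sw (f : H →ₗ[𝕜] V) (h : H) : coindCoact φ δ f h =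
    sw (Coalgebra.comul (R := 𝕜) h) (fun a t => sw (Coalgebra.comul (R := 𝕜) t) (fun b c =>
      sw (δ (f b)) (fun k v => (HopfAlgebra.antipode 𝕜 a * (φ k * c)) ⊗ₜ[𝕜] v))) := by
  have e : ∀ a b c : H, coindCoactAux φ δ f ((a ⊗ₜ c) ⊗ₜ b) =
      sw (δ (f b)) (fun k v => (HopfAlgebra.antipode 𝕜 a * (φ k * c)) ⊗ₜ[𝕜] v) := fun a b c => by
    change LinearMap.rTensor V (LinearMap.mulLeft 𝕜 (HopfAlgebra.antipode 𝕜 a) ∘ₗ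
      LinearMap.mulRight 𝕜 c) ((φ : K →ₗ[𝕜] H).rTensor V (δ (f b))) = _
    rw [← LinearMap.comp_apply, ← LinearMap.rTensor_comp, linearMap_apply_eq_sw]
    rfl
  rw [coindCoact, LinearMap.comp_apply, comulTri]
  simp only [LinearMap.comp_apply]
  rw [linearMap_apply_eq_sw (LinearMap.lTensor H _) (Coalgebra.comul h)]
  simp only [LinearMap.lTensor_tmul, map_sw]
  congr 1; funext a t
  generalize (Coalgebra.comul t : H ⊗[𝕜] H) = s
  conv_lhs => rw [← sw_tmul_self s]
  simp only [map_sw, LinearEquiv.coe_coe, TensorProduct.comm_tmul,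
    isLinearMap_map_sw (isLinearMap_tmul_right isLinearMap_id _), TensorProduct.assoc_symm_tmul, e]

theorem isLinearMap_coindCoact (h : H) :
    IsLinearMap 𝕜 (fun f : H →ₗ[𝕜] V => coindCoact φ δ f h) := by
  simp only [coindCoact_eq_sw]
  fun_prop

/-- The map `h ↦ φ(f(h₍₁₎)⁽⁻¹⁾) h₍₂₎ ⊗ f(h₍₁₎)⁽⁰⁾`. -/
noncomputable def coindTwist (hV : IsYD ρ δ) (f : homK φ ρ) :
    homK φ (tensorAct ((Algebra.lmul 𝕜 H).comp (φ : K →ₐ[𝕜] H)) ρ) :=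
  ⟨IsLinearMap.mk' (fun h => sw (Coalgebra.comul (R := 𝕜) h) (fun a b => sw (δ (f.1 a))
    (fun k v => (φ k * b) ⊗ₜ[𝕜] v))) (by fun_prop), fun k h => by
    simp only [IsLinearMap.mk'_apply]
    simp (disch := intros; fun_prop) only [sw_comul_mul, sw_comul_bialgHom, f.2 _ _]
    rw [sw_comm, map_sw]
    congr 1; funext a b
    -- `K`-linearity for the diagonal action is the Yetter–Drinfeld condition of `V`: `(k₍₁₎ v)⁽⁻¹⁾
    -- k₍₂₎ ⊗ (k₍₁₎ v)⁽⁰⁾` is replaced by `k₍₁₎ v⁽⁻¹⁾ ⊗ k₍₂₎ v⁽⁰⁾`.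
    have h1 := hV.sw_eq k (f.1 a) (fun x v => (φ x * b) ⊗ₜ[𝕜] v) (by intros; fun_prop)
      (by intros; fun_prop)
    simp only [map_mul, mul_assoc] at h1
    rw [← h1, map_sw, sw_comm]
    simp only [tensorAct_tmul_eq_sw]
    rfl⟩

/-- The coaction is the preimage of `coindTwist hV f` under `lproj` with `A = H`. The first clause
is the explicit formula with `S`; the second is the relation from which the structure is derived. -/
theorem exists_homKCoact (hφ : HasDualBasis φ) (hV : IsYD ρ δ) (f : homK φ ρ) :
    ∃ x : H ⊗[𝕜] homK φ ρ, (homKTensor φ H ρ x).1 = coindCoact φ δ f.1 ∧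
      ∀ h, sw (Coalgebra.comul (R := 𝕜) h)
        (fun a b => sw x (fun p f' => (a * p) ⊗ₜ[𝕜] f'.1 b)) =
          sw (Coalgebra.comul (R := 𝕜) h) (fun a b => sw (δ (f.1 a))
            (fun k v => (φ k * b) ⊗ₜ[𝕜] v)) := by
  obtain ⟨x, h1, h2⟩ := exists_sw_act_left (Algebra.lmul 𝕜 H) ρ hφ (coindTwist hV f)
  refine ⟨x, ?_, h2⟩
  rw [h1]
  refine LinearMap.ext fun h => ?_
  rw [coindCoact_eq_sw]
  change sw (Coalgebra.comul (R := 𝕜) h) (fun a t => actLeft V (Algebra.lmul 𝕜 H)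
    (HopfAlgebra.antipode 𝕜 a) (sw (Coalgebra.comul (R := 𝕜) t) (fun a b => sw (δ (f.1 a))
    (fun k v => (φ k * b) ⊗ₜ[𝕜] v)))) = _
  simp only [map_sw, actLeft_tmul]
  rfl

/-- The coaction on `Hom_K(H, V)` for a Yetter--Drinfeld module `V`. -/
noncomputable def homKCoact (hφ : HasDualBasis φ) (hV : IsYD ρ δ) :
    homK φ ρ →ₗ[𝕜] H ⊗[𝕜] homK φ ρ :=
  IsLinearMap.mk' (fun f => (exists_homKCoact hφ hV f).choose)
    -- The chosen preimage is unique and its image depends linearly on `f`, so the choice is linear.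
    ⟨fun f g => (homKTensor_bijective ρ hφ).1 (Subtype.ext (by
      rw [map_add, (exists_homKCoact hφ hV (f + g)).choose_spec.1, Submodule.coe_add, Submodule.coe_add,
        (exists_homKCoact hφ hV f).choose_spec.1, (exists_homKCoact hφ hV g).choose_spec.1]
      exact LinearMap.ext fun h => (isLinearMap_coindCoact h).map_add f.1 g.1)),
    fun c f => (homKTensor_bijective ρ hφ).1 (Subtype.ext (by
      rw [map_smul, (exists_homKCoact hφ hV (c • f)).choose_spec.1, Submodule.coe_smul, Submodule.coe_smul,
        (exists_homKCoact hφ hV f).choose_spec.1]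
      exact LinearMap.ext fun h => (isLinearMap_coindCoact h).map_smul c f.1))⟩

variable (hφ : HasDualBasis φ) (hV : IsYD ρ δ)

theorem homKTensor_homKCoact (f : homK φ ρ) :
    (homKTensor φ H ρ (homKCoact hφ hV f)).1 = coindCoact φ δ f.1 :=
  (exists_homKCoact hφ hV f).choose_spec.1

/-- The defining relation `h₍₁₎ f⁽⁻¹⁾ ⊗ f⁽⁰⁾(h₍₂₎) = φ(f(h₍₁₎)⁽⁻¹⁾) h₍₂₎ ⊗ f(h₍₁₎)⁽⁰⁾`, paired with
a bilinear function. It replaces the coaction of `f` by that of its values. -/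
theorem sw_homKCoact (f : homK φ ρ) (h : H) (G : H → V → P)
    (h₁ : ∀ b, IsLinearMap 𝕜 (fun a => G a b)) (h₂ : ∀ a, IsLinearMap 𝕜 (fun b => G a b)) :
    sw (Coalgebra.comul (R := 𝕜) h) (fun a b => sw (homKCoact hφ hV f)
        (fun p f' => G (a * p) (f'.1 b))) =
      sw (Coalgebra.comul (R := 𝕜) h) (fun a b => sw (δ (f.1 a)) (fun k v => G (φ k * b) v)) := by
  have := congr(sw $((exists_homKCoact hφ hV f).choose_spec.2 h) G)
  simp only [sw_sw _ _ _ h₁ h₂, sw_tmul _ _ _ h₁ h₂] at this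
  exact this

/-- Apply the counit to the first leg of the defining relation and use the counit axiom of `V`. -/
theorem homKCoact_counit (hδ : IsCoact δ) (f : homK φ ρ) :
    sw (homKCoact hφ hV f) (fun p f' => Coalgebra.counit (R := 𝕜) p • f') = f := by
  refine Subtype.ext (LinearMap.ext fun h => ?_)
  have h1 := sw_homKCoact hφ hV f h (fun p v => Coalgebra.counit (R := 𝕜) p • v)
    (by intros; fun_prop) (by intros; fun_prop)
  have e1 : ∀ (a b : H) (v : V), Coalgebra.counit (R := 𝕜) (a * b) • v =
      Coalgebra.counit (R := 𝕜) a • (Coalgebra.counit (R := 𝕜) b • v) := fun a b v => by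
    rw [Bialgebra.counit_mul, mul_smul]
  have e2 : ∀ (k : K) (b : H) (v : V), Coalgebra.counit (R := 𝕜) (φ k * b) • v =
      Coalgebra.counit (R := 𝕜) k • (Coalgebra.counit (R := 𝕜) b • v) := fun a b v => by
    rw [e1, CoalgHomClass.counit_comp_apply]
  simp only [e2] at h1
  simp only [e1, ← isLinearMap_map_sw (isLinearMap_smul_right isLinearMap_id _)] at h1
  rw [sw_counit_left h (fun b => sw (homKCoact hφ hV f) fun p f' =>
    Coalgebra.counit (R := 𝕜) p • f'.1 b) (by fun_prop)] at h1
  simp (disch := fun_prop) only [hδ.sw_counit] at h1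
  rw [sw_counit_right h (fun b => f.1 b) (by fun_prop)] at h1
  rw [← h1, ← Submodule.subtype_apply, map_sw, ← LinearMap.applyₗ_apply_apply, map_sw]
  rfl

theorem lmul_tensor_comul (a p : H) :
    tensorAct (Algebra.lmul 𝕜 H) (Algebra.lmul 𝕜 H) a (Coalgebra.comul p) =
      Coalgebra.comul (R := 𝕜) (a * p) := by
  rw [tensorAct_eq_sw, ← sw_tmul_self (Coalgebra.comul (R := 𝕜) (a * p)),
    sw_comul_mul _ _ _ (by intros; fun_prop) (by intros; fun_prop)]
  rfl

/-- Both sides are compared through the injectivity of `lproj` for `A = H ⊗ H` with its diagonal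
action. One side applies the coproduct to the defining relation of `f`; the other applies that
relation twice, and the two meet by coassociativity in `V`. -/
theorem homKCoact_coassoc (hδ : IsCoact δ) (f : homK φ ρ) :
    sw (homKCoact hφ hV f) (fun a w => sw (Coalgebra.comul (R := 𝕜) a)
        (fun p q => p ⊗ₜ[𝕜] (q ⊗ₜ[𝕜] w))) =
      sw (homKCoact hφ hV f) (fun a w => a ⊗ₜ[𝕜] homKCoact hφ hV w) := by
  have e1 : ∀ (t : H ⊗[𝕜] H) (w : homK φ ρ), sw t (fun p q => p ⊗ₜ[𝕜] (q ⊗ₜ[𝕜] w)) =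
      TensorProduct.assoc 𝕜 H H (homK φ ρ) (t ⊗ₜ w) := fun t w => by
    conv_rhs => rw [← sw_tmul_self t]
    rw [isLinearMap_map_sw (isLinearMap_tmul_left isLinearMap_id _), map_sw]
    rfl
  have e2 : ∀ (a : H) (s : H ⊗[𝕜] homK φ ρ), a ⊗ₜ[𝕜] s =
      TensorProduct.assoc 𝕜 H H (homK φ ρ) (sw s fun q u => (a ⊗ₜ[𝕜] q) ⊗ₜ[𝕜] u) := fun a s => by
    conv_lhs => rw [← sw_tmul_self s]
    rw [isLinearMap_map_sw (isLinearMap_tmul_right isLinearMap_id _), map_sw]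
    rfl
  simp only [e1]
  conv_rhs => enter [2, a, w]; rw [e2]
  rw [← map_sw, ← map_sw]
  congr 1
  -- The diagonal action is chosen because `a` then sends `Δ(p)` to `Δ(a p)`.
  refine eq_of_sw_act_left (tensorAct (Algebra.lmul 𝕜 H) (Algebra.lmul 𝕜 H)) ρ hφ fun h => ?_
  simp (disch := intros; fun_prop) only [sw_sw, sw_tmul, lmul_tensor_comul, tensorAct_tmul_eq_sw]
  simp only [isLinearMap_map_sw (isLinearMap_tmul_left isLinearMap_id _)]
  rw [sw_homKCoact hφ hV f h (fun x v => Coalgebra.comul (R := 𝕜) x ⊗ₜ[𝕜] v)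
    (by intros; fun_prop) (by intros; fun_prop)]
  have hl : ∀ (x : H) (v : V), Coalgebra.comul (R := 𝕜) x ⊗ₜ[𝕜] v =
      sw (Coalgebra.comul (R := 𝕜) x) (fun c d => (c ⊗ₜ[𝕜] d) ⊗ₜ[𝕜] v) := fun x v => by
    rw [← isLinearMap_map_sw (isLinearMap_tmul_left isLinearMap_id _), sw_tmul_self]
  symm
  calc
    _ = sw (homKCoact hφ hV f) (fun p w => sw (homKCoact hφ hV w) (fun q u =>
          sw (Coalgebra.comul (R := 𝕜) h) (fun a b => sw (Coalgebra.comul (R := 𝕜) a)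
            (fun c d => ((c * p) ⊗ₜ[𝕜] (d * q)) ⊗ₜ[𝕜] u.1 b)))) := by
      rw [sw_comm]
      congr 1; funext p w
      rw [sw_comm]
      rfl
    _ = sw (homKCoact hφ hV f) (fun p w => sw (Coalgebra.comul (R := 𝕜) h) (fun c b =>
          sw (Coalgebra.comul (R := 𝕜) b) (fun d b => sw (homKCoact hφ hV w) (fun q u =>
            ((c * p) ⊗ₜ[𝕜] (d * q)) ⊗ₜ[𝕜] u.1 b)))) := by
      congr 1; funext p w
      rw [← sw_comul_coassoc h (fun c d b => sw (homKCoact hφ hV w) (fun q u =>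
        ((c * p) ⊗ₜ[𝕜] (d * q)) ⊗ₜ[𝕜] u.1 b)) (by intros; fun_prop) (by intros; fun_prop)
        (by intros; fun_prop), sw_comm]
      congr 1; funext a b
      rw [sw_comm]
    _ = sw (homKCoact hφ hV f) (fun p w => sw (Coalgebra.comul (R := 𝕜) h) (fun c b =>
          sw (Coalgebra.comul (R := 𝕜) b) (fun d b => sw (δ (w.1 d)) (fun k v =>
            ((c * p) ⊗ₜ[𝕜] (φ k * b)) ⊗ₜ[𝕜] v)))) := by
      congr 1; funext p w
      congr 1; funext c b
      exact sw_homKCoact hφ hV w b (fun x v => ((c * p) ⊗ₜ[𝕜] x) ⊗ₜ[𝕜] v)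
        (by intros; fun_prop) (by intros; fun_prop)
    _ = sw (Coalgebra.comul (R := 𝕜) h) (fun a b => sw (Coalgebra.comul (R := 𝕜) a) (fun c d =>
          sw (homKCoact hφ hV f) (fun p w => sw (δ (w.1 d)) (fun k v =>
            ((c * p) ⊗ₜ[𝕜] (φ k * b)) ⊗ₜ[𝕜] v)))) := by
      rw [sw_comul_coassoc h (fun c d b => sw (homKCoact hφ hV f) (fun p w =>
        sw (δ (w.1 d)) (fun k v => ((c * p) ⊗ₜ[𝕜] (φ k * b)) ⊗ₜ[𝕜] v)))
        (by intros; fun_prop) (by intros; fun_prop) (by intros; fun_prop), sw_comm]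
      congr 1; funext a b
      rw [sw_comm]
    _ = sw (Coalgebra.comul (R := 𝕜) h) (fun a b => sw (Coalgebra.comul (R := 𝕜) a) (fun c d =>
          sw (δ (f.1 c)) (fun l y => sw (δ y) (fun k v =>
            ((φ l * d) ⊗ₜ[𝕜] (φ k * b)) ⊗ₜ[𝕜] v)))) := by
      congr 1; funext a b
      exact sw_homKCoact hφ hV f a (fun x y => sw (δ y) (fun k v =>
        (x ⊗ₜ[𝕜] (φ k * b)) ⊗ₜ[𝕜] v)) (by intros; fun_prop) (by intros; fun_prop)
    _ = _ := by
      rw [sw_comul_coassoc h (fun c d b => sw (δ (f.1 c)) (fun l y => sw (δ y) (fun k v =>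
        ((φ l * d) ⊗ₜ[𝕜] (φ k * b)) ⊗ₜ[𝕜] v))) (by intros; fun_prop) (by intros; fun_prop)
        (by intros; fun_prop)]
      congr 1; funext a b
      simp (disch := intros; fun_prop) only [hl, sw_comul_mul, sw_comul_bialgHom]
      rw [hδ.sw_coassoc (f.1 a) (fun p q v => sw (Coalgebra.comul (R := 𝕜) b) (fun c d =>
        ((φ p * c) ⊗ₜ[𝕜] (φ q * d)) ⊗ₜ[𝕜] v)) (by intros; fun_prop) (by intros; fun_prop)
        (by intros; fun_prop), sw_comm]
      congr 1; funext l y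
      rw [sw_comm]

theorem homKCoact_isCoact (hδ : IsCoact δ) :
    IsCoact (V := homK φ ρ) (homKCoact hφ hV) :=
  isCoact_of_sw (homKCoact_coassoc hφ hV hδ) (homKCoact_counit hφ hV hδ)

theorem eq_of_sw_mul_left (hφ : HasDualBasis φ) {x y : H ⊗[𝕜] homK φ ρ}
    (hxy : ∀ h, sw (Coalgebra.comul (R := 𝕜) h)
        (fun a b => sw x (fun p f => (a * p) ⊗ₜ[𝕜] f.1 b)) =
      sw (Coalgebra.comul (R := 𝕜) h) (fun a b => sw y (fun p f => (a * p) ⊗ₜ[𝕜] f.1 b))) :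
    x = y :=
  eq_of_sw_act_left (Algebra.lmul 𝕜 H) ρ hφ hxy

/-- Convolved with `h`, both sides are given by the coaction of the values of `f` on the first leg
of `h g`: the left by the defining relation of `f` at `h g`, the right by that of `g₍₁₎ f` at `h`.
-/
theorem homKCoact_isYD : IsYD (V := homK φ ρ) (homKAct φ ρ) (homKCoact hφ hV) := by
  refine isYD_of_sw fun g f => eq_of_sw_mul_left hφ fun h => ?_
  simp (disch := intros; fun_prop) only [sw_sw, sw_tmul, homKAct_apply]
  have h1 := sw_homKCoact hφ hV f (h * g) (fun x v => x ⊗ₜ[𝕜] v) (by intros; fun_prop)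
    (by intros; fun_prop)
  simp (disch := intros; fun_prop) only [sw_comul_mul] at h1
  simp only [← mul_assoc]
  rw [h1, sw_comm]
  conv_rhs => rw [sw_comm]
  congr 1; funext a b
  have h2 := sw_homKCoact hφ hV (homKAct φ ρ a f) h (fun x v => (x * b) ⊗ₜ[𝕜] v)
    (by intros; fun_prop) (by intros; fun_prop)
  simp only [← mul_assoc]
  exact h2.symm


end HomKCoact

/-! ### Compatibility of the coaction with the lax structure and the braiding. -/

section
variable {𝕜 : Type u} [Field 𝕜] {K H : Type u} [Ring K] [Ring H] [HopfAlgebra 𝕜 K]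
  [HopfAlgebra 𝕜 H] {φ : K →ₐc[𝕜] H} {V W : Type u} [AddCommGroup V] [Module 𝕜 V]
  [AddCommGroup W] [Module 𝕜 W] {ρ : K →ₐ[𝕜] Module.End 𝕜 V} {δ : V →ₗ[𝕜] K ⊗[𝕜] V}
  {σ : K →ₐ[𝕜] Module.End 𝕜 W} {γ : W →ₗ[𝕜] K ⊗[𝕜] W}
  (hφ : HasDualBasis φ) (hV : IsYD ρ δ) (hW : IsYD σ γ)

/-- A criterion for colinearity of linear maps to `Hom_K(H, V)`. -/
theorem homKCoact_apply_eq {D : Type u} [AddCommMonoid D] [Module 𝕜 D] (T : D →ₗ[𝕜] homK φ ρ)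
    (d : D) (t : H ⊗[𝕜] D) (hT : ∀ h, sw (Coalgebra.comul (R := 𝕜) h) (fun a b =>
        sw (δ ((T d).1 a)) (fun k v => (φ k * b) ⊗ₜ[𝕜] v)) =
      sw (Coalgebra.comul (R := 𝕜) h) (fun a b => sw t (fun p d' => (a * p) ⊗ₜ[𝕜] (T d').1 b))) :
    homKCoact hφ hV (T d) = T.lTensor H t := by
  refine eq_of_sw_mul_left hφ fun h => ?_
  rw [sw_homKCoact hφ hV _ h (fun p v => p ⊗ₜ[𝕜] v) (by intros; fun_prop) (by intros; fun_prop), hT]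
  simp (disch := intros; fun_prop) only [sw_lTensor]

/-- The defining relation is used first for `f` and then for `g`, with coassociativity in `H`
regrouping the legs in between. -/
theorem homKCoact_mu (hVW : IsYD (tensorAct ρ σ) (tensorCoact δ γ))
    (T : homK φ ρ ⊗[𝕜] homK φ σ →ₗ[𝕜] homK φ (tensorAct ρ σ))
    (hT : ∀ (f : homK φ ρ) (g : homK φ σ) h, (T (f ⊗ₜ g)).1 h =
      sw (Coalgebra.comul (R := 𝕜) h) (fun a b => f.1 a ⊗ₜ[𝕜] g.1 b)) :
    homKCoact hφ hVW ∘ₗ T = T.lTensor H ∘ₗ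
      tensorCoact (V := homK φ ρ) (W := homK φ σ) (homKCoact hφ hV) (homKCoact hφ hW) := by
  refine TensorProduct.ext' fun f g => homKCoact_apply_eq hφ hVW T _ _ fun h => ?_
  simp (disch := intros; fun_prop) only [sw_tensorCoact, hT, map_sw, sw_sw]
  have hR : ∀ a b, sw (tensorCoact (V := homK φ ρ) (W := homK φ σ) (homKCoact hφ hV)
      (homKCoact hφ hW) (f ⊗ₜ g)) (fun p d' => (a * p) ⊗ₜ[𝕜] (T d').1 b) =
        sw (homKCoact hφ hV f) (fun p f' => sw (homKCoact hφ hW g) (fun q g' =>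
          sw (Coalgebra.comul (R := 𝕜) b) (fun c d =>
            (a * (p * q)) ⊗ₜ[𝕜] (f'.1 c ⊗ₜ[𝕜] g'.1 d)))) := fun a b => by
    refine (sw_tensorCoact _ _ f g _ (by intros; fun_prop) (fun p => isLinearMap_tmul_right
      (f := fun d' => (T d').1 b) 
        (homKEval φ (tensorAct ρ σ) b ∘ₗ T).isLinear _)).trans ?_
    simp only [hT, isLinearMap_map_sw (isLinearMap_tmul_right isLinearMap_id _)]
  simp only [hR]
  rw [sw_comul_coassoc h (fun c d b => sw (δ (f.1 c)) fun k v => sw (γ (g.1 d)) fun l w =>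
    (φ (k * l) * b) ⊗ₜ[𝕜] (v ⊗ₜ[𝕜] w)) (by intros; fun_prop) (by intros; fun_prop)
    (by intros; fun_prop)]
  symm
  calc
    _ = sw (Coalgebra.comul (R := 𝕜) h) (fun c t => sw (Coalgebra.comul (R := 𝕜) t) (fun d b =>
          sw (homKCoact hφ hV f) (fun p f' => sw (homKCoact hφ hW g) (fun q g' =>
            (c * (p * q)) ⊗ₜ[𝕜] (f'.1 d ⊗ₜ[𝕜] g'.1 b))))) := by
      congr 1; funext a b
      conv_rhs => rw [sw_comm]
      congr 1; funext p f'
      conv_rhs => rw [sw_comm]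
    _ = sw (Coalgebra.comul (R := 𝕜) h) (fun a b => sw (Coalgebra.comul (R := 𝕜) a) (fun c d =>
          sw (homKCoact hφ hV f) (fun p f' => sw (homKCoact hφ hW g) (fun q g' =>
            (c * p * q) ⊗ₜ[𝕜] (f'.1 d ⊗ₜ[𝕜] g'.1 b))))) := by
      simp only [mul_assoc]
      exact (sw_comul_coassoc h (fun c d b => sw (homKCoact hφ hV f) fun p f' =>
        sw (homKCoact hφ hW g) fun q g' => (c * (p * q)) ⊗ₜ[𝕜] (f'.1 d ⊗ₜ[𝕜] g'.1 b))
        (by intros; fun_prop) (by intros; fun_prop) (by intros; fun_prop)).symm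
    _ = sw (Coalgebra.comul (R := 𝕜) h) (fun a b => sw (Coalgebra.comul (R := 𝕜) a) (fun c d =>
          sw (δ (f.1 c)) (fun k v => sw (homKCoact hφ hW g) (fun q g' =>
            (φ k * d * q) ⊗ₜ[𝕜] (v ⊗ₜ[𝕜] g'.1 b))))) := by
      congr 1; funext a b
      exact sw_homKCoact hφ hV f a (fun x v => sw (homKCoact hφ hW g) (fun q g' =>
        (x * q) ⊗ₜ[𝕜] (v ⊗ₜ[𝕜] g'.1 b))) (by intros; fun_prop) (by intros; fun_prop)
    _ = sw (Coalgebra.comul (R := 𝕜) h) (fun a b => sw (δ (f.1 a)) (fun k v =>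
          sw (Coalgebra.comul (R := 𝕜) b) (fun c d => sw (homKCoact hφ hW g) (fun q g' =>
            (φ k * (c * q)) ⊗ₜ[𝕜] (v ⊗ₜ[𝕜] g'.1 d))))) := by
      simp only [mul_assoc]
      rw [sw_comul_coassoc h (fun c d b => sw (δ (f.1 c)) fun k v => sw (homKCoact hφ hW g)
        fun q g' => (φ k * (d * q)) ⊗ₜ[𝕜] (v ⊗ₜ[𝕜] g'.1 b)) (by intros; fun_prop)
        (by intros; fun_prop) (by intros; fun_prop)]
      congr 1; funext a b
      rw [sw_comm]
    _ = sw (Coalgebra.comul (R := 𝕜) h) (fun a b => sw (δ (f.1 a)) (fun k v =>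
          sw (Coalgebra.comul (R := 𝕜) b) (fun c d => sw (γ (g.1 c)) (fun l w =>
            (φ k * (φ l * d)) ⊗ₜ[𝕜] (v ⊗ₜ[𝕜] w))))) := by
      congr 1; funext a b
      congr 1; funext k v
      exact sw_homKCoact hφ hW g b (fun x w => (φ k * x) ⊗ₜ[𝕜] (v ⊗ₜ[𝕜] w))
        (by intros; fun_prop) (by intros; fun_prop)
    _ = _ := by
      simp only [map_mul, mul_assoc]
      congr 1; funext a b
      rw [sw_comm]

theorem homKCoact_eps (h1 : IsYD (unitAct 𝕜 K) (unitCoact 𝕜 K))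
    (T : 𝕜 →ₗ[𝕜] homK φ (unitAct 𝕜 K))
    (hT : ∀ (c : 𝕜) h, (T c).1 h = Coalgebra.counit (R := 𝕜) h * c) :
    homKCoact hφ h1 ∘ₗ T = T.lTensor H ∘ₗ unitCoact 𝕜 H := by
  refine LinearMap.ext fun c => (homKCoact_apply_eq hφ h1 T c (unitCoact 𝕜 H c) fun h => ?_ :)
  simp (disch := intros; fun_prop) only [hT, unitCoact, TensorProduct.mk_apply,
    sw_tmul, map_one, one_mul, mul_one]
  simp only [← smul_eq_mul, TensorProduct.tmul_smul]
  rw [sw_counit_left h (fun b => b ⊗ₜ[𝕜] c) (by fun_prop),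
    sw_counit_right h (fun b => b ⊗ₜ[𝕜] c) (by fun_prop)]

/-- At `h` the right side is `g(h₍₁₎ f⁽⁻¹⁾) ⊗ f⁽⁰⁾(h₍₂₎)`. The defining relation makes it
`g(φ(f(h₍₁₎)⁽⁻¹⁾) h₍₂₎) ⊗ f(h₍₁₎)⁽⁰⁾`, and `K`-linearity of `g` gives the braiding of the values. -/
theorem homKCoact_braid
    (T : homK φ ρ ⊗[𝕜] homK φ σ →ₗ[𝕜] homK φ (tensorAct ρ σ))
    (T' : homK φ σ ⊗[𝕜] homK φ ρ →ₗ[𝕜] homK φ (tensorAct σ ρ))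
    (hT : ∀ (f : homK φ ρ) (g : homK φ σ) h, (T (f ⊗ₜ g)).1 h =
      sw (Coalgebra.comul (R := 𝕜) h) (fun a b => f.1 a ⊗ₜ[𝕜] g.1 b))
    (hT' : ∀ (f : homK φ σ) (g : homK φ ρ) h, (T' (f ⊗ₜ g)).1 h =
      sw (Coalgebra.comul (R := 𝕜) h) (fun a b => f.1 a ⊗ₜ[𝕜] g.1 b))
    (B : homK φ (tensorAct ρ σ) →ₗ[𝕜] homK φ (tensorAct σ ρ))
    (hB : ∀ f h, (B f).1 h = braid δ σ (f.1 h)) :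
    B ∘ₗ T = T' ∘ₗ braid (U := homK φ ρ) (V := homK φ ρ) (W := homK φ σ) (homKCoact hφ hV)
      (homKAct φ σ) := by
  refine TensorProduct.ext' fun f g => Subtype.ext (LinearMap.ext fun h => ?_)
  have e : ∀ t, (T' t).1 h = (homKEval φ (tensorAct σ ρ) h) (T' t) := fun _ => rfl
  rw [LinearMap.comp_apply, LinearMap.comp_apply, hB, hT, braid_tmul_eq_sw, map_sw, e, map_sw,
    map_sw]
  simp only [← e, hT', homKAct_apply, braid_tmul_eq_sw]
  rw [sw_comm, sw_homKCoact hφ hV f h (fun x v => g.1 x ⊗ₜ[𝕜] v) (by intros; fun_prop)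
    (by intros; fun_prop)]
  simp only [g.2 _ _]

end

/-! ### The coinduction functor on Yetter--Drinfeld modules -/

section CoindFunctor
variable {𝕜 : Type u} [Field 𝕜] {K H : Type u} [Ring K] [Ring H] [HopfAlgebra 𝕜 K]
  [HopfAlgebra 𝕜 H] {φ : K →ₐc[𝕜] H} (hφ : HasDualBasis φ)

/-- The comodule underlying the coinduced Yetter--Drinfeld module. -/
noncomputable def coindYDComod (V : YD 𝕜 K) : LComod 𝕜 H :=
  ⟨homK φ V.act, homKCoact hφ V.isYD, homKCoact_isCoact hφ V.isYD V.isCoact⟩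

theorem sw_coindYDComod {P : Type u} [AddCommGroup P] [Module 𝕜 P] (V : YD 𝕜 K)
    (f : homK φ V.act) (h : H) (G : H → V.carrier → P)
    (h₁ : ∀ b, IsLinearMap 𝕜 (fun a => G a b)) (h₂ : ∀ a, IsLinearMap 𝕜 (fun b => G a b)) :
    sw (Coalgebra.comul (R := 𝕜) h) (fun a b => sw ((coindYDComod hφ V).coact f)
        (fun p (f' : homK φ V.act) => G (a * p) (f'.1 b))) =
      sw (Coalgebra.comul (R := 𝕜) h) (fun a b => sw (V.coact (f.1 a))
        (fun k v => G (φ k * b) v)) :=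
  sw_homKCoact hφ V.isYD f h G h₁ h₂

theorem coindYD_map_comm {V W : YD 𝕜 K} (t : V ⟶ W) :
    (coindYDComod hφ W).coact ∘ₗ ((coind φ).map ((YD.forgetLMod 𝕜 K).map t)).toLin =
      ((coind φ).map ((YD.forgetLMod 𝕜 K).map t)).toLin.lTensor H ∘ₗ
        (coindYDComod hφ V).coact := by
  refine LinearMap.ext fun (f : homK φ V.act) => eq_of_sw_mul_left hφ fun h => ?_
  let T : homK φ V.act →ₗ[𝕜] homK φ W.act := ((coind φ).map ((YD.forgetLMod 𝕜 K).map t)).toLin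
  have hT : ∀ (f : homK φ V.act) b, (T f).1 b = t.toLin (f.1 b) := fun _ _ => rfl
  change _ = sw (Coalgebra.comul (R := 𝕜) h) (fun a b => sw (T.lTensor H (homKCoact hφ V.isYD f))
    (fun p f => (a * p) ⊗ₜ[𝕜] f.1 b))
  simp (disch := intros; fun_prop) only [sw_lTensor, hT]
  refine (sw_coindYDComod hφ W (T f) h (fun p v => p ⊗ₜ[𝕜] v) (by intros; fun_prop)
    (by intros; fun_prop)).trans ?_
  rw [sw_homKCoact hφ V.isYD f h (fun p v => p ⊗ₜ[𝕜] t.toLin v) (by intros; fun_prop)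
    (by intros; fun_prop)]
  simp (disch := intros; fun_prop) only [hT, sw_colinear t.comm']

/-- Coinduction of Yetter--Drinfeld modules along `φ : K → H`. -/
noncomputable def coindYD : YD 𝕜 K ⥤ YD 𝕜 H where
  obj V :=
    { toLMod := (coind φ).obj V.toLMod
      coact := (coindYDComod hφ V).coact
      isCoact := (coindYDComod hφ V).isCoact
      isYD := homKCoact_isYD hφ V.isYD }
  map t :=
    { toLin := ((coind φ).map ((YD.forgetLMod 𝕜 K).map t)).toLin
      comm := ((coind φ).map ((YD.forgetLMod 𝕜 K).map t)).comm
      comm' := coindYD_map_comm hφ t }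
  map_id V := YD.hom_ext congr(LMod.Hom.toLin $((coind φ).map_id V.toLMod))
  map_comp f g := YD.hom_ext congr(LMod.Hom.toLin
    $((coind φ).map_comp ((YD.forgetLMod 𝕜 K).map f) ((YD.forgetLMod 𝕜 K).map g)))

theorem coindYD_mu_comm (V W : YD 𝕜 K) :
    (coindYDComod hφ (V ⊗ W)).coact ∘ₗ (lax (coindAdj φ) V.toLMod W.toLMod).toLin =
      (lax (coindAdj φ) V.toLMod W.toLMod).toLin.lTensor H ∘ₗ
        tensorCoact (coindYDComod hφ V).coact (coindYDComod hφ W).coact :=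
  homKCoact_mu hφ V.isYD W.isYD (V ⊗ W).isYD _ (coindAdj_lax φ V.toLMod W.toLMod)

theorem coindYD_eps_comm :
    (coindYDComod hφ (𝟙_ (YD 𝕜 K))).coact ∘ₗ (laxUnit (coindAdj φ)).toLin =
      (laxUnit (coindAdj φ)).toLin.lTensor H ∘ₗ unitCoact 𝕜 H :=
  homKCoact_eps hφ (𝟙_ (YD 𝕜 K)).isYD _ (coindAdj_laxUnit φ)

/-- The lax monoidal structure on coinduction of Yetter--Drinfeld modules. -/
noncomputable instance coindYDLaxMonoidal : (coindYD hφ).LaxMonoidal :=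
  letI := (coindAdj φ).rightAdjointLaxMonoidal
  { ε := ⟨(laxUnit (coindAdj φ)).toLin, (laxUnit (coindAdj φ)).comm, coindYD_eps_comm hφ⟩
    μ := fun V W => ⟨(lax (coindAdj φ) V.toLMod W.toLMod).toLin,
      (lax (coindAdj φ) V.toLMod W.toLMod).comm, coindYD_mu_comm hφ V W⟩
    -- As for comodules, coherence is inherited from the right adjoint, here `coind φ`.
    μ_natural_left := fun {_ _} f U => YD.hom_ext congr(LMod.Hom.toLin
      $(Functor.LaxMonoidal.μ_natural_left (coind φ) ((YD.forgetLMod 𝕜 K).map f) U.toLMod))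
    μ_natural_right := fun {_ _} U f => YD.hom_ext congr(LMod.Hom.toLin
      $(Functor.LaxMonoidal.μ_natural_right (coind φ) U.toLMod ((YD.forgetLMod 𝕜 K).map f)))
    associativity := fun V W U => YD.hom_ext congr(LMod.Hom.toLin
      $(Functor.LaxMonoidal.associativity (coind φ) V.toLMod W.toLMod U.toLMod))
    left_unitality := fun V => YD.hom_ext congr(LMod.Hom.toLin
      $(Functor.LaxMonoidal.left_unitality (coind φ) V.toLMod))
    right_unitality := fun V => YD.hom_ext congr(LMod.Hom.toLin
      $(Functor.LaxMonoidal.right_unitality (coind φ) V.toLMod)) }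

/-- The module underlying the coinduced Yetter--Drinfeld module is the coinduced module. -/
noncomputable def coindYDForget :
    coindYD hφ ⋙ YD.forgetLMod 𝕜 H ≅ YD.forgetLMod 𝕜 K ⋙ coind φ :=
  NatIso.ofComponents (fun _ => Iso.refl _) (fun _ => rfl)

theorem coindYD_halfBraiding (V : YD 𝕜 K) (A : LMod 𝕜 H) :
    YD.halfBraidingMod ((coindYD hφ).obj V) A ≫ (A ◁ (coindYDForget hφ).hom.app V) ≫
        lproj (coindAdj φ) A ((YD.forgetLMod 𝕜 K).obj V) =
      ((coindYDForget hφ).hom.app V ▷ A) ≫ rproj (coindAdj φ) ((YD.forgetLMod 𝕜 K).obj V) A ≫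
        (coind φ).map (YD.halfBraidingMod V ((resMod φ).obj A)) := by
  have h1 : (coindYDForget hφ).hom.app V ▷ A = 𝟙 _ := MonoidalCategory.id_whiskerRight _ _
  have h2 : A ◁ (coindYDForget hφ).hom.app V = 𝟙 _ := MonoidalCategory.whiskerLeft_id _ _
  rw [h1, h2]
  erw [Category.id_comp, Category.id_comp]
  apply LMod.hom_ext
  refine TensorProduct.ext' fun (f : homK φ V.act) (a : A.carrier) => Subtype.ext
    (LinearMap.ext fun h => ?_)
  refine (coindAdj_lproj φ A V.toLMod (braid (V := homK φ V.act) (homKCoact hφ V.isYD) A.act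
    (f ⊗ₜ a)) h).trans (Eq.trans ?_ congr(braid V.coact (A.act.comp (φ : K →ₐ[𝕜] H))
      $(coindAdj_rproj φ V.toLMod A (f ⊗ₜ a) h)).symm)
  -- The half-braiding identity is the defining relation paired with the action of `H` on `a`.
  have h3 := sw_homKCoact hφ V.isYD f h (fun x v => A.act x a ⊗ₜ[𝕜] v) (by intros; fun_prop)
    (by intros; fun_prop)
  simp (disch := intros; fun_prop) only [braid_tmul_eq_sw, sw_sw, sw_tmul, map_sw]
  simp only [map_mul, Module.End.mul_apply] at h3
  exact h3

variable [InvertibleAntipode 𝕜 K] [InvertibleAntipode 𝕜 H]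

noncomputable instance coindYDLaxBraided : (coindYD hφ).LaxBraided where
  braided V W := YD.hom_ext (homKCoact_braid hφ V.isYD (W := W.carrier) (σ := W.act) _ _
    (coindAdj_lax φ V.toLMod W.toLMod) (coindAdj_lax φ W.toLMod V.toLMod) _ fun _ _ => rfl)

end CoindFunctor

/-! ### The two halves of the main theorem -/

section
variable {𝕜 : Type u} [Field 𝕜] {K H : Type u} [Ring K] [Ring H]
    [HopfAlgebra 𝕜 K] [HopfAlgebra 𝕜 H] [InvertibleAntipode 𝕜 K] [InvertibleAntipode 𝕜 H]
    (φ : K →ₐc[𝕜] H)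

theorem comodule_induction :
    (∃ adj : resComod φ ⊣ indComod φ,
      (∀ (V : LComod 𝕜 K) (v : V.carrier),
        ((adj.unit.app V).toLin v : cotensor φ (resCoact φ V.coact)).1 = V.coact v) ∧
      (∀ (W : LComod 𝕜 H) (x : cotensor φ W.coact),
        (adj.counit.app W).toLin x =
          TensorProduct.lid 𝕜 W.carrier
            ((Coalgebra.counit (R := 𝕜) (A := K)).rTensor W.carrier x.1)) ∧
      -- the lax structure `(k ⊗ v) ⊗ (l ⊗ w) ↦ k l ⊗ (v ⊗ w)`, `c ↦ 1 ⊗ c`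
      (∀ (V W : LComod 𝕜 H) (x : cotensor φ V.coact) (y : cotensor φ W.coact),
        ((lax adj V W).toLin (x ⊗ₜ[𝕜] y) : cotensor φ (tensorCoact V.coact W.coact)).1 =
          mulTensor K V.carrier W.carrier (x.1 ⊗ₜ[𝕜] y.1)) ∧
      (∀ c : 𝕜, ((laxUnit adj).toLin c : cotensor φ (unitCoact 𝕜 H)).1 = 1 ⊗ₜ[𝕜] c) ∧
      ProjectionFormula adj ∧
      ∃ (F : YD 𝕜 H ⥤ YD 𝕜 K) (_ : F.LaxBraided)
        (e : F ⋙ YD.forgetLComod 𝕜 K ≅ YD.forgetLComod 𝕜 H ⋙ indComod φ),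
        -- the half-braidings of `F V` are induced by those of `V`
        (∀ (V : YD 𝕜 H) (A : LComod 𝕜 K),
          YD.halfBraidingComod (F.obj V) A ≫ (e.hom.app V ▷ A) ≫
              rproj adj ((YD.forgetLComod 𝕜 H).obj V) A =
            (A ◁ e.hom.app V) ≫ lproj adj A ((YD.forgetLComod 𝕜 H).obj V) ≫
              (indComod φ).map (YD.halfBraidingComod V ((resComod φ).obj A))) ∧
        -- the action `k (l ⊗ v) = k₍₁₎ l S(k₍₃₎) ⊗ φ(k₍₂₎) v`
        (∀ (V : YD 𝕜 H) (k : K) (x : (F.obj V).carrier),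
          ((e.hom.app V).toLin ((F.obj V).act k x) : cotensor φ V.coact).1 =
            indAct φ V.act k ((e.hom.app V).toLin x : cotensor φ V.coact).1) ∧
        -- the coaction `l ⊗ v ↦ l₍₁₎ ⊗ (l₍₂₎ ⊗ v)`
        (∀ (V : YD 𝕜 H) (x : (F.obj V).carrier),
          (cotensor φ V.coact).subtype.lTensor K
              ((e.hom.app V).toLin.lTensor K ((F.obj V).coact x)) =
            freeCoact 𝕜 K V.carrier ((e.hom.app V).toLin x : cotensor φ V.coact).1) ∧
        -- the lax structure of `F` is that of comodule induction
        (∀ (V W : YD 𝕜 H) (x : (F.obj V).carrier) (y : (F.obj W).carrier),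
          (e.hom.app (V ⊗ W)).toLin ((Functor.LaxMonoidal.μ F V W).toLin (x ⊗ₜ[𝕜] y)) =
            (lax adj ((YD.forgetLComod 𝕜 H).obj V) ((YD.forgetLComod 𝕜 H).obj W)).toLin
              ((e.hom.app V).toLin x ⊗ₜ[𝕜] (e.hom.app W).toLin y)) ∧
        (∀ c : 𝕜, (e.hom.app (𝟙_ (YD 𝕜 H))).toLin ((Functor.LaxMonoidal.ε F).toLin c) =
          (laxUnit adj).toLin c)) := by
  refine ⟨indAdj φ, fun V v => rfl, fun W x => rfl, fun V W x y => indAdj_lax φ V W x y,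
    fun c => rfl, indAdj_projectionFormula φ, indYD φ, indYDLaxBraided φ, indYDForget φ,
    indYD_halfBraiding φ, fun V k x => rfl, fun V x => ?_, fun V W x y => rfl, fun c => rfl⟩
  have h : ((indYDForget φ).hom.app V).toLin.lTensor K (((indYD φ).obj V).coact x) =
      ((indYD φ).obj V).coact x := LinearMap.lTensor_id_apply K _ _
  rw [h]
  exact LinearMap.congr_fun (cotensorCoact_spec φ V.coact) x
theorem module_coinduction :
    ((letI : Module K H := Module.compHom H ((φ : K →ₐ[𝕜] H) : K →+* H);
        Module.Finite K H ∧ Module.Projective K H) →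
      (∀ (W : Type u) [AddCommGroup W] [Module 𝕜 W] (V : LMod 𝕜 K),
        Function.Bijective (homKTensor φ W V.act)) ∧
      ∃ adj : resMod φ ⊣ coind φ,
        (∀ (W : LMod 𝕜 H) (w : W.carrier) (h : H),
          ((adj.unit.app W).toLin w : homK φ (W.act.comp (φ : K →ₐ[𝕜] H))).1 h = W.act h w) ∧
        (∀ (V : LMod 𝕜 K) (f : homK φ V.act), (adj.counit.app V).toLin f = f.1 1) ∧
        -- the lax structure `f ⊗ g ↦ (h ↦ f(h₍₁₎) ⊗ g(h₍₂₎))`, `c ↦ (h ↦ ε(h) c)`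
        (∀ (V W : LMod 𝕜 K) (f : homK φ V.act) (g : homK φ W.act) (h : H),
          ((lax adj V W).toLin (f ⊗ₜ[𝕜] g) : homK φ (tensorAct V.act W.act)).1 h =
            TensorProduct.map f.1 g.1 (Coalgebra.comul h)) ∧
        (∀ (c : 𝕜) (h : H), ((laxUnit adj).toLin c : homK φ (unitAct 𝕜 K)).1 h =
          Coalgebra.counit (R := 𝕜) h * c) ∧
        ProjectionFormula adj ∧
        ∃ (F : YD 𝕜 K ⥤ YD 𝕜 H) (_ : F.LaxBraided)
          (e : F ⋙ YD.forgetLMod 𝕜 H ≅ YD.forgetLMod 𝕜 K ⋙ coind φ),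
          -- the half-braidings of `F V` are induced by those of `V`
          (∀ (V : YD 𝕜 K) (A : LMod 𝕜 H),
            YD.halfBraidingMod (F.obj V) A ≫ (A ◁ e.hom.app V) ≫
                lproj adj A ((YD.forgetLMod 𝕜 K).obj V) =
              (e.hom.app V ▷ A) ≫ rproj adj ((YD.forgetLMod 𝕜 K).obj V) A ≫
                (coind φ).map (YD.halfBraidingMod V ((resMod φ).obj A))) ∧
          -- the coaction `f ↦ (h ↦ S(h₍₁₎) φ(f(h₍₂₎)⁽⁻¹⁾) h₍₃₎ ⊗ f(h₍₂₎)⁽⁰⁾)`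
          (∀ (V : YD 𝕜 K) (x : (F.obj V).carrier) (h : H),
            (homKTensor φ H V.act ((e.hom.app V).toLin.lTensor H ((F.obj V).coact x))).1 h =
              coindCoact φ V.coact ((e.hom.app V).toLin x : homK φ V.act).1 h) ∧
          -- the lax structure of `F` is that of coinduction
          (∀ (V W : YD 𝕜 K) (x : (F.obj V).carrier) (y : (F.obj W).carrier),
            (e.hom.app (V ⊗ W)).toLin ((Functor.LaxMonoidal.μ F V W).toLin (x ⊗ₜ[𝕜] y)) =
              (lax adj ((YD.forgetLMod 𝕜 K).obj V) ((YD.forgetLMod 𝕜 K).obj W)).toLin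
                ((e.hom.app V).toLin x ⊗ₜ[𝕜] (e.hom.app W).toLin y)) ∧
          (∀ c : 𝕜, (e.hom.app (𝟙_ (YD 𝕜 K))).toLin ((Functor.LaxMonoidal.ε F).toLin c) =
            (laxUnit adj).toLin c) ∧
          -- finite-dimensional Yetter--Drinfeld modules are preserved
          (∀ V : YD 𝕜 K, Module.Finite 𝕜 V.carrier → Module.Finite 𝕜 (F.obj V).carrier)) := by
  intro h
  have hφ := hasDualBasis_of_finite_projective φ h
  refine ⟨fun W _ _ V => homKTensor_bijective V.act hφ, coindAdj φ, fun W w h => rfl,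
    fun V f => rfl, fun V W f g h => ?_, coindAdj_laxUnit φ, coindAdj_projectionFormula hφ,
    coindYD hφ, coindYDLaxBraided hφ, coindYDForget hφ, coindYD_halfBraiding hφ, fun V x h => ?_,
    fun V W x y => rfl, fun c => rfl, fun V hV => homK_finite V.act hφ⟩
  · refine (coindAdj_lax φ V W f g h).trans ?_
    rw [linearMap_apply_eq_sw]
    rfl
  · have e : ((coindYDForget hφ).hom.app V).toLin.lTensor H (((coindYD hφ).obj V).coact x) =
        ((coindYD hφ).obj V).coact x := LinearMap.lTensor_id_apply H _ _
    rw [e]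
    exact LinearMap.congr_fun (homKTensor_homKCoact hφ V.isYD x) h

end

end HopfInd

theorem mainTheorem8 {𝕜 : Type u} [Field 𝕜] {K H : Type u} [Ring K] [Ring H]
    [HopfAlgebra 𝕜 K] [HopfAlgebra 𝕜 H] [InvertibleAntipode 𝕜 K] [InvertibleAntipode 𝕜 H]
    (φ : K →ₐc[𝕜] H) :
    -- comodule induction along an arbitrary Hopf algebra map
    (∃ adj : resComod φ ⊣ indComod φ,
      (∀ (V : LComod 𝕜 K) (v : V.carrier),
        ((adj.unit.app V).toLin v : cotensor φ (resCoact φ V.coact)).1 = V.coact v) ∧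
      (∀ (W : LComod 𝕜 H) (x : cotensor φ W.coact),
        (adj.counit.app W).toLin x =
          TensorProduct.lid 𝕜 W.carrier
            ((Coalgebra.counit (R := 𝕜) (A := K)).rTensor W.carrier x.1)) ∧
      -- the lax structure `(k ⊗ v) ⊗ (l ⊗ w) ↦ k l ⊗ (v ⊗ w)`, `c ↦ 1 ⊗ c`
      (∀ (V W : LComod 𝕜 H) (x : cotensor φ V.coact) (y : cotensor φ W.coact),
        ((lax adj V W).toLin (x ⊗ₜ[𝕜] y) : cotensor φ (tensorCoact V.coact W.coact)).1 =
          mulTensor K V.carrier W.carrier (x.1 ⊗ₜ[𝕜] y.1)) ∧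
      (∀ c : 𝕜, ((laxUnit adj).toLin c : cotensor φ (unitCoact 𝕜 H)).1 = 1 ⊗ₜ[𝕜] c) ∧
      ProjectionFormula adj ∧
      ∃ (F : YD 𝕜 H ⥤ YD 𝕜 K) (_ : F.LaxBraided)
        (e : F ⋙ YD.forgetLComod 𝕜 K ≅ YD.forgetLComod 𝕜 H ⋙ indComod φ),
        -- the half-braidings of `F V` are induced by those of `V`
        (∀ (V : YD 𝕜 H) (A : LComod 𝕜 K),
          YD.halfBraidingComod (F.obj V) A ≫ (e.hom.app V ▷ A) ≫
              rproj adj ((YD.forgetLComod 𝕜 H).obj V) A =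
            (A ◁ e.hom.app V) ≫ lproj adj A ((YD.forgetLComod 𝕜 H).obj V) ≫
              (indComod φ).map (YD.halfBraidingComod V ((resComod φ).obj A))) ∧
        -- the action `k (l ⊗ v) = k₍₁₎ l S(k₍₃₎) ⊗ φ(k₍₂₎) v`
        (∀ (V : YD 𝕜 H) (k : K) (x : (F.obj V).carrier),
          ((e.hom.app V).toLin ((F.obj V).act k x) : cotensor φ V.coact).1 =
            indAct φ V.act k ((e.hom.app V).toLin x : cotensor φ V.coact).1) ∧
        -- the coaction `l ⊗ v ↦ l₍₁₎ ⊗ (l₍₂₎ ⊗ v)`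
        (∀ (V : YD 𝕜 H) (x : (F.obj V).carrier),
          (cotensor φ V.coact).subtype.lTensor K
              ((e.hom.app V).toLin.lTensor K ((F.obj V).coact x)) =
            freeCoact 𝕜 K V.carrier ((e.hom.app V).toLin x : cotensor φ V.coact).1) ∧
        -- the lax structure of `F` is that of comodule induction
        (∀ (V W : YD 𝕜 H) (x : (F.obj V).carrier) (y : (F.obj W).carrier),
          (e.hom.app (V ⊗ W)).toLin ((Functor.LaxMonoidal.μ F V W).toLin (x ⊗ₜ[𝕜] y)) =
            (lax adj ((YD.forgetLComod 𝕜 H).obj V) ((YD.forgetLComod 𝕜 H).obj W)).toLin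
              ((e.hom.app V).toLin x ⊗ₜ[𝕜] (e.hom.app W).toLin y)) ∧
        (∀ c : 𝕜, (e.hom.app (𝟙_ (YD 𝕜 H))).toLin ((Functor.LaxMonoidal.ε F).toLin c) =
          (laxUnit adj).toLin c)) ∧
    -- coinduction of modules, when `H` is finitely generated projective over `K`
    ((letI : Module K H := Module.compHom H ((φ : K →ₐ[𝕜] H) : K →+* H);
        Module.Finite K H ∧ Module.Projective K H) →
      (∀ (W : Type u) [AddCommGroup W] [Module 𝕜 W] (V : LMod 𝕜 K),
        Function.Bijective (homKTensor φ W V.act)) ∧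
      ∃ adj : resMod φ ⊣ coind φ,
        (∀ (W : LMod 𝕜 H) (w : W.carrier) (h : H),
          ((adj.unit.app W).toLin w : homK φ (W.act.comp (φ : K →ₐ[𝕜] H))).1 h = W.act h w) ∧
        (∀ (V : LMod 𝕜 K) (f : homK φ V.act), (adj.counit.app V).toLin f = f.1 1) ∧
        -- the lax structure `f ⊗ g ↦ (h ↦ f(h₍₁₎) ⊗ g(h₍₂₎))`, `c ↦ (h ↦ ε(h) c)`
        (∀ (V W : LMod 𝕜 K) (f : homK φ V.act) (g : homK φ W.act) (h : H),
          ((lax adj V W).toLin (f ⊗ₜ[𝕜] g) : homK φ (tensorAct V.act W.act)).1 h =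
            TensorProduct.map f.1 g.1 (Coalgebra.comul h)) ∧
        (∀ (c : 𝕜) (h : H), ((laxUnit adj).toLin c : homK φ (unitAct 𝕜 K)).1 h =
          Coalgebra.counit (R := 𝕜) h * c) ∧
        ProjectionFormula adj ∧
        ∃ (F : YD 𝕜 K ⥤ YD 𝕜 H) (_ : F.LaxBraided)
          (e : F ⋙ YD.forgetLMod 𝕜 H ≅ YD.forgetLMod 𝕜 K ⋙ coind φ),
          -- the half-braidings of `F V` are induced by those of `V`
          (∀ (V : YD 𝕜 K) (A : LMod 𝕜 H),
            YD.halfBraidingMod (F.obj V) A ≫ (A ◁ e.hom.app V) ≫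
                lproj adj A ((YD.forgetLMod 𝕜 K).obj V) =
              (e.hom.app V ▷ A) ≫ rproj adj ((YD.forgetLMod 𝕜 K).obj V) A ≫
                (coind φ).map (YD.halfBraidingMod V ((resMod φ).obj A))) ∧
          -- the coaction `f ↦ (h ↦ S(h₍₁₎) φ(f(h₍₂₎)⁽⁻¹⁾) h₍₃₎ ⊗ f(h₍₂₎)⁽⁰⁾)`
          (∀ (V : YD 𝕜 K) (x : (F.obj V).carrier) (h : H),
            (homKTensor φ H V.act ((e.hom.app V).toLin.lTensor H ((F.obj V).coact x))).1 h =
              coindCoact φ V.coact ((e.hom.app V).toLin x : homK φ V.act).1 h) ∧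
          -- the lax structure of `F` is that of coinduction
          (∀ (V W : YD 𝕜 K) (x : (F.obj V).carrier) (y : (F.obj W).carrier),
            (e.hom.app (V ⊗ W)).toLin ((Functor.LaxMonoidal.μ F V W).toLin (x ⊗ₜ[𝕜] y)) =
              (lax adj ((YD.forgetLMod 𝕜 K).obj V) ((YD.forgetLMod 𝕜 K).obj W)).toLin
                ((e.hom.app V).toLin x ⊗ₜ[𝕜] (e.hom.app W).toLin y)) ∧
          (∀ c : 𝕜, (e.hom.app (𝟙_ (YD 𝕜 K))).toLin ((Functor.LaxMonoidal.ε F).toLin c) =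
            (laxUnit adj).toLin c) ∧
          -- finite-dimensional Yetter--Drinfeld modules are preserved
          (∀ V : YD 𝕜 K, Module.Finite 𝕜 V.carrier → Module.Finite 𝕜 (F.obj V).carrier)) :=
  ⟨comodule_induction φ, module_coinduction φ⟩
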